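/- **Conventions.** A *randomized logspace algorithm* is a probabilistic random-access Turing machine which, on every binary input $x$ of length $m$ (read-only, multiple access), uses $O(\log m)$ bits of working space and $\operatorname{poly}(m)$ time, has read-once access to a uniformly random bit string of length $\operatorname{poly}(m)$, and outputs one bit. A *deterministic logspace algorithm* is one that does not use random bits. For $s\ge 3$, ${\sf HG}^s(n,1/2)$ is the distribution of the random $s$-uniform hypergraph on $[n]$ in which each possible hyperedge is present independently with probability $1/2$. ${\sf HG}^s(n,1/2,k)$ is obtained by choosing $K\subseteq[n]$ uniformly among the $k$-element subsets, including all hyperedges contained in $K$, and including every other possible hyperedge independently with probability $1/2$. The clique leakage distribution ${\sf clHG}^s(n,1/2,k)$ is ${\sf HG}^s(n,1/2,k)$ conditioned on the event that the first $s-2$ vertices belong to $K$. *Conjecture* ${\sf HPC\text{-}Conj\text{-}Space}$: for every randomized logspace algorithm $\mathcal A$ with random string $r$, every constant integer $s\ge3$, and all sequences of non-decreasing positive integers $n=\omega(1)$ and $k\le n$ with $k=O(n^{1/2-\delta})$ for some constant $\delta>0$, $$\mathbb P_{A_G\sim {\sf HG}^s(n,1/2),\,r}\big(\mathcal A(\{n,k,A_G,s\},r)=0\big)+\mathbb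 P_{A_G\sim {\sf HG}^s(n,1/2,k),\,r}\big(\mathcal A(\{n,k,A_G,s\},r)=1\big)=1+o(1).$$ A deterministic logspace algorithm $\mathcal A$ *solves the clique leakage hypergraph planted clique recovery problem* for $s$ and the sequences $n,k$ if there is a constant $c>0$ such that, for all sufficiently large indices of the sequences, with probability at least $c$ over $G=\{n,k,A_G,s\}$ with $A_G\sim{\sf clHG}^s(n,1/2,k)$ with planted vertex set $K$, the following holds: for every vertex $v\in[n]$, $\mathcal A(\{G,v\})=1$ if $v\in K$ and $\mathcal A(\{G,v\})=0$ if $v\notin K$. **Lemma.** Let $s\ge3$ be an integer constant and $\delta>0$ a real constant, and let $n=\omega(1)$ and $k$ be non-decreasing sequences of positive integers with $k=\omega\big((\log n)^{1/(s-1)}\big)$ and $k=O(n^{1/2-\delta})$. If ${\sf HPC\text{-}Conj\text{-}Space}$ is true, then no deterministic logspace algorithm solves the clique leakage hypergraph planted clique recovery problem for $s$, $n$, $k$. -/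

import Mathlib

open MeasureTheory ProbabilityTheory Filter Asymptotics

namespace LogspacePC

/-! ### Random-access Turing machines with bounded work space -/

/-- A work tape: one-way infinite, its cells `0, 1, 2, …` hold bits, initially all `0`.
`ones` is the set of cells that hold a `1`, `head` is the cell scanned by the head. -/
structure Tape where
  ones : Finset ℕ
  head : ℕ

/-- Head movements. -/
inductive Move where
  | left
  | stay
  | right

namespace Tape

/-- The blank tape, with the head on its leftmost cell. -/
def blank : Tape := ⟨∅, 0⟩

/-- The bit in the scanned cell. -/
def bit (t : Tape) : Bool := decide (t.head ∈ t.ones)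

/-- Whether the head is at the left end of the tape. -/
def atLeftEnd (t : Tape) : Bool := decide (t.head = 0)

/-- The number that is written on the tape in binary, least significant bit in cell `0`. -/
def value (t : Tape) : ℕ := ∑ i ∈ t.ones, 2 ^ i

/-- Write the bit `b` into the scanned cell, then move the head
(a move to the left has no effect at the left end). -/
def act (t : Tape) (b : Bool) (m : Move) : Tape where
  ones := if b then insert t.head t.ones else t.ones.erase t.head
  head := match m with
    | .left => t.head - 1
    | .stay => t.head
    | .right => t.head + 1

end Tape

/-- A probabilistic random-access Turing machine. It has a finite control `State`, finitely many
work tapes (indexed by `Ix`), one of which is the address tape `addr`, and a read-only input.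
In each step it sees its state, for each work tape the scanned bit and whether the head is at the
left end, the input bit at the position that is written on the address tape (`none` if the input is
not that long), and one bit of the random string; it then changes state, and on each work tape
writes a bit and moves the head.
It has halted with output bit `b` as soon as it is in a state `q` with `output q = some b`. -/
structure Machine where
  State : Type
  Ix : Type
  finite_state : Finite State
  finite_ix : Finite Ix
  addr : Ix
  start : State
  output : State → Option Bool
  trans : State → (Ix → Bool × Bool) → Option Bool → Bool → State × (Ix → Bool × Move)

namespace Machine

variable (M : Machine)

/-- A configuration: the state of the control, and the work tapes. -/
structure Config where
  state : M.State
  tape : M.Ix → Tape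

/-- The initial configuration. -/
def init : M.Config := ⟨M.start, fun _ => Tape.blank⟩

/-- One step on input `x` that uses the random bit `b`. A machine that has halted stays put. -/
def step (x : List Bool) (c : M.Config) (b : Bool) : M.Config :=
  match M.output c.state with
  | some _ => c
  | none =>
    let a := M.trans c.state (fun t => ((c.tape t).bit, (c.tape t).atLeftEnd))
      x[(c.tape M.addr).value]? b
    ⟨a.1, fun t => (c.tape t).act (a.2 t).1 (a.2 t).2⟩

/-- The configuration reached on input `x` after reading the random string `r` once, from left to
right, one bit in each step; so this is the configuration after `r.length` steps. -/
def run (x r : List Bool) : M.Config := r.foldl (M.step x) M.init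

/-- The output after reading the random string `r` (`none` if the machine has not halted). -/
def result (x r : List Bool) : Option Bool := M.output (M.run x r).state

/-- The machine uses `O(log |x|)` bits of work space on every input `x`, whatever the random bits
are: on each of its (constantly many) work tapes, including the address tape, it visits only the
first `O(log |x|)` cells. -/
def IsLogspace : Prop :=
  ∃ c : ℕ, ∀ (x r : List Bool) (t : M.Ix),
    ((M.run x r).tape t).head < c * (Nat.log 2 x.length + 1)

/-- On every input `x`, whatever the random bits are, the machine has halted after
`T(|x|)` steps. -/
def HaltsWithin (T : Polynomial ℕ) : Prop :=
  ∀ x r : List Bool, r.length = T.eval x.length → (M.result x r).isSome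

/-- The random bits have no influence on the computation. -/
def IsDeterministic : Prop :=
  ∀ q v i b b', M.trans q v i b = M.trans q v i b'

end Machine

/-- The uniform distribution on a bit. -/
noncomputable def fairCoin : Measure Bool := (PMF.uniformOfFintype Bool).toMeasure

/-- A randomized logspace algorithm: a probabilistic random-access Turing machine that runs in
polynomial time and logarithmic work space. On an input of length `m` it gets a uniformly random
string of `time(m)` bits, which it reads once. -/
structure RandomizedLogspaceAlgorithm where
  machine : Machine
  time : Polynomial ℕ
  halts : machine.HaltsWithin time
  logspace : machine.IsLogspace

/-- The probability, over the uniformly random read-once string, that the algorithm outputs `b` on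
the input `x`. -/
noncomputable def RandomizedLogspaceAlgorithm.outputProb (A : RandomizedLogspaceAlgorithm)
    (x : List Bool) (b : Bool) : ℝ :=
  (Measure.pi fun _ : Fin (A.time.eval x.length) => fairCoin).real
    {r | A.machine.result x (List.ofFn r) = some b}

/-- A deterministic logspace algorithm: the same without the use of random bits. -/
structure DeterministicLogspaceAlgorithm extends RandomizedLogspaceAlgorithm where
  deterministic : machine.IsDeterministic

/-- The output bit of a deterministic logspace algorithm (it ignores the string of zeros that
is supplied in place of the random string). -/
def DeterministicLogspaceAlgorithm.result (A : DeterministicLogspaceAlgorithm)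
    (x : List Bool) : Option Bool :=
  A.machine.result x (List.replicate (A.time.eval x.length) false)

/-! ### Hypergraphs and planted cliques -/

/-- The possible hyperedges of an `s`-uniform hypergraph with vertex set `Fin n`. -/
abbrev Edge (n s : ℕ) : Type := {e : Finset (Fin n) // e.card = s}

/-- An `s`-uniform hypergraph with vertex set `Fin n`, given by its hyperedge indicators. -/
abbrev Hypergraph (n s : ℕ) : Type := Edge n s → Bool

/-- Every set of vertex sets is an event. -/
instance vertexSetMeasurableSpace (n : ℕ) : MeasurableSpace (Finset (Fin n)) := ⊤

/-- The Erdős–Rényi distribution `HG^s(n, 1/2)`: each possible hyperedge is present independently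
with probability `1/2`. -/
noncomputable def erdosRenyi (n s : ℕ) : Measure (Hypergraph n s) :=
  Measure.pi fun _ => fairCoin

/-- Add all hyperedges inside `K` to the hypergraph `G`. -/
def plant {n s : ℕ} (K : Finset (Fin n)) (G : Hypergraph n s) : Hypergraph n s :=
  fun e => decide (e.1 ⊆ K) || G e

/-- The planted distribution `HG^s(n, 1/2, k)`, as the joint law of the planted vertex set `K`
(uniform among the sets of `k` vertices) and the hypergraph. -/
noncomputable def plantedClique (n s k : ℕ) : Measure (Finset (Fin n) × Hypergraph n s) :=
  ((uniformOn {K : Finset (Fin n) | K.card = k}).prod (erdosRenyi n s)).map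
    fun p => (p.1, plant p.1 p.2)

/-- The clique leakage distribution `clHG^s(n, 1/2, k)`, as the joint law of the planted vertex set
and the hypergraph: the planted distribution, conditioned on the event that the first `s - 2`
vertices are in the planted vertex set. -/
noncomputable def leakedClique (n s k : ℕ) : Measure (Finset (Fin n) × Hypergraph n s) :=
  (plantedClique n s k)[|{p | ∀ v : Fin n, (v : ℕ) < s - 2 → v ∈ p.1}]

/-! ### Inputs as bit strings -/

/-- `1^m 0`. -/
def unary (m : ℕ) : List Bool := List.replicate m true ++ [false]

/-- The adjacency tensor: its entry at an `s`-tuple of vertices is `1` if and only if the vertices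
are distinct and form a hyperedge. -/
def Hypergraph.adj {n s : ℕ} (G : Hypergraph n s) (v : Fin s → Fin n) : Bool :=
  if h : (Finset.univ.image v).card = s then G ⟨Finset.univ.image v, h⟩ else false

/-- The input `{n, k, A_G, s}` of the detection problem: the parameters `n`, `k`, `s`, followed by
the `n ^ s` bits of the adjacency tensor; the entry at `(v_0, …, v_{s-1})` has position
`∑ i, v_i * n ^ i` among them. Its length is polynomial in `n` for constant `s` and `k ≤ n`. -/
def encode {n s : ℕ} (k : ℕ) (G : Hypergraph n s) : List Bool :=
  unary n ++ unary k ++ unary s ++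
    List.ofFn fun a : Fin (n ^ s) => Hypergraph.adj G (finFunctionFinEquiv.symm a)

/-- The input of a recovery algorithm: the input of the detection problem and a vertex. -/
def encodeWithVertex {n s : ℕ} (k : ℕ) (G : Hypergraph n s) (v : Fin n) : List Bool :=
  encode k G ++ unary v

/-! ### The hardness conjecture and the recovery problem -/

/-- The logspace hypergraph planted clique conjecture: for every randomized logspace algorithm,
every constant `s ≥ 3` and all sequences `n = ω(1)`, `k ≤ n` of non-decreasing positive integers
with `k = O(n ^ (1/2 - δ))` for a constant `δ > 0`,
`P_{HG^s(n,1/2)}(output 0) + P_{HG^s(n,1/2,k)}(output 1) = 1 + o(1)`. -/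
def HPCConjSpace : Prop :=
  ∀ (A : RandomizedLogspaceAlgorithm) (s : ℕ), 3 ≤ s →
  ∀ n k : ℕ → ℕ, Monotone n → Monotone k → (∀ i, 0 < n i) → (∀ i, 0 < k i) →
    Tendsto n atTop atTop → (∀ i, k i ≤ n i) →
    (∃ δ : ℝ, 0 < δ ∧
      (fun i => (k i : ℝ)) =O[atTop] fun i => (n i : ℝ) ^ ((1 : ℝ) / 2 - δ)) →
    Tendsto
      (fun i =>
        (∫ G, A.outputProb (encode (k i) G) false ∂(erdosRenyi (n i) s)) +
        ∫ p, A.outputProb (encode (k i) p.2) true ∂(plantedClique (n i) s (k i)))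
      atTop (nhds 1)

/-- The algorithm `A` solves the clique leakage hypergraph planted clique recovery problem: with at
least constant probability over the input `(K, G)`, it answers correctly for every vertex whether
that vertex is in the planted clique `K`. -/
def SolvesLeakedRecovery (A : DeterministicLogspaceAlgorithm) (s : ℕ) (n k : ℕ → ℕ) : Prop :=
  ∃ c : ℝ, 0 < c ∧ ∀ᶠ i in atTop,
    c ≤ (leakedClique (n i) s (k i)).real
      {p | ∀ v : Fin (n i),
        A.result (encodeWithVertex (k i) p.2 v) = some (decide (v ∈ p.1))}

end LogspacePC

/-! Suppose `A` recovers the clique under leakage with probability at least c. The leaked s - 2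
vertices can be guessed: there are at most n^(s-2) tuples, and s is constant. A detector therefore
tries every tuple, relabels the vertices so that the tuple comes first, runs `A` on every vertex,
and accepts if the returned vertices number k and span a clique (`Detects`).

On HG^s(n,1/2), acceptance forces a clique on k vertices (`exists_clique_of_detects`). The expected
number of these is C(n,k) 2^(-C(k,s)), at most 1/n once C(k,s) ≥ (k+1) log n, and the lower bound on
k guarantees this eventually (`tendsto_expected_cliques`). On the planted distribution, the detector
accepts at least as often as `A` succeeds under leakage (`leakedClique_le_plantedClique`): the
planted law is invariant under relabelling, and exactly k(k-1)...(k-s+3) tuples lie in K, so a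
double count over tuples compares the two. The two probabilities in the conjecture then add up to at
least 1 - o(1) + c.

Most of the work is to realize the detector as a logspace machine. A small loop language on
registers of O(log |x|) bits is compiled to machines (`Prog.exec_compile`, `Prog.exists_algorithm`).
Polynomial time comes for free, because a deterministic halting machine never repeats a
configuration. Bounded recursion (`LogComputable.iterate`) yields arithmetic, bounded sums and
bounded quantifiers. Finally `A` is simulated on the relabelled input, which is never stored: each
bit is recomputed on demand (`DeterministicLogspaceAlgorithm.logDecidable`, `logDecidable_detects`).
-/

namespace LogspacePC

/-! ### Fragments of machines -/

namespace Tape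

@[simp] lemma act_head_right (t : Tape) (b : Bool) : (t.act b .right).head = t.head + 1 := rfl

@[simp] lemma act_head_left (t : Tape) (b : Bool) : (t.act b .left).head = t.head - 1 := rfl

@[simp] lemma act_head_stay (t : Tape) (b : Bool) : (t.act b .stay).head = t.head := rfl

lemma act_bit_ones (t : Tape) (m : Move) : (t.act t.bit m).ones = t.ones := by
  unfold act bit
  by_cases h : t.head ∈ t.ones <;> simp [h]

@[simp] lemma act_bit_stay (t : Tape) : t.act t.bit .stay = t := by
  cases t with
  | mk o h => exact congrArg (fun o' => Tape.mk o' h) (act_bit_ones ⟨o, h⟩ .stay)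

end Tape

/-- What a machine sees of its work tapes. -/
def view {Ix : Type} (T : Ix → Tape) : Ix → Bool × Bool :=
  fun t => ((T t).bit, (T t).atLeftEnd)

/-- The effect of simultaneous actions on all tapes. -/
def actAll {Ix : Type} (T : Ix → Tape) (a : Ix → Bool × Move) : Ix → Tape :=
  fun t => (T t).act (a t).1 (a t).2

/-- A fragment of a deterministic machine: a finite control with an entry and an exit `none`. -/
structure Frag (Ix : Type) where
  Q : Type
  finite : Finite Q
  start : Q
  next : Q → (Ix → Bool × Bool) → Option Bool → Option Q × (Ix → Bool × Move)

namespace Frag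

variable {Ix : Type}

/-- One step of a fragment. -/
def step (F : Frag Ix) (addr : Ix) (x : List Bool) (q : F.Q) (T : Ix → Tape) :
    Option F.Q × (Ix → Tape) :=
  ((F.next q (view T) x[(T addr).value]?).1, actAll T (F.next q (view T) x[(T addr).value]?).2)

/-- The step relation, restricted to steps after which all heads are at positions `< ℓ`. -/
def Next (F : Frag Ix) (addr : Ix) (x : List Bool) (ℓ : ℕ)
    (c c' : Option F.Q × (Ix → Tape)) : Prop :=
  ∃ q, c.1 = some q ∧ c' = F.step addr x q c.2 ∧ ∀ t, (c'.2 t).head < ℓ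

/-- The fragment leads from the tapes `T` to the tapes `T'`, with all heads at positions `< ℓ`. -/
def Exec (F : Frag Ix) (addr : Ix) (x : List Bool) (ℓ : ℕ) (T T' : Ix → Tape) : Prop :=
  Relation.ReflTransGen (F.Next addr x ℓ) (some F.start, T) (none, T')

/-- A single step. -/
def act (a : (Ix → Bool × Bool) → Option Bool → Ix → Bool × Move) : Frag Ix where
  Q := Unit
  finite := inferInstance
  start := ()
  next _ v i := (none, a v i)

/-- One fragment after the other. -/
def seq (F G : Frag Ix) : Frag Ix where
  Q := F.Q ⊕ G.Q
  finite := by have := F.finite; have := G.finite; infer_instance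
  start := .inl F.start
  next q v i := match q with
    | .inl q => (some (((F.next q v i).1).elim (.inr G.start) .inl), (F.next q v i).2)
    | .inr q => ((G.next q v i).1.map .inr, (G.next q v i).2)

/-- Repeat a fragment while a condition on the scanned symbols holds. -/
def loop (c : (Ix → Bool × Bool) → Option Bool → Bool) (F : Frag Ix) : Frag Ix where
  Q := Option F.Q
  finite := by have := F.finite; infer_instance
  start := none
  next q v i := match q with
    | none => (if c v i then some (some F.start) else none, fun t => ((v t).1, .stay))
    | some q => (some (F.next q v i).1, (F.next q v i).2)

variable {addr : Ix} {x : List Bool} {ℓ : ℕ} {T T₁ T' : Ix → Tape}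

lemma exec_act (a : (Ix → Bool × Bool) → Option Bool → Ix → Bool × Move)
    (h : actAll T (a (view T) x[(T addr).value]?) = T') (hℓ : ∀ t, (T' t).head < ℓ) :
    (act a).Exec addr x ℓ T T' := by
  subst h
  exact .single ⟨(), rfl, rfl, hℓ⟩

/-- Both runs embed step by step. The exit `none` of `F` is sent to the entry of `G`, so the lifted
runs share their middle configuration. -/
lemma Exec.seq {F G : Frag Ix} (h₁ : F.Exec addr x ℓ T T₁) (h₂ : G.Exec addr x ℓ T₁ T') :
    (F.seq G).Exec addr x ℓ T T' := by
  have e₁ := Relation.ReflTransGen.lift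
    (p := (F.seq G).Next addr x ℓ)
    (fun c : Option F.Q × (Ix → Tape) =>
      ((some (c.1.elim (.inr G.start) .inl), c.2) : Option (F.seq G).Q × (Ix → Tape)))
    (by
      rintro ⟨_, T⟩ _ ⟨q, rfl, rfl, h⟩
      exact ⟨.inl q, rfl, rfl, h⟩) _ _ h₁
  have e₂ := Relation.ReflTransGen.lift
    (p := (F.seq G).Next addr x ℓ)
    (fun c : Option G.Q × (Ix → Tape) =>
      ((c.1.map .inr, c.2) : Option (F.seq G).Q × (Ix → Tape)))
    (by
      rintro ⟨_, T⟩ _ ⟨q, rfl, rfl, h⟩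
      exact ⟨.inr q, rfl, rfl, h⟩) _ _ h₂
  exact Relation.ReflTransGen.trans e₁ e₂

lemma actAll_stay (T : Ix → Tape) : actAll T (fun t => ((view T t).1, .stay)) = T := by
  funext t
  exact Tape.act_bit_stay _

lemma exec_loop_false {c : (Ix → Bool × Bool) → Option Bool → Bool} {F : Frag Ix}
    (hc : c (view T) x[(T addr).value]? = false) (hℓ : ∀ t, (T t).head < ℓ) :
    (loop c F).Exec addr x ℓ T T := by
  refine .single ⟨none, rfl, ?_, hℓ⟩
  simp [step, loop, hc, actAll_stay]

lemma Exec.loop_true {c : (Ix → Bool × Bool) → Option Bool → Bool} {F : Frag Ix}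
    (hc : c (view T) x[(T addr).value]? = true) (hℓ : ∀ t, (T t).head < ℓ)
    (h₁ : F.Exec addr x ℓ T T₁) (h₂ : (loop c F).Exec addr x ℓ T₁ T') :
    (loop c F).Exec addr x ℓ T T' := by
  have e₁ := Relation.ReflTransGen.lift
    (p := (loop c F).Next addr x ℓ)
    (fun d : Option F.Q × (Ix → Tape) => ((some d.1, d.2) : Option (loop c F).Q × (Ix → Tape)))
    (by
      rintro ⟨_, T⟩ _ ⟨q, rfl, rfl, h⟩
      exact ⟨some q, rfl, rfl, h⟩) _ _ h₁
  have e₀ : (loop c F).Next addr x ℓ (some (loop c F).start, T) (some (some F.start), T) := by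
    refine ⟨none, rfl, ?_, hℓ⟩
    simp [step, loop, hc, actAll_stay]
  exact (Relation.ReflTransGen.head e₀ e₁).trans h₂

/-! ### Sweeps over the tapes -/

/-- The tapes `T`, where those in `S` are replaced by tapes with contents `O` and head at `j`. -/
def swept (S : Ix → Bool) (T : Ix → Tape) (O : Ix → Finset ℕ) (j : ℕ) : Ix → Tape :=
  fun t => if S t then ⟨O t, j⟩ else T t

/-- Move the heads of the tapes in `S` to the right and write on them according to `w`, as long as
the condition `c` holds. -/
def sweep (S : Ix → Bool) (c : (Ix → Bool × Bool) → Bool)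
    (w : (Ix → Bool × Bool) → Ix → Bool) : Frag Ix :=
  loop (fun v _ => c v)
    (act fun v _ t => if S t then (w v t, .right) else ((v t).1, .stay))

/-- Move the heads of the tapes in `S` to the left, until the tape `u` is at its left end. -/
def home (S : Ix → Bool) (u : Ix) : Frag Ix :=
  loop (fun v _ => !(v u).2) (act fun v _ t => ((v t).1, if S t then .left else .stay))

lemma swept_head_lt {S : Ix → Bool} {O : Ix → Finset ℕ} {j : ℕ} (hT : ∀ t, (T t).head < ℓ)
    (hj : j < ℓ) (t : Ix) : (swept S T O j t).head < ℓ := by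
  unfold swept
  split
  · exact hj
  · exact hT t

lemma swept_bit {S : Ix → Bool} {O : Ix → Finset ℕ} {j : ℕ} {t : Ix} (hS : S t = true) :
    (view (swept S T O j) t).1 = decide (j ∈ O t) := by
  simp [view, swept, hS, Tape.bit]

/-- `O j` is the loop invariant: the contents of the tapes in `S` once their heads stand at `j`. The
induction is on the remaining distance `J - j`, because `Exec.loop_true` peels off the first
iteration. -/
lemma exec_sweep (S : Ix → Bool) (c : (Ix → Bool × Bool) → Bool)
    (w : (Ix → Bool × Bool) → Ix → Bool) (T : Ix → Tape) (O : ℕ → Ix → Finset ℕ) (J : ℕ)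
    (hT : ∀ t, (T t).head < ℓ) (hJ : J < ℓ)
    (htrue : ∀ j < J, c (view (swept S T (O j) j)) = true)
    (hfalse : c (view (swept S T (O J) J)) = false)
    (hstep : ∀ j < J, ∀ t, S t = true →
      (if w (view (swept S T (O j) j)) t then insert j (O j t) else (O j t).erase j)
        = O (j + 1) t) :
    (sweep S c w).Exec addr x ℓ (swept S T (O 0) 0) (swept S T (O J) J) := by
  have key : ∀ d j, j + d = J →
      (sweep S c w).Exec addr x ℓ (swept S T (O j) j) (swept S T (O J) J) := by
    intro d
    induction d with
    | zero =>
      intro j hj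
      obtain rfl : j = J := by omega
      exact exec_loop_false hfalse (swept_head_lt hT hJ)
    | succ d ih =>
      intro j hj
      refine Exec.loop_true (htrue j (by omega)) (swept_head_lt hT (by omega)) ?_
        (ih (j + 1) (by omega))
      refine exec_act _ ?_ (swept_head_lt hT (by omega))
      funext t
      by_cases hS : S t = true
      · simp only [actAll, hS, if_true, swept]
        have := hstep j (by omega) t hS
        simp only [Tape.act]
        rw [← this]
      · simp only [actAll, hS, swept]
        simp [view, swept, hS]
  exact key J 0 (by omega)

/-- The heads of the tapes in `S` move together, so testing the single tape `u` brings all of them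
home. -/
lemma exec_home (S : Ix → Bool) (u : Ix) (hu : S u = true) (T : Ix → Tape) (O : Ix → Finset ℕ)
    (hT : ∀ t, (T t).head < ℓ) : ∀ J < ℓ,
    (home S u).Exec addr x ℓ (swept S T O J) (swept S T O 0)
  | 0, hJ => exec_loop_false (by simp [view, swept, hu, Tape.atLeftEnd]) (swept_head_lt hT hJ)
  | J + 1, hJ => by
    refine Exec.loop_true (by simp [view, swept, hu, Tape.atLeftEnd]) (swept_head_lt hT hJ) ?_
      (exec_home S u hu T O hT J (by omega))
    refine exec_act _ ?_ (swept_head_lt hT (by omega))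
    funext t
    by_cases hS : S t = true
    · have h1 := Tape.act_bit_ones ⟨O t, J + 1⟩ .left
      simp only [actAll, hS, swept, view, if_true]
      exact congrArg (fun o => Tape.mk o J) h1
    · simp [actAll, view, swept, hS]

end Frag

end LogspacePC

namespace LogspacePC

/-! ### Arithmetic on the tapes -/

/-- All heads are at the left end, and all contents are in the first `L` cells, which are the ones
that are marked on the tape `ru`. -/
structure Ready {Ix : Type} (L : ℕ) (ru : Ix) (T : Ix → Tape) : Prop where
  head : ∀ t, (T t).head = 0
  ones : ∀ t, (T t).ones ⊆ Finset.range L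
  ruler : (T ru).ones = Finset.range L

lemma sum_range_two_pow_add_one (J : ℕ) : ∑ i ∈ Finset.range J, 2 ^ i + 1 = 2 ^ J := by
  induction J with
  | zero => rfl
  | succ J ih => rw [Finset.sum_range_succ, pow_succ]; omega

lemma Tape.value_lt {t : Tape} {L : ℕ} (h : t.ones ⊆ Finset.range L) : t.value < 2 ^ L := by
  have h1 : t.value ≤ ∑ i ∈ Finset.range L, 2 ^ i := Finset.sum_le_sum_of_subset h
  have h2 := sum_range_two_pow_add_one L
  omega

lemma Tape.value_eq_zero_iff {t : Tape} : t.value = 0 ↔ t.ones = ∅ := by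
  simp [Tape.value, Finset.sum_eq_zero_iff, Finset.eq_empty_iff_forall_notMem]

/-- The contents of a tape after its number has been decreased by one, where `J` is the position of
the lowest `1`. -/
lemma sum_borrow {o : Finset ℕ} {J : ℕ} (hJ : J ∈ o) (hmin : ∀ j < J, j ∉ o) :
    ∑ i ∈ (o ∪ Finset.range J).erase J, 2 ^ i + 1 = ∑ i ∈ o, 2 ^ i := by
  have h1 : (o ∪ Finset.range J).erase J = o.erase J ∪ Finset.range J := by
    ext i; simp only [Finset.mem_erase, Finset.mem_union, Finset.mem_range]; grind
  have h2 : Disjoint (o.erase J) (Finset.range J) := by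
    rw [Finset.disjoint_left]
    intro i hi hi'
    exact hmin i (Finset.mem_range.1 hi') (Finset.mem_of_mem_erase hi)
  rw [h1, Finset.sum_union h2, add_assoc, sum_range_two_pow_add_one, Finset.sum_erase_add _ _ hJ]

/-- Binary increment: the carry clears the ones below the first zero `J` and sets `J`; the balance
is the geometric sum `1 + 2 + ... + 2 ^ (J - 1) = 2 ^ J - 1`. -/
lemma sum_carry {o : Finset ℕ} {J : ℕ} (hJ : J ∉ o) (hmin : ∀ j < J, j ∈ o) :
    ∑ i ∈ insert J (o \ Finset.range J), 2 ^ i = ∑ i ∈ o, 2 ^ i + 1 := by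
  have h1 : Finset.range J ⊆ o := fun j hj => hmin j (Finset.mem_range.1 hj)
  rw [Finset.sum_insert (by simp [hJ]), ← Finset.sum_sdiff h1, ← sum_range_two_pow_add_one J]
  ring

variable {Ix : Type}

lemma Ready.swept_eq {L : ℕ} {ru : Ix} {T : Ix → Tape} (h : Ready L ru T) (S : Ix → Bool) :
    Frag.swept S T (fun t => (T t).ones) 0 = T := by
  funext t
  unfold Frag.swept
  split
  · rw [← h.head t]
  · rfl

variable [DecidableEq Ix]

lemma Ready.update {L : ℕ} {ru r : Ix} {T : Ix → Tape} (h : Ready L ru T) (hr : r ≠ ru)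
    {o : Finset ℕ} (ho : o ⊆ Finset.range L) : Ready L ru (Function.update T r ⟨o, 0⟩) := by
  refine ⟨fun t => ?_, fun t => ?_, ?_⟩
  · by_cases e : t = r
    · subst e; simp
    · simp [e, h.head]
  · by_cases e : t = r
    · subst e; simpa using ho
    · simpa [e] using h.ones t
  · rw [Function.update_of_ne hr.symm, h.ruler]

lemma Ready.swept_update {L : ℕ} {ru r : Ix} {T : Ix → Tape} (h : Ready L ru T) {S : Ix → Bool}
    (hS : S r = true) (o : Finset ℕ) :
    Frag.swept S T (fun t => if t = r then o else (T t).ones) 0 = Function.update T r ⟨o, 0⟩ := by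
  funext t
  unfold Frag.swept
  by_cases e : t = r
  · subst e; simp [hS]
  · rw [Function.update_of_ne e]
    simp only [e, if_false]
    split
    · rw [← h.head t]
    · rfl

namespace Frag

/-- The indicator of a set of two tapes. -/
def pair (a b : Ix) : Ix → Bool := fun t => decide (t = a ∨ t = b)

/-- The indicator of a set of three tapes. -/
def triple (a b c : Ix) : Ix → Bool := fun t => decide (t = a ∨ t = b ∨ t = c)

/-- Decrease the number on the tape `r` by one. -/
def dec (ru r : Ix) : Frag Ix :=
  seq (sweep (pair r ru) (fun v => (v ru).1 && !(v r).1)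
    (fun v t => if t = r then true else (v t).1))
  (seq (act fun v _ t => (if t = r then false else (v t).1, .stay))
    (home (pair r ru) ru))

/-- Set the cells of the tape `dst` according to those of `src`. -/
def setCells (ru dst src : Ix) (g : Bool → Bool) : Frag Ix :=
  seq (sweep (triple dst src ru) (fun v => (v ru).1)
    (fun v t => if t = dst then g (v src).1 else (v t).1))
  (home (triple dst src ru) ru)

/-- Write on the tape `fl` whether the number on the tape `r` is nonzero. -/
def test (ru fl r : Ix) : Frag Ix :=
  seq (sweep (pair r ru) (fun v => (v ru).1 && !(v r).1) (fun v t => (v t).1))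
  (seq (act fun v _ t => (if t = fl then (v ru).1 else (v t).1, .stay))
    (home (pair r ru) ru))

/-- Write on the first cell of the tape `dst` whether the scanned input bit is `1`. -/
def readInput (dst : Ix) : Frag Ix :=
  act fun v i t => (if t = dst then i == some true else (v t).1, .stay)

variable {addr : Ix} {x : List Bool} {ℓ L : ℕ} {T : Ix → Tape} {ru : Ix}

/-- `J = L` encodes that there is no `1`; a sweep guided by the ruler then stops just past the
marked cells. -/
lemma exists_lowest (o : Finset ℕ) (L : ℕ) (ho : o ⊆ Finset.range L) :
    ∃ J ≤ L, (∀ j < J, j ∉ o) ∧ (J = L ∧ o = ∅ ∨ J < L ∧ J ∈ o) := by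
  classical
  have hex : ∃ j, j ∈ o ∨ j = L := ⟨L, .inr rfl⟩
  refine ⟨Nat.find hex, Nat.find_min' hex (.inr rfl), fun j hj hjo =>
    Nat.find_min hex hj (.inl hjo), ?_⟩
  rcases Nat.find_spec hex with h | h
  · exact .inr ⟨Finset.mem_range.1 (ho h), h⟩
  · left
    refine ⟨h, Finset.eq_empty_of_forall_notMem fun j hj => ?_⟩
    exact Nat.find_min hex (m := j) (by rw [h]; exact Finset.mem_range.1 (ho hj)) (.inl hj)

/-- The borrow sets the zeros below the lowest `1` and clears that `1`. If the number is zero, the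
ruler stops the sweep at `J = L` with all cells set, which is `2 ^ L - 1`; the erasure at cell `L`
then has no effect. Hence the arithmetic modulo `2 ^ L`. -/
lemma exec_dec (h : Ready L ru T) (hℓ : L < ℓ) {r : Ix} (hr : r ≠ ru) :
    ∃ o ⊆ Finset.range L, ∑ i ∈ o, 2 ^ i = ((T r).value + (2 ^ L - 1)) % 2 ^ L ∧
      (dec ru r).Exec addr x ℓ T (Function.update T r ⟨o, 0⟩) := by
  obtain ⟨J, hJL, hmin, hJ⟩ := exists_lowest (T r).ones L (h.ones r)
  have hT : ∀ t, (T t).head < ℓ := fun t => by rw [h.head t]; omega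
  refine ⟨((T r).ones ∪ Finset.range J).erase J, ?_, ?_, ?_⟩
  · refine (Finset.erase_subset _ _).trans (Finset.union_subset (h.ones r) ?_)
    exact Finset.range_subset_range.2 hJL
  · have hlt := Tape.value_lt (h.ones r)
    rcases hJ with ⟨rfl, h0⟩ | ⟨_, hJo⟩
    · have h1 := sum_range_two_pow_add_one J
      have h2 : (T r).value = 0 := by rw [Tape.value, h0]; rfl
      rw [h0, h2, Finset.empty_union, Finset.erase_eq_of_notMem (by simp), zero_add,
        Nat.mod_eq_of_lt (by omega)]
      omega
    · have h1 := sum_borrow hJo hmin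
      have h2 : (T r).value = ∑ i ∈ (T r).ones, 2 ^ i := rfl
      have h3 : (T r).value + (2 ^ L - 1) =
        ∑ i ∈ ((T r).ones ∪ Finset.range J).erase J, 2 ^ i + 2 ^ L := by omega
      rw [h3, Nat.add_mod_right, Nat.mod_eq_of_lt (by omega)]
  · have hsr : pair r ru r = true := by simp [pair]
    have hsu : pair r ru ru = true := by simp [pair]
    refine Exec.seq (T₁ := swept (pair r ru) T
        (fun t => if t = r then (T r).ones ∪ Finset.range J else (T t).ones) J) ?_
      (Exec.seq (T₁ := swept (pair r ru) T
        (fun t => if t = r then ((T r).ones ∪ Finset.range J).erase J else (T t).ones) J) ?_ ?_)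
    · have := exec_sweep (addr := addr) (x := x) (pair r ru)
        (fun v => (v ru).1 && !(v r).1)
        (fun v t => if t = r then true else (v t).1) T
        (fun j t => if t = r then (T r).ones ∪ Finset.range j else (T t).ones) J hT
        (by omega) ?_ ?_ ?_
      · convert this using 1
        refine Eq.trans (h.swept_eq (pair r ru)).symm ?_
        congr 1
        funext t
        by_cases e : t = r
        · subst e; simp
        · simp [e]
      · intro j hj
        simp only [swept_bit hsr, swept_bit hsu, hr.symm, if_false, h.ruler, if_true]
        have := hmin j hj
        simp [this]
        omega
      · simp only [swept_bit hsr, swept_bit hsu, hr.symm, if_false, h.ruler, if_true]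
        rcases hJ with ⟨rfl, _⟩ | ⟨_, hJo⟩
        · simp
        · simp [hJo]
      · intro j hj t ht
        by_cases e : t = r
        · simp [e, Finset.range_add_one]
        · simp only [swept_bit ht, e, if_false]
          by_cases hjt : j ∈ (T t).ones <;> simp [hjt]
    · refine exec_act _ ?_ (swept_head_lt hT (by omega))
      funext t
      by_cases e : t = r
      · subst e
        simp [actAll, swept, Tape.act, hsr]
      · rw [actAll]
        simp only [e, if_false]
        have : (swept (pair r ru) T
          (fun t => if t = r then ((T r).ones ∪ Finset.range J).erase J else (T t).ones) J) t
          = (swept (pair r ru) T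
            (fun t => if t = r then (T r).ones ∪ Finset.range J else (T t).ones) J) t := by
          simp [swept, e]
        rw [this]
        exact Tape.act_bit_stay _
    · rw [← h.swept_update hsr]
      exact exec_home _ ru hsu T _ hT J (by omega)

lemma exec_setCells (h : Ready L ru T) (hℓ : L < ℓ) {dst src : Ix} (hd : dst ≠ ru)
    (hds : dst ≠ src) (g : Bool → Bool) :
    (setCells ru dst src g).Exec addr x ℓ T (Function.update T dst
      ⟨(Finset.range L).filter fun i => g (decide (i ∈ (T src).ones)), 0⟩) := by
  have hT : ∀ t, (T t).head < ℓ := fun t => by rw [h.head t]; omega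
  have hsd : triple dst src ru dst = true := by simp [triple]
  have hss : triple dst src ru src = true := by simp [triple]
  have hsu : triple dst src ru ru = true := by simp [triple]
  refine Exec.seq (T₁ := swept (triple dst src ru) T
      (fun t => if t = dst then (Finset.range L).filter fun i => g (decide (i ∈ (T src).ones))
        else (T t).ones) L) ?_ ?_
  · have := exec_sweep (addr := addr) (x := x) (triple dst src ru)
      (fun v => (v ru).1)
      (fun v t => if t = dst then g (v src).1 else (v t).1) T
      -- Invariant: the cells below `j` carry the new contents, the others still the old ones.
      (fun j t => if t = dst then ((Finset.range j).filter fun i => g (decide (i ∈ (T src).ones)))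
        ∪ ((T dst).ones \ Finset.range j) else (T t).ones) L hT hℓ ?_ ?_ ?_
    · convert this using 1
      · refine Eq.trans (h.swept_eq (triple dst src ru)).symm ?_
        congr 1
        funext t
        by_cases e : t = dst
        · subst e; simp
        · simp [e]
      · congr 1
        funext t
        by_cases e : t = dst
        · simp [e, Finset.sdiff_eq_empty_iff_subset.2 (h.ones dst)]
        · simp [e]
    · intro j hj
      simp only [swept_bit hsu, hd.symm, if_false, h.ruler]
      simpa using hj
    · simp only [swept_bit hsu, hd.symm, if_false, h.ruler]
      simp
    · intro j hj t ht
      by_cases e : t = dst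
      · simp only [e, if_true, swept_bit hss, hds.symm, if_false]
        ext i
        by_cases hg : g (decide (j ∈ (T src).ones)) = true
        · simp only [hg, if_true, Finset.mem_insert, Finset.mem_union, Finset.mem_filter,
            Finset.mem_range, Finset.mem_sdiff]
          rcases lt_trichotomy i j with hij | rfl | hij
          · simp [hij, hij.ne, Nat.lt_succ_of_lt hij]
          · simp [hg]
          · simp [hij.ne', show ¬ i < j + 1 by omega, show ¬ i < j by omega]
        · simp only [hg, Finset.mem_union, Finset.mem_filter, Finset.mem_range,
            Finset.mem_sdiff]
          rcases lt_trichotomy i j with hij | rfl | hij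
          · simp [hij, hij.ne, Nat.lt_succ_of_lt hij]
          · simp [hg]
          · simp [hij.ne', show ¬ i < j + 1 by omega, show ¬ i < j by omega]
      · simp only [swept_bit ht, e, if_false]
        by_cases hjt : j ∈ (T t).ones <;> simp [hjt]
  · rw [← h.swept_update hsd]
    exact exec_home _ ru hsu T _ hT L hℓ

/-- The sweep stops at the lowest `1` of `r` or just past the marked cells, and the ruler bit at
that place tells the two cases apart. Only cell `0` of `fl` is written and the rest is left over, so
nothing is claimed beyond `0 ∈ o`. -/
lemma exec_test (h : Ready L ru T) (hℓ : L < ℓ) (hL : 0 < L) {r fl : Ix}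
    (hf : fl ≠ ru) (hfr : fl ≠ r) :
    ∃ o ⊆ Finset.range L, (0 ∈ o ↔ (T r).value ≠ 0) ∧
      (test ru fl r).Exec addr x ℓ T (Function.update T fl ⟨o, 0⟩) := by
  obtain ⟨J, hJL, hmin, hJ⟩ := exists_lowest (T r).ones L (h.ones r)
  have hT : ∀ t, (T t).head < ℓ := fun t => by rw [h.head t]; omega
  refine ⟨if J < L then insert 0 (T fl).ones else (T fl).ones.erase 0, ?_, ?_, ?_⟩
  · split
    · exact Finset.insert_subset (Finset.mem_range.2 hL) (h.ones fl)
    · exact (Finset.erase_subset _ _).trans (h.ones fl)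
  · rw [Ne, Tape.value_eq_zero_iff]
    rcases hJ with ⟨rfl, h0⟩ | ⟨hJ', hJo⟩
    · simp [h0]
    · simp [hJ', Finset.ne_empty_of_mem hJo]
  · have hsr : pair r ru r = true := by simp [pair]
    have hsu : pair r ru ru = true := by simp [pair]
    have hsf : pair r ru fl = false := by simp [pair, hf, hfr]
    refine Exec.seq (T₁ := swept (pair r ru) T
        (fun t => (T t).ones) J) ?_
      (Exec.seq (T₁ := swept (pair r ru) (Function.update T fl
        ⟨if J < L then insert 0 (T fl).ones else (T fl).ones.erase 0, 0⟩)
        (fun t => (T t).ones) J) ?_ ?_)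
    · have := exec_sweep (addr := addr) (x := x) (pair r ru)
        (fun v => (v ru).1 && !(v r).1)
        (fun v t => (v t).1) T (fun _ t => (T t).ones) J hT
        (by omega) ?_ ?_ ?_
      · rwa [h.swept_eq] at this
      · intro j hj
        simp only [swept_bit hsr, swept_bit hsu, h.ruler]
        have := hmin j hj
        simp [this]
        omega
      · simp only [swept_bit hsr, swept_bit hsu, h.ruler]
        rcases hJ with ⟨rfl, _⟩ | ⟨_, hJo⟩
        · simp
        · simp [hJo]
      · intro j hj t ht
        simp only [swept_bit ht]
        by_cases hjt : j ∈ (T t).ones <;> simp [hjt]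
    · refine exec_act _ ?_ (swept_head_lt (fun t => ?_) (by omega))
      · funext t
        rw [actAll]
        by_cases e : t = fl
        · subst e
          simp only [if_true, swept_bit hsu, h.ruler, Finset.mem_range]
          simp [swept, hsf, Tape.act, h.head]
        · simp only [e, if_false]
          have : swept (pair r ru) (Function.update T fl
            ⟨if J < L then insert 0 (T fl).ones else (T fl).ones.erase 0, 0⟩)
            (fun t => (T t).ones) J t =
            swept (pair r ru) T (fun t => (T t).ones) J t := by
            simp [swept, e]
          rw [this]
          exact Tape.act_bit_stay _
      · by_cases e : t = fl
        · subst e; simp; omega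
        · simpa [e] using hT t
    · have := exec_home (addr := addr) (x := x) (ℓ := ℓ) (pair r ru) ru hsu (Function.update T fl
        ⟨if J < L then insert 0 (T fl).ones else (T fl).ones.erase 0, 0⟩)
        (fun t => (T t).ones) (fun t => ?_) J (by omega)
      · convert this using 1
        funext t
        by_cases e : t = fl
        · subst e
          simp [swept, hsf]
        · simp only [swept, Function.update_of_ne e]
          split
          · rw [← h.head t]
          · rfl
      · by_cases e : t = fl
        · subst e; simp; omega
        · simpa [e] using hT t

/-- Only one cell is written, so `dst` has to be blank for its number to become `0` or `1`. -/
lemma exec_readInput (h : Ready L ru T) (hℓ : L < ℓ) {dst : Ix} (h0 : (T dst).ones = ∅) :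
    (readInput dst).Exec addr x ℓ T (Function.update T dst
      ⟨if x[(T addr).value]? = some true then {0} else ∅, 0⟩) := by
  refine exec_act _ ?_ fun t => ?_
  · funext t
    rw [actAll]
    by_cases e : t = dst
    · subst e
      by_cases hx : x[(T addr).value]? = some true
      · simp [hx, Tape.act, h.head, h0]
      · simp [hx, Tape.act, h.head, h0]
    · simp only [e, if_false, Function.update_of_ne e]
      exact Tape.act_bit_stay _
  · by_cases e : t = dst
    · subst e; simp; omega
    · simp [e, h.head]; omega

end Frag

end LogspacePC

namespace LogspacePC

/-! ### Programs on registers -/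

/-- Programs on registers that hold numbers, with bounded loops. -/
inductive Prog where
  | dec (r : ℕ)
  | copy (d s : ℕ)
  | query (d s : ℕ)
  | seq (p q : Prog)
  | loop (r : ℕ) (p : Prog)

namespace Prog

/-- The effect of a program on the registers, which hold numbers below `B`: `dec` decreases a
register modulo `B`, `query d s` looks up the input bit at the position in `s`, and `loop r p`
counts down the register `r` to `0` and performs `p` each time. -/
def run (x : List Bool) (B : ℕ) : Prog → (ℕ → ℕ) → ℕ → ℕ
  | dec r, σ => Function.update σ r ((σ r + (B - 1)) % B)
  | copy d s, σ => Function.update σ d (σ s)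
  | query d s, σ => Function.update σ d (if x[σ s]? = some true then 1 else 0)
  | seq p q, σ => run x B q (run x B p σ)
  | loop r p, σ => (fun τ => run x B p (Function.update τ r (τ r - 1)))^[σ r] σ

/-- The program changes the register `r'` at most by way of instructions that mention it as their
target. -/
def Writes : Prog → ℕ → Prop
  | dec r, r' => r' = r
  | copy d _, r' => r' = d
  | query d _, r' => r' = d
  | seq p q, r' => p.Writes r' ∨ q.Writes r'
  | loop r p, r' => r' = r ∨ p.Writes r'

/-- The loops of the program do not change their counters, and `copy` has two different registers. -/
def WF : Prog → Prop
  | dec _ => True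
  | copy d s => d ≠ s
  | query _ _ => True
  | seq p q => p.WF ∧ q.WF
  | loop r p => p.WF ∧ ¬ p.Writes r

/-- All registers of the program are at most `N`. -/
def Below (N : ℕ) : Prog → Prop
  | dec r => r ≤ N
  | copy d s => d ≤ N ∧ s ≤ N
  | query d s => d ≤ N ∧ s ≤ N
  | seq p q => p.Below N ∧ q.Below N
  | loop r p => r ≤ N ∧ p.Below N

lemma Below.mono {N N' : ℕ} (h : N ≤ N') : ∀ {p : Prog}, p.Below N → p.Below N'
  | dec _, hp => le_trans hp h
  | copy _ _, hp => ⟨le_trans hp.1 h, le_trans hp.2 h⟩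
  | query _ _, hp => ⟨le_trans hp.1 h, le_trans hp.2 h⟩
  | seq _ _, hp => ⟨hp.1.mono h, hp.2.mono h⟩
  | loop _ _, hp => ⟨le_trans hp.1 h, hp.2.mono h⟩

lemma exists_below : ∀ p : Prog, ∃ N, p.Below N
  | dec r => ⟨r, le_rfl⟩
  | copy d s => ⟨max d s, le_max_left _ _, le_max_right _ _⟩
  | query d s => ⟨max d s, le_max_left _ _, le_max_right _ _⟩
  | seq p q => by
    obtain ⟨a, ha⟩ := exists_below p
    obtain ⟨b, hb⟩ := exists_below q
    exact ⟨max a b, ha.mono (le_max_left _ _), hb.mono (le_max_right _ _)⟩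
  | loop r p => by
    obtain ⟨a, ha⟩ := exists_below p
    exact ⟨max r a, le_max_left _ _, ha.mono (le_max_right _ _)⟩

lemma run_of_not_writes (x : List Bool) (B : ℕ) {r' : ℕ} :
    ∀ (p : Prog) (σ : ℕ → ℕ), ¬ p.Writes r' → run x B p σ r' = σ r'
  | dec _, _, h => Function.update_of_ne h _ _
  | copy _ _, _, h => Function.update_of_ne h _ _
  | query _ _, _, h => Function.update_of_ne h _ _
  | seq p q, σ, h => by
    rw [Writes, not_or] at h
    rw [run, run_of_not_writes x B q _ h.2, run_of_not_writes x B p _ h.1]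
  | loop r p, σ, h => by
    rw [Writes, not_or] at h
    rw [run]
    generalize σ r = m
    induction m with
    | zero => rfl
    | succ m ih =>
      rw [Function.iterate_succ_apply', run_of_not_writes x B p _ h.2,
        Function.update_of_ne h.1, ih]

lemma run_lt (x : List Bool) {B : ℕ} (hB : 2 ≤ B) :
    ∀ (p : Prog) (σ : ℕ → ℕ), (∀ r, σ r < B) → ∀ r, run x B p σ r < B
  | dec r', σ, h, r => by
    by_cases e : r = r'
    · subst e; simp [run, Nat.mod_lt _ (show 0 < B by omega)]
    · simp [run, e, h]
  | copy d s, σ, h, r => by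
    by_cases e : r = d
    · subst e; simp [run, h]
    · simp [run, e, h]
  | query d s, σ, h, r => by
    by_cases e : r = d
    · subst e
      simp only [run, Function.update_self]
      split <;> omega
    · simp [run, e, h]
  | seq p q, σ, h, r => run_lt x hB q _ (run_lt x hB p σ h) r
  | loop r' p, σ, h, r => by
    rw [run]
    generalize σ r' = m
    induction m generalizing r with
    | zero => exact h r
    | succ m ih =>
      rw [Function.iterate_succ_apply']
      refine run_lt x hB p _ (fun t => ?_) r
      by_cases e : t = r'
      · subst e
        simpa using (Nat.sub_le _ _).trans_lt (ih t)
      · simp [e, ih]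

/-! ### Compilation -/

/-- The tapes of the compiled program: the registers, and four special tapes. -/
abbrev TapeIx (N : ℕ) : Type := Fin (N + 1) ⊕ Fin 4

/-- The tape of a register. -/
def reg (N r : ℕ) : TapeIx N := .inl (Fin.ofNat (N + 1) r)

/-- The address tape. -/
abbrev adT (N : ℕ) : TapeIx N := .inr 0

/-- The tape on which the space is marked. -/
abbrev ruT (N : ℕ) : TapeIx N := .inr 1

/-- The tape for the result of a test. -/
abbrev flT (N : ℕ) : TapeIx N := .inr 2

/-- An auxiliary tape. -/
abbrev auxT (N : ℕ) : TapeIx N := .inr 3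

lemma reg_inj {N r r' : ℕ} (hr : r ≤ N) (hr' : r' ≤ N) : reg N r = reg N r' ↔ r = r' := by
  simp [reg, Fin.ext_iff, Nat.mod_eq_of_lt (Nat.lt_succ_of_le hr),
    Nat.mod_eq_of_lt (Nat.lt_succ_of_le hr')]

/-- The translation of programs into fragments. -/
def compile (N : ℕ) : Prog → Frag (TapeIx N)
  | dec r => Frag.dec (ruT N) (reg N r)
  | copy d s => Frag.setCells (ruT N) (reg N d) (reg N s) id
  | query d s => ((Frag.setCells (ruT N) (adT N) (reg N s) id).seq
      (Frag.setCells (ruT N) (reg N d) (adT N) fun _ => false)).seq (Frag.readInput (reg N d))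
  | seq p q => (compile N p).seq (compile N q)
  | loop r p => (Frag.test (ruT N) (flT N) (reg N r)).seq
      (Frag.loop (fun v _ => (v (flT N)).1) ((Frag.dec (ruT N) (reg N r)).seq
        ((compile N p).seq (Frag.test (ruT N) (flT N) (reg N r)))))

/-- The tapes hold the contents of the registers. -/
def Holds (N : ℕ) (T : TapeIx N → Tape) (σ : ℕ → ℕ) : Prop :=
  ∀ r ≤ N, (T (reg N r)).value = σ r

lemma Holds.update_reg {N : ℕ} {T : TapeIx N → Tape} {σ : ℕ → ℕ} (h : Holds N T σ) {r : ℕ}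
    (hr : r ≤ N) (t : Tape) :
    Holds N (Function.update T (reg N r) t) (Function.update σ r t.value) := by
  intro r' hr'
  by_cases e : r' = r
  · subst e; simp
  · rw [Function.update_of_ne e, Function.update_of_ne (mt (reg_inj hr' hr).1 e), h r' hr']

lemma Holds.update_special {N : ℕ} {T : TapeIx N → Tape} {σ : ℕ → ℕ} (h : Holds N T σ) (i : Fin 4)
    (t : Tape) : Holds N (Function.update T (.inr i) t) σ := by
  intro r' hr'
  rw [Function.update_of_ne (by simp [reg]), h r' hr']

/-- Structural recursion with the invariant `Ready` and `Holds`. The ruler fixes `L` throughout, so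
the registers are numbers modulo `2 ^ L` and no head passes cell `L`. -/
theorem exec_compile {N L ℓ : ℕ} (hL : 0 < L) (hℓ : L < ℓ) (x : List Bool) :
    ∀ (p : Prog), p.WF → p.Below N → ∀ (T : TapeIx N → Tape) (σ : ℕ → ℕ),
      Ready L (ruT N) T → Holds N T σ → ∃ T', (compile N p).Exec (adT N) x ℓ T T' ∧
        Ready L (ruT N) T' ∧ Holds N T' (run x (2 ^ L) p σ)
  | dec r, _, hb, T, σ, hT, hσ => by
    obtain ⟨o, ho, hv, he⟩ := Frag.exec_dec (addr := adT N) (x := x) hT hℓ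
      (r := reg N r) (by simp [reg])
    refine ⟨_, he, hT.update (by simp [reg]) ho, ?_⟩
    rw [run, ← hσ r hb, ← hv]
    exact hσ.update_reg hb ⟨o, 0⟩
  | copy d s, hw, hb, T, σ, hT, hσ => by
    have he := Frag.exec_setCells (addr := adT N) (x := x) hT hℓ
      (dst := reg N d) (src := reg N s) (by simp [reg]) (mt (reg_inj hb.1 hb.2).1 hw) id
    refine ⟨_, he, hT.update (by simp [reg]) (Finset.filter_subset _ _), ?_⟩
    rw [run, ← hσ s hb.2]
    convert hσ.update_reg hb.1 _ using 2
    simp only [Tape.value, id]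
    congr 1
    ext i
    simpa using fun h => Finset.mem_range.1 (hT.ones _ h)
  | query d s, _, hb, T, σ, hT, hσ => by
    have he := Frag.exec_setCells (addr := adT N) (x := x) hT hℓ
      (dst := adT N) (src := reg N s) (by simp) (by simp [reg]) id
    have hT1 := hT.update (r := adT N) (by simp)
      (o := (Finset.range L).filter fun i => id (decide (i ∈ (T (reg N s)).ones)))
      (Finset.filter_subset _ _)
    have hσ1 := hσ.update_special 0
      ⟨(Finset.range L).filter fun i => id (decide (i ∈ (T (reg N s)).ones)), 0⟩
    have hv : ((Function.update T (adT N)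
      ⟨(Finset.range L).filter fun i => id (decide (i ∈ (T (reg N s)).ones)), 0⟩) (adT N)).value
        = σ s := by
      rw [← hσ s hb.2, Function.update_self]
      simp only [Tape.value, id]
      congr 1
      ext i
      simpa using fun h => Finset.mem_range.1 (hT.ones _ h)
    generalize Function.update T (adT N)
      ⟨(Finset.range L).filter fun i => id (decide (i ∈ (T (reg N s)).ones)), 0⟩ = T1 at *
    -- The target is cleared because `readInput` writes a single cell. The address was copied
    -- before, so `d = s` is allowed.
    have he2 := Frag.exec_setCells (addr := adT N) (x := x) hT1 hℓ
      (dst := reg N d) (src := adT N) (by simp [reg]) (by simp [reg]) (fun _ => false)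
    have hT2 := hT1.update (r := reg N d) (by simp [reg])
      (o := (Finset.range L).filter fun i => (fun _ => false) (decide (i ∈ (T1 (adT N)).ones)))
      (Finset.filter_subset _ _)
    have he3 := Frag.exec_readInput (addr := adT N) (x := x) hT2 hℓ (dst := reg N d) (by simp)
    refine ⟨_, (he.seq he2).seq he3, hT2.update (by simp [reg]) ?_, ?_⟩
    · split
      · simpa using hL
      · simp
    · rw [Function.update_idem, Function.update_of_ne (by simp [reg]), hv, run]
      convert hσ1.update_reg hb.1 _ using 2
      split <;> simp [Tape.value]
  | seq p q, hw, hb, T, σ, hT, hσ => by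
    obtain ⟨T1, he1, hT1, hσ1⟩ := exec_compile hL hℓ x p hw.1 hb.1 T σ hT hσ
    obtain ⟨T2, he2, hT2, hσ2⟩ := exec_compile hL hℓ x q hw.2 hb.2 T1 _ hT1 hσ1
    exact ⟨T2, he1.seq he2, hT2, hσ2⟩
  | loop r p, hw, hb, T, σ, hT, hσ => by
    have htest : ∀ (T : TapeIx N → Tape) (σ : ℕ → ℕ), Ready L (ruT N) T → Holds N T σ →
        ∃ T', (Frag.test (ruT N) (flT N) (reg N r)).Exec (adT N) x ℓ T T' ∧ Ready L (ruT N) T' ∧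
          Holds N T' σ ∧ (view T' (flT N)).1 = decide (σ r ≠ 0) := by
      intro T σ hT hσ
      obtain ⟨o, ho, h0, he⟩ := Frag.exec_test (addr := adT N) (x := x) hT hℓ hL
        (r := reg N r) (fl := flT N) (by simp) (by simp [reg])
      refine ⟨_, he, hT.update (by simp) ho, hσ.update_special 2 _, ?_⟩
      rw [hσ r hb.1] at h0
      simp [view, Tape.bit, h0]
    -- The machine tests the counter anew before each round, while `run` iterates as often as the
    -- counter says at the start. These agree because `p` does not write to `r`, so each round
    -- lowers the counter by exactly one.
    have hloop : ∀ (m : ℕ) (T : TapeIx N → Tape) (σ : ℕ → ℕ), Ready L (ruT N) T → Holds N T σ →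
        σ r = m → (view T (flT N)).1 = decide (m ≠ 0) →
        ∃ T', (Frag.loop (fun v _ => (v (flT N)).1) ((Frag.dec (ruT N) (reg N r)).seq
        ((compile N p).seq (Frag.test (ruT N) (flT N) (reg N r))))).Exec (adT N) x ℓ T T' ∧
          Ready L (ruT N) T' ∧ Holds N T'
            ((fun τ => run x (2 ^ L) p (Function.update τ r (τ r - 1)))^[m] σ) := by
      intro m
      induction m with
      | zero =>
        intro T σ hT hσ _ hf
        exact ⟨T, Frag.exec_loop_false (by simpa using hf)
          (fun t => by rw [hT.head t]; omega), hT, hσ⟩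
      | succ m ih =>
        intro T σ hT hσ hm hf
        obtain ⟨o, ho, hv, he1⟩ := Frag.exec_dec (addr := adT N) (x := x) hT hℓ
          (r := reg N r) (by simp [reg])
        have hT1 := hT.update (r := reg N r) (by simp [reg]) ho
        have hσ1 := hσ.update_reg hb.1 ⟨o, 0⟩
        have hval : (Tape.mk o 0).value = m := by
          have hlt := Tape.value_lt (hT.ones (reg N r))
          rw [hσ r hb.1, hm] at hlt hv
          rw [Tape.value, hv, show m + 1 + (2 ^ L - 1) = m + 2 ^ L by omega,
            Nat.add_mod_right, Nat.mod_eq_of_lt (by omega)]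
        rw [hval] at hσ1
        obtain ⟨T2, he2, hT2, hσ2⟩ := exec_compile hL hℓ x p hw.1 hb.2 _ _ hT1 hσ1
        obtain ⟨T3, he3, hT3, hσ3, hf3⟩ := htest T2 _ hT2 hσ2
        rw [run_of_not_writes x _ p _ hw.2, Function.update_self] at hf3
        obtain ⟨T4, he4, hT4, hσ4⟩ := ih T3 _ hT3 hσ3
          (by rw [run_of_not_writes x _ p _ hw.2, Function.update_self]) hf3
        refine ⟨T4, Frag.Exec.loop_true (by simpa using hf)
          (fun t => by rw [hT.head t]; omega) (he1.seq (he2.seq he3)) he4, hT4, ?_⟩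
        rw [Function.iterate_succ_apply, hm, Nat.add_sub_cancel]
        exact hσ4
    obtain ⟨T1, he1, hT1, hσ1, hf1⟩ := htest T σ hT hσ
    obtain ⟨T2, he2, hT2, hσ2⟩ := hloop _ T1 σ hT1 hσ1 rfl hf1
    exact ⟨T2, he1.seq he2, hT2, hσ2⟩

end Prog

end LogspacePC

namespace LogspacePC

/-! ### Running time of deterministic logspace machines -/

namespace Machine

variable {M : Machine}

lemma run_append_singleton (x r : List Bool) (b : Bool) :
    M.run x (r ++ [b]) = M.step x (M.run x r) b := by
  simp [run, List.foldl_append]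

lemma step_of_halted {x : List Bool} {c : M.Config} {o : Bool} (h : M.output c.state = some o)
    (b : Bool) : M.step x c b = c := by
  simp [step, h]

lemma IsDeterministic.step_eq (h : M.IsDeterministic) (x : List Bool) (c : M.Config) (b b' : Bool) :
    M.step x c b = M.step x c b' := by
  unfold step
  rw [h _ _ _ b b']

lemma IsDeterministic.run_eq (h : M.IsDeterministic) (x : List Bool) (r : List Bool) :
    M.run x r = (fun c => M.step x c false)^[r.length] M.init := by
  induction r using List.reverseRecOn with
  | nil => rfl
  | append_singleton r b ih =>
    rw [run_append_singleton, List.length_append, List.length_singleton,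
      Function.iterate_succ_apply', ← ih, h.step_eq x _ b false]

lemma ones_step_subset (x : List Bool) (c : M.Config) (b : Bool) (t : M.Ix) :
    ((M.step x c b).tape t).ones ⊆ insert (c.tape t).head (c.tape t).ones := by
  unfold step
  split
  · exact Finset.subset_insert _ _
  · simp only [Tape.act]
    split
    · exact subset_rfl
    · exact (Finset.erase_subset _ _).trans (Finset.subset_insert _ _)

lemma ones_run_subset {x : List Bool} {ℓ : ℕ} (h : ∀ r t, ((M.run x r).tape t).head < ℓ)
    (r : List Bool) (t : M.Ix) : ((M.run x r).tape t).ones ⊆ Finset.range ℓ := by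
  induction r using List.reverseRecOn with
  | nil => exact Finset.empty_subset _
  | append_singleton r b ih =>
    rw [run_append_singleton]
    exact (ones_step_subset x _ b t).trans
      (Finset.insert_subset (Finset.mem_range.2 (h r t)) ih)

end Machine

/-- A deterministic machine that always halts and uses logarithmic space runs in polynomial time,
since it never repeats a configuration. -/
theorem Machine.IsDeterministic.exists_haltsWithin {M : Machine} (hdet : M.IsDeterministic)
    (hspace : M.IsLogspace)
    (hhalt : ∀ x, ∃ t₀, ∀ r : List Bool, t₀ ≤ r.length → (M.result x r).isSome) :
    ∃ T : Polynomial ℕ, M.HaltsWithin T := by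
  classical
  obtain ⟨c, hc⟩ := hspace
  have := M.finite_state
  have := M.finite_ix
  have := Fintype.ofFinite M.State
  have := Fintype.ofFinite M.Ix
  -- A bound on the number of configurations: a state and, for each tape, a set of ones within `ℓ`
  -- cells and a head position, where `2 ^ ℓ * ℓ ≤ 2 ^ (2 * ℓ)` and `2 ^ ℓ ≤ (2 * (|x| + 1)) ^ c`.
  refine ⟨Polynomial.C (Fintype.card M.State) *
    ((Polynomial.C 2 * (Polynomial.X + 1)) ^ (2 * c)) ^ Fintype.card M.Ix, fun x r hr => ?_⟩
  set ℓ := c * (Nat.log 2 x.length + 1) with hℓ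
  set f : M.Config → M.Config := fun d => M.step x d false with hf
  have hrun : ∀ i, M.run x (List.replicate i false) = f^[i] M.init := fun i => by
    rw [hdet.run_eq, List.length_replicate]
  have hhead : ∀ i t, ((f^[i] M.init).tape t).head < ℓ := fun i t => by
    rw [← hrun]; exact hc x _ t
  have hones : ∀ i t, ((f^[i] M.init).tape t).ones ⊆ Finset.range ℓ := fun i t => by
    rw [← hrun]; exact ones_run_subset (hc x) _ t
  by_contra hnot
  rw [Machine.result, hdet.run_eq, Option.not_isSome_iff_eq_none] at hnot
  change M.output (f^[r.length] M.init).state = none at hnot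
  -- Halting is permanent, so no earlier configuration has halted either.
  have hnone : ∀ i ≤ r.length, M.output (f^[i] M.init).state = none := by
    intro i hi
    by_contra hne
    obtain ⟨o, ho⟩ := Option.ne_none_iff_exists'.1 hne
    have hfix : ∀ k, f^[k + i] M.init = f^[i] M.init := by
      intro k
      induction k with
      | zero => simp
      | succ k ih =>
        rw [Nat.succ_add, Function.iterate_succ_apply', ih]
        exact step_of_halted ho false
    have h1 := hfix (r.length - i)
    rw [Nat.sub_add_cancel hi] at h1
    rw [h1, ho] at hnot
    exact absurd hnot (by simp)
  let g : Fin (r.length + 1) → M.State × (M.Ix → Finset (Fin ℓ) × Fin ℓ) := fun i =>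
    ((f^[i] M.init).state, fun t =>
      (Finset.univ.filter fun j : Fin ℓ => (j : ℕ) ∈ ((f^[i] M.init).tape t).ones,
        ⟨_, hhead i t⟩))
  have hcard : Fintype.card (M.State × (M.Ix → Finset (Fin ℓ) × Fin ℓ)) ≤ r.length := by
    have h1 : 2 ^ ℓ * ℓ ≤ (2 * (x.length + 1)) ^ (2 * c) := by
      have h2 : 2 ^ (Nat.log 2 x.length + 1) ≤ 2 * (x.length + 1) := by
        rw [pow_succ]
        by_cases h0 : x.length = 0
        · simp [h0]
        · have := Nat.pow_log_le_self 2 h0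
          omega
      calc 2 ^ ℓ * ℓ ≤ 2 ^ ℓ * 2 ^ ℓ := Nat.mul_le_mul_left _ Nat.lt_two_pow_self.le
        _ = (2 ^ (Nat.log 2 x.length + 1)) ^ (2 * c) := by
          rw [← pow_add, ← pow_mul, hℓ]; congr 1; ring
        _ ≤ _ := Nat.pow_le_pow_left h2 _
    rw [hr]
    simp only [Fintype.card_prod, Fintype.card_fun, Fintype.card_finset, Fintype.card_fin,
      Polynomial.eval_mul, Polynomial.eval_C, Polynomial.eval_pow, Polynomial.eval_add,
      Polynomial.eval_X, Polynomial.eval_one]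
    exact Nat.mul_le_mul_left _ (Nat.pow_le_pow_left h1 _)
  obtain ⟨i, j, hij, hg⟩ := Fintype.exists_ne_map_eq_of_card_lt g (by simpa using Nat.lt_succ_of_le hcard)
  have hconf : ∀ i j : Fin (r.length + 1), g i = g j → f^[i] M.init = f^[j] M.init := by
    intro i j hg
    have hst : (f^[i] M.init).state = (f^[j] M.init).state := congrArg Prod.fst hg
    have htape : ∀ t, (f^[i] M.init).tape t = (f^[j] M.init).tape t := by
      intro t
      have h1 := congrFun (congrArg Prod.snd hg) t
      have h2 : ((f^[i] M.init).tape t).head = ((f^[j] M.init).tape t).head :=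
        congrArg (fun p => (p.2 : ℕ)) h1
      have h3 : ((f^[i] M.init).tape t).ones = ((f^[j] M.init).tape t).ones := by
        ext k
        by_cases hk : k < ℓ
        · have h4 := congrArg (fun p => (⟨k, hk⟩ : Fin ℓ) ∈ p.1) h1
          simpa [g] using h4
        · exact iff_of_false (fun h => hk (Finset.mem_range.1 (hones _ _ h)))
            (fun h => hk (Finset.mem_range.1 (hones _ _ h)))
      revert h2 h3
      generalize (f^[i] M.init).tape t = a
      generalize (f^[j] M.init).tape t = b
      cases a; cases b
      rintro rfl rfl
      rfl
    revert hst htape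
    generalize f^[i] M.init = a
    generalize f^[j] M.init = b
    cases a; cases b
    rintro rfl h
    congr 1
    exact funext h
  obtain ⟨i, j, hlt, hij⟩ : ∃ i j : Fin (r.length + 1), i < j ∧
      f^[i] M.init = f^[j] M.init := by
    rcases lt_or_gt_of_ne hij with h | h
    · exact ⟨i, j, h, hconf i j hg⟩
    · exact ⟨j, i, h, hconf j i hg.symm⟩
  obtain ⟨d, hd⟩ : ∃ d, (j : ℕ) = d + i ∧ 0 < d :=
    ⟨j - i, by have : (i : ℕ) < j := hlt; omega, by have : (i : ℕ) < j := hlt; omega⟩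
  -- A repeated configuration makes the run periodic, so at arbitrarily late times it is in a
  -- configuration that has not halted, against `hhalt`.
  have hper : ∀ n, f^[n * d + i] M.init = f^[i] M.init := by
    intro n
    induction n with
    | zero => simp
    | succ n ih =>
      rw [show (n + 1) * d + i = d + (n * d + i) by ring, Function.iterate_add_apply, ih,
        ← Function.iterate_add_apply, ← hd.1, ← hij]
  obtain ⟨t₀, ht₀⟩ := hhalt x
  have h1 := ht₀ (List.replicate (t₀ * d + i) false) (by
    rw [List.length_replicate]
    exact (Nat.le_mul_of_pos_right _ hd.2).trans (Nat.le_add_right _ _))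
  rw [Machine.result, hrun, hper, hnone i (by omega)] at h1
  exact absurd h1 (by simp)

/-! ### Machines from fragments -/

/-- The machine that executes a fragment and then outputs the scanned bit of the tape `out`. -/
def Frag.toMachine {Ix : Type} [Finite Ix] (F : Frag Ix) (addr out : Ix) : Machine where
  State := Option F.Q ⊕ Bool
  Ix := Ix
  finite_state := by have := F.finite; infer_instance
  finite_ix := inferInstance
  addr := addr
  start := .inl (some F.start)
  output q := match q with
    | .inl _ => none
    | .inr b => some b
  trans q v i _ := match q with
    | .inl (some q) => (.inl (F.next q v i).1, (F.next q v i).2)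
    | .inl none => (.inr (v out).1, fun t => ((v t).1, .stay))
    | .inr b => (.inr b, fun t => ((v t).1, .stay))

lemma Frag.toMachine_isDeterministic {Ix : Type} [Finite Ix] (F : Frag Ix) (addr out : Ix) :
    (F.toMachine addr out).IsDeterministic := by
  rintro (_ | _) v i b b' <;> rfl

/-- Induction from the end of the run. `t₀` is its number of steps plus one for the transition to
the output state. The head bound covers every `r`, including runs cut short, as `IsLogspace`
demands. -/
lemma Frag.foldl_toMachine {Ix : Type} [Finite Ix] (F : Frag Ix) (addr out : Ix) {x : List Bool}
    {ℓ : ℕ} {T' : Ix → Tape} {c : Option F.Q × (Ix → Tape)}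
    (h : Relation.ReflTransGen (F.Next addr x ℓ) c (none, T')) (hc : ∀ t, (c.2 t).head < ℓ) :
    ∃ t₀, ∀ r : List Bool,
      (∀ t : Ix, ((r.foldl ((F.toMachine addr out).step x) ⟨.inl c.1, c.2⟩).tape t).head < ℓ) ∧
      (t₀ ≤ r.length →
        (r.foldl ((F.toMachine addr out).step x) ⟨.inl c.1, c.2⟩).state = .inr (T' out).bit) := by
  induction h using Relation.ReflTransGen.head_induction_on with
  | refl =>
    refine ⟨1, fun r => ?_⟩
    cases r with
    | nil => exact ⟨hc, by simp⟩
    | cons b r =>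
      have h1 : (F.toMachine addr out).step x ⟨.inl none, T'⟩ b = ⟨.inr (T' out).bit, T'⟩ := by
        have := actAll_stay T'
        simp only [Machine.step, toMachine]
        congr 1
      have h2 : ∀ r : List Bool, r.foldl ((F.toMachine addr out).step x) ⟨.inr (T' out).bit, T'⟩ =
          ⟨.inr (T' out).bit, T'⟩ := by
        intro r
        induction r with
        | nil => rfl
        | cons b r ih =>
          rw [List.foldl_cons, Machine.step_of_halted (o := (T' out).bit) rfl]
          exact ih
      rw [List.foldl_cons, h1, h2]
      exact ⟨hc, fun _ => rfl⟩
  | head hstep _ ih =>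
    rename_i c c' _
    obtain ⟨q, hq, rfl, hℓ⟩ := hstep
    obtain ⟨t₀, ht₀⟩ := ih hℓ
    refine ⟨t₀ + 1, fun r => ?_⟩
    cases r with
    | nil => exact ⟨hc, by simp⟩
    | cons b r =>
      have h1 : (F.toMachine addr out).step x ⟨.inl c.1, c.2⟩ b =
          ⟨.inl (F.step addr x q c.2).1, (F.step addr x q c.2).2⟩ := by
        rw [hq]
        rfl
      rw [List.foldl_cons, h1]
      refine ⟨(ht₀ r).1, fun hr => (ht₀ r).2 ?_⟩
      simpa using hr

/-- A fragment that uses logarithmic space on all inputs yields a deterministic logspace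
algorithm. -/
theorem Frag.exists_algorithm {Ix : Type} [Finite Ix] (F : Frag Ix) (addr out : Ix) (c : ℕ)
    (T' : List Bool → Ix → Tape)
    (h : ∀ x, F.Exec addr x (c * (Nat.log 2 x.length + 1)) (fun _ => Tape.blank) (T' x)) :
    ∃ A : DeterministicLogspaceAlgorithm, ∀ x r : List Bool,
      r.length = A.time.eval x.length → A.machine.result x r = some (T' x out).bit := by
  -- With `c = 0` the last step of the run would violate its own head bound.
  have hpos : 0 < c := by
    rcases Nat.eq_zero_or_pos c with rfl | hc
    · rcases Relation.ReflTransGen.cases_tail (h []) with h0 | ⟨_, _, _, _, _, h1⟩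
      · exact absurd (congrArg Prod.fst h0) (by simp)
      · simpa using h1 addr
    · exact hc
  have key : ∀ x, ∃ t₀, ∀ r : List Bool,
      (∀ t : Ix, (((F.toMachine addr out).run x r).tape t).head < c * (Nat.log 2 x.length + 1)) ∧
      (t₀ ≤ r.length → ((F.toMachine addr out).run x r).state = .inr (T' x out).bit) :=
    fun x => F.foldl_toMachine addr out (h x) (fun t => by
      change 0 < _
      positivity)
  have hspace : (F.toMachine addr out).IsLogspace :=
    ⟨c, fun x r t => ((key x).choose_spec r).1 t⟩
  obtain ⟨T, hT⟩ := (F.toMachine_isDeterministic addr out).exists_haltsWithin hspace (fun x => by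
    obtain ⟨t₀, ht₀⟩ := key x
    refine ⟨t₀, fun r hr => ?_⟩
    rw [Machine.result, (ht₀ r).2 hr]
    rfl)
  refine ⟨⟨⟨F.toMachine addr out, T, hT, hspace⟩, F.toMachine_isDeterministic addr out⟩,
    fun x r hr => ?_⟩
  obtain ⟨t₀, ht₀⟩ := key x
  obtain ⟨o, ho⟩ := Option.isSome_iff_exists.1 (hT x r hr)
  -- The time bound `T` may be smaller than `t₀`. Padding the string of a halted run changes nothing
  -- and makes it long enough for `ht₀`.
  have hstay : ∀ k, ((F.toMachine addr out).run x (r ++ List.replicate k false)) =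
      (F.toMachine addr out).run x r := by
    intro k
    induction k with
    | zero => simp
    | succ k ih =>
      rw [List.replicate_succ', ← List.append_assoc, Machine.run_append_singleton, ih,
        Machine.step_of_halted ho]
  have h1 := (ht₀ (r ++ List.replicate t₀ false)).2 (by simp)
  rw [hstay] at h1
  change (F.toMachine addr out).result x r = _
  rw [Machine.result, h1]
  rfl

end LogspacePC

namespace LogspacePC

/-! ### Marking the space -/

namespace Frag

variable {Ix : Type} [DecidableEq Ix]

/-- Count the length of the input on the tape `ad`, and mark the visited cells on `aux`. -/
def countInput (ad aux : Ix) : Frag Ix :=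
  loop (fun _ i => i.isSome) ((sweep (pair ad aux) (fun v => (v ad).1) (fun _ t => decide (t = aux))).seq
    ((act fun v _ t => (if t = ad ∨ t = aux then true else (v t).1, .stay)).seq
      (home (pair ad aux) ad)))

/-- Tapes that are blank except for `ad` and `aux`. -/
def counting (ad aux : Ix) (O R : Finset ℕ) (j : ℕ) : Ix → Tape :=
  swept (pair ad aux) (fun _ => Tape.blank) (fun t => if t = aux then R else O) j

/-- One increment of the counter on `ad`, with `J` its first zero. The marks on `aux` record how
many cells were ever used, whence `max a (J + 1)`. -/
lemma exec_countInput_step {ad aux addr : Ix} (hne : ad ≠ aux) {x : List Bool} {ℓ : ℕ}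
    (O : Finset ℕ) (a J : ℕ) (hO : O ⊆ Finset.range a) (hJ : J ∉ O) (hmin : ∀ j < J, j ∈ O)
    (hℓ : J < ℓ) :
    ((sweep (pair ad aux) (fun v => (v ad).1) (fun _ t => decide (t = aux))).seq
    ((act fun v _ t => (if t = ad ∨ t = aux then true else (v t).1, .stay)).seq
      (home (pair ad aux) ad))).Exec addr x ℓ (counting ad aux O (Finset.range a) 0)
      (counting ad aux (insert J (O \ Finset.range J)) (Finset.range (max a (J + 1))) 0) := by
  have hT : ∀ t : Ix, ((fun _ : Ix => Tape.blank) t).head < ℓ := fun _ => by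
    change 0 < ℓ; omega
  have ha : pair ad aux ad = true := by simp [pair]
  have hb : pair ad aux aux = true := by simp [pair]
  have hJa : J ≤ a := by
    by_contra h
    exact absurd (hO (hmin a (by omega))) (by simp)
  refine Exec.seq (T₁ := counting ad aux (O \ Finset.range J) (Finset.range a) J) ?_
    (Exec.seq (T₁ := counting ad aux (insert J (O \ Finset.range J))
      (Finset.range (max a (J + 1))) J) ?_ ?_)
  · have := exec_sweep (addr := addr) (x := x) (pair ad aux) (fun v => (v ad).1)
      (fun _ t => decide (t = aux)) (fun _ => Tape.blank)
      (fun j t => if t = aux then Finset.range a else O \ Finset.range j) J hT hℓ ?_ ?_ ?_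
    · simpa [counting] using this
    · intro j hj
      simp [swept_bit ha, hne, hmin j hj]
    · simp [swept_bit ha, hne, hJ]
    · intro j hj t ht
      by_cases e : t = aux
      · simp only [e, if_true, decide_true]
        exact Finset.insert_eq_self.2 (Finset.mem_range.2 (by omega))
      · simp only [e, if_false, decide_false, Bool.false_eq_true]
        ext i
        simp only [Finset.mem_erase, Finset.mem_sdiff, Finset.mem_range]
        grind
  · refine exec_act _ ?_ (swept_head_lt hT hℓ)
    funext t
    by_cases e : t = aux
    · subst e
      simp only [actAll, counting, swept, hb, or_true, if_true, Tape.act]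
      congr 1
      ext i
      simp only [Finset.mem_insert, Finset.mem_range]
      omega
    · by_cases e' : t = ad
      · subst e'
        simp [actAll, counting, swept, ha, e, Tape.act]
      · have hp : pair ad aux t = false := by simp [pair, e, e']
        simp [actAll, counting, swept, hp, e, e', view]
  · exact exec_home (pair ad aux) ad ha _ _ hT J hℓ

/-- The address tape itself is the counter: the loop ends when the input has no bit at the current
address, that is, at the value `|x|`. The cells used on the way then number at least the binary
length of `|x|`. -/
lemma exec_countInput {ad aux : Ix} (hne : ad ≠ aux) {x : List Bool} {ℓ : ℕ}
    (hℓ : Nat.log 2 x.length + 1 < ℓ) :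
    ∃ O a, O ⊆ Finset.range a ∧ x.length < 2 ^ a ∧ a ≤ Nat.log 2 x.length + 1 ∧
      (countInput ad aux).Exec ad x ℓ (fun _ => Tape.blank)
        (counting ad aux O (Finset.range a) 0) := by
  have hT : ∀ t : Ix, ((fun _ : Ix => Tape.blank) t).head < ℓ := fun _ => by
    change 0 < ℓ; omega
  have key : ∀ d i O a, i + d = x.length → O ⊆ Finset.range a → ∑ j ∈ O, 2 ^ j = i →
      a ≤ Nat.log 2 x.length + 1 →
      ∃ O' a', O' ⊆ Finset.range a' ∧ ∑ j ∈ O', 2 ^ j = x.length ∧ a' ≤ Nat.log 2 x.length + 1 ∧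
        (countInput ad aux).Exec ad x ℓ (counting ad aux O (Finset.range a) 0)
          (counting ad aux O' (Finset.range a') 0) := by
    intro d
    induction d with
    | zero =>
      intro i O a hi hO hs ha
      refine ⟨O, a, hO, by omega, ha, exec_loop_false ?_ (swept_head_lt hT (by omega))⟩
      have : (counting ad aux O (Finset.range a) 0 ad).value = x.length := by
        simp only [counting, swept, pair, hne, true_or, decide_true, if_true, if_false, Tape.value]
        omega
      rw [this]
      simp
    | succ d ih =>
      intro i O a hi hO hs ha
      have hex : ∃ j, j ∉ O := Infinite.exists_notMem_finset O
      obtain ⟨J, hJ, hmin⟩ : ∃ J, J ∉ O ∧ ∀ j < J, j ∈ O :=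
        ⟨Nat.find hex, Nat.find_spec hex, fun j hj => not_not.1 (Nat.find_min hex hj)⟩
      have hsum := sum_carry hJ hmin
      -- The incremented counter contains `2 ^ J` and is still at most `|x|`; this keeps it within
      -- `log |x| + 1` cells.
      have hpow : 2 ^ J ≤ x.length := by
        have := Finset.single_le_sum (f := fun j => 2 ^ j) (fun _ _ => Nat.zero_le _)
          (Finset.mem_insert_self J (O \ Finset.range J))
        omega
      have hJlog : J ≤ Nat.log 2 x.length := Nat.le_log_of_pow_le (by norm_num) hpow
      have hJa : J ≤ a := by
        by_contra h
        exact absurd (hO (hmin a (by omega))) (by simp)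
      have hsub : insert J (O \ Finset.range J) ⊆ Finset.range (max a (J + 1)) := by
        intro j hj
        rcases Finset.mem_insert.1 hj with rfl | hj
        · exact Finset.mem_range.2 (by omega)
        · have := Finset.mem_range.1 (hO (Finset.mem_sdiff.1 hj).1)
          exact Finset.mem_range.2 (by omega)
      obtain ⟨O', a', h1, h2, h3, h4⟩ := ih (i + 1) (insert J (O \ Finset.range J))
        (max a (J + 1)) (by omega) hsub (by omega) (by omega)
      · refine ⟨O', a', h1, h2, h3, Exec.loop_true ?_ (swept_head_lt hT (by omega))
          (exec_countInput_step hne O a J hO hJ hmin (by omega)) h4⟩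
        have : (counting ad aux O (Finset.range a) 0 ad).value = i := by
          simp only [counting, swept, pair, hne, true_or, decide_true, if_true, if_false,
            Tape.value]
          omega
        rw [this, Option.isSome_iff_ne_none]
        simp
        omega
  obtain ⟨O, a, h1, h2, h3, h4⟩ := key x.length 0 ∅ 0 (by omega) (by simp) (by simp) (by omega)
  refine ⟨O, a, h1, ?_, h3, ?_⟩
  · rw [← h2]
    exact Tape.value_lt (t := ⟨O, 0⟩) h1
  · convert h4 using 1
    funext t
    simp [counting, swept, Tape.blank]

/-- Write a `1` on the tape `ru` and move to the right, `c` times, after moving to the right on the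
tape `aux`. -/
def stretchStep (ru aux : Ix) : ℕ → Frag Ix
  | 0 => act fun v _ t => ((v t).1, if t = aux then .right else .stay)
  | c + 1 => (stretchStep ru aux c).seq
    (act fun v _ t => if t = ru then (true, .right) else ((v t).1, .stay))

/-- Mark on the tape `ru` one cell, and `c` cells for each marked cell of `aux`. -/
def stretch (ru aux : Ix) (c : ℕ) : Frag Ix :=
  (act fun v _ t => if t = ru then (true, .right) else ((v t).1, .stay)).seq
  ((loop (fun v _ => (v aux).1) (stretchStep ru aux c)).seq
  ((home (fun t => decide (t = ru)) ru).seq (home (fun t => decide (t = aux)) aux)))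

/-- The tapes `T`, with the first `p` cells of `ru` marked, and the heads of `ru` and `aux` moved. -/
def stretching (ru aux : Ix) (T : Ix → Tape) (p q : ℕ) : Ix → Tape := fun t =>
  if t = ru then ⟨Finset.range p, p⟩ else if t = aux then ⟨(T aux).ones, q⟩ else T t

lemma stretching_head_lt {ru aux : Ix} {T : Ix → Tape} {ℓ p q : ℕ} (hT : ∀ t, (T t).head = 0)
    (hp : p < ℓ) (hq : q < ℓ) (t : Ix) : (stretching ru aux T p q t).head < ℓ := by
  unfold stretching
  split
  · exact hp
  · split
    · exact hq
    · rw [hT]; omega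

lemma exec_push {ru aux addr : Ix} {x : List Bool} {ℓ : ℕ} {T : Ix → Tape}
    (hT : ∀ t, (T t).head = 0) {p q : ℕ} (hp : p + 1 < ℓ) (hq : q < ℓ) :
    (act fun v _ t => if t = ru then (true, .right) else ((v t).1, .stay)).Exec addr x ℓ
      (stretching ru aux T p q) (stretching ru aux T (p + 1) q) := by
  refine exec_act _ ?_ (stretching_head_lt hT hp hq)
  funext t
  by_cases e : t = ru
  · subst e
    simp [actAll, stretching, Tape.act, Finset.range_add_one]
  · simp only [actAll, e, if_false]
    refine (Tape.act_bit_stay _).trans ?_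
    simp [stretching, e]

lemma exec_stretchStep {ru aux addr : Ix} (hne : aux ≠ ru) {x : List Bool} {ℓ : ℕ} {T : Ix → Tape}
    (hT : ∀ t, (T t).head = 0) {p q : ℕ} (hq : q + 1 < ℓ) : ∀ c, p + c < ℓ →
    (stretchStep ru aux c).Exec addr x ℓ
      (stretching ru aux T p q) (stretching ru aux T (p + c) (q + 1))
  | 0, hp => by
    refine exec_act _ ?_ (stretching_head_lt hT hp hq)
    funext t
    by_cases e : t = aux
    · subst e
      have h1 := Tape.act_bit_ones (stretching ru t T p q t) .right
      simp only [stretching, hne, if_false, if_true] at h1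
      simp only [actAll, view, stretching, hne, if_false, if_true]
      exact congrArg (fun o => Tape.mk o (q + 1)) h1
    · simp only [actAll, e, if_false]
      refine (Tape.act_bit_stay _).trans ?_
      simp [stretching, e]
  | c + 1, hp => (exec_stretchStep hne hT hq c (by omega)).seq
      (exec_push hT (by omega) hq)

/-- The ruler exceeds the counter by a constant factor so that registers can hold polynomials in
`|x|`. The extra cell keeps it nonempty when `a = 0`. -/
lemma exec_stretch {ru aux addr : Ix} (hne : aux ≠ ru) {x : List Bool} {ℓ : ℕ} {T : Ix → Tape}
    (hT : ∀ t, (T t).head = 0) {a c : ℕ} (hru : (T ru).ones = ∅) (haux : (T aux).ones = Finset.range a)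
    (hℓ : 1 + c * a < ℓ) (hℓ' : a < ℓ) :
    (stretch ru aux c).Exec addr x ℓ T
      (Function.update T ru ⟨Finset.range (1 + c * a), 0⟩) := by
  have h0 : stretching ru aux T 0 0 = T := by
    funext t
    unfold stretching
    split
    · subst t; rw [Finset.range_zero, ← hru, ← hT ru]
    · split
      · subst t; rw [← hT aux]
      · rfl
  have hloop : ∀ d q, q + d = a → (loop (fun v _ => (v aux).1) (stretchStep ru aux c)).Exec addr x ℓ
      (stretching ru aux T (1 + c * q) q) (stretching ru aux T (1 + c * a) a) := by
    intro d
    induction d with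
    | zero =>
      intro q hq
      obtain rfl : q = a := by omega
      refine exec_loop_false ?_ (stretching_head_lt hT (by omega) (by omega))
      simp [view, stretching, hne, haux, Tape.bit]
    | succ d ih =>
      intro q hq
      have hle : c * (q + 1) ≤ c * a := Nat.mul_le_mul_left _ (by omega)
      have hle' : c * q ≤ c * (q + 1) := Nat.mul_le_mul_left _ (by omega)
      refine Exec.loop_true ?_ (stretching_head_lt hT (by omega) (by omega))
        (exec_stretchStep hne hT (by omega) c (by rw [Nat.mul_succ] at hle; omega)) ?_
      · simp [view, stretching, hne, haux, Tape.bit]; omega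
      · have := ih (q + 1) (by omega)
        rwa [Nat.mul_succ, ← add_assoc] at this
  have hhome1 := exec_home (addr := addr) (x := x) (fun t => decide (t = ru)) ru (by simp)
    (stretching ru aux T 0 a) (fun _ => Finset.range (1 + c * a))
    (stretching_head_lt hT (by omega) hℓ') (1 + c * a) hℓ
  have hhome2 := exec_home (addr := addr) (x := x) (fun t => decide (t = aux)) aux (by simp)
    (Function.update T ru ⟨Finset.range (1 + c * a), 0⟩) (fun _ => Finset.range a)
    (ℓ := ℓ) (fun t => by
      by_cases e : t = ru
      · subst e; simp; omega
      · simp [e, hT]; omega) a hℓ'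
  refine Exec.seq (T₁ := stretching ru aux T 1 0) ?_ ((hloop a 0 (by omega)).seq
    (Exec.seq (T₁ := swept (fun t => decide (t = aux)) (Function.update T ru
      ⟨Finset.range (1 + c * a), 0⟩) (fun _ => Finset.range a) a) ?_ ?_))
  · have := exec_push (ru := ru) (aux := aux) (addr := addr) (x := x) (ℓ := ℓ) hT
      (p := 0) (q := 0) (by omega) (by omega)
    rwa [h0] at this
  · convert hhome1 using 1
    · funext t
      simp only [swept, stretching]
      by_cases e : t = ru <;> simp [e]
    · funext t
      simp only [swept, stretching]
      by_cases e : t = ru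
      · simp [e, hne.symm]
      · by_cases e' : t = aux
        · simp [e', hne, haux]
        · simp [e, e']
  · convert hhome2 using 1
    funext t
    simp only [swept]
    by_cases e' : t = aux
    · subst e'
      rw [Function.update_of_ne hne, ← haux, ← hT t]
      simp
    · simp [e']

end Frag

lemma Tape.bit_eq_decide_value {t : Tape} (h : t.head = 0) :
    t.bit = decide (t.value % 2 = 1) := by
  have hodd : ∀ o : Finset ℕ, 0 ∉ o → (∑ i ∈ o, 2 ^ i) % 2 = 0 := by
    intro o ho
    refine Nat.mod_eq_zero_of_dvd (Finset.dvd_sum fun i hi => ?_)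
    exact dvd_pow_self 2 (fun h0 => ho (h0 ▸ hi))
  unfold Tape.bit Tape.value
  rw [h]
  by_cases h0 : 0 ∈ t.ones
  · have h1 := hodd (t.ones.erase 0) (by simp)
    rw [← Finset.sum_erase_add _ _ h0, Nat.add_mod, h1]
    simp [h0]
  · simp [h0, hodd _ h0]

/-- Every program with sufficiently many bits per register is executed by a deterministic logspace
algorithm. -/
theorem Prog.exists_algorithm (p : Prog) (hp : p.WF) (c : ℕ) :
    ∃ (A : DeterministicLogspaceAlgorithm) (L : List Bool → ℕ),
      (∀ x, x ≠ [] → (x.length + 2) ^ c ≤ 2 ^ L x ∧ 1 ≤ L x) ∧ ∀ x r : List Bool,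
        r.length = A.time.eval x.length →
          A.machine.result x r = some (decide (p.run x (2 ^ L x) (fun _ => 0) 0 % 2 = 1)) := by
  obtain ⟨N, hN⟩ := p.exists_below
  -- With `c = 0` the ruler could be shorter than the counter left on the address tape, against
  -- `Ready`.
  wlog hc : 0 < c generalizing c
  · obtain ⟨A, L, h1, h2⟩ := this 1 one_pos
    refine ⟨A, L, fun x hx => ⟨?_, (h1 x hx).2⟩, h2⟩
    rw [show c = 0 by omega, pow_zero]
    exact Nat.one_le_two_pow
  have key : ∀ x : List Bool, ∃ (L : ℕ) (T' : TapeIx N → Tape),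
      (x ≠ [] → (x.length + 2) ^ c ≤ 2 ^ L ∧ 1 ≤ L) ∧
      ((Frag.countInput (adT N) (auxT N)).seq
        ((Frag.stretch (ruT N) (auxT N) (2 * c)).seq (p.compile N))).Exec (adT N) x
          ((2 * c + 3) * (Nat.log 2 x.length + 1)) (fun _ => Tape.blank) T' ∧
      (T' (reg N 0)).bit = decide (p.run x (2 ^ L) (fun _ => 0) 0 % 2 = 1) := by
    intro x
    have hmul : (2 * c + 3) * (Nat.log 2 x.length + 1) =
      2 * c * (Nat.log 2 x.length + 1) + 3 * (Nat.log 2 x.length + 1) := by ring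
    obtain ⟨O, a, hO, hxa, ha, he⟩ := Frag.exec_countInput (ad := adT N) (aux := auxT N)
      (by simp) (x := x) (ℓ := (2 * c + 3) * (Nat.log 2 x.length + 1)) (by rw [hmul]; omega)
    have hle : 2 * c * a ≤ 2 * c * (Nat.log 2 x.length + 1) := Nat.mul_le_mul_left _ ha
    have hhead : ∀ t, (Frag.counting (adT N) (auxT N) O (Finset.range a) 0 t).head = 0 := by
      intro t
      unfold Frag.counting Frag.swept
      split <;> rfl
    have hblank : ∀ t, t ≠ adT N → t ≠ auxT N →
        Frag.counting (adT N) (auxT N) O (Finset.range a) 0 t = Tape.blank := by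
      intro t h1 h2
      simp [Frag.counting, Frag.swept, Frag.pair, h1, h2]
    have haux : (Frag.counting (adT N) (auxT N) O (Finset.range a) 0 (auxT N)).ones =
        Finset.range a := by
      simp [Frag.counting, Frag.swept, Frag.pair]
    have had : (Frag.counting (adT N) (auxT N) O (Finset.range a) 0 (adT N)).ones = O := by
      simp [Frag.counting, Frag.swept, Frag.pair]
    have he2 := Frag.exec_stretch (ru := ruT N) (aux := auxT N) (addr := adT N) (x := x) (a := a)
      (c := 2 * c) (by simp) hhead (by rw [hblank _ (by simp) (by simp)]; rfl) haux
      (ℓ := (2 * c + 3) * (Nat.log 2 x.length + 1)) (by rw [hmul]; omega) (by rw [hmul]; omega)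
    have hsub : Finset.range a ⊆ Finset.range (1 + 2 * c * a) := Finset.range_subset_range.2 (by
      have : 1 * a ≤ 2 * c * a := Nat.mul_le_mul_right _ (by omega)
      omega)
    have hready : Ready (1 + 2 * c * a) (ruT N)
        (Function.update (Frag.counting (adT N) (auxT N) O (Finset.range a) 0) (ruT N)
          ⟨Finset.range (1 + 2 * c * a), 0⟩) := by
      refine ⟨fun t => ?_, fun t => ?_, by simp⟩
      · by_cases e : t = ruT N
        · subst e; simp
        · rw [Function.update_of_ne e, hhead]
      · by_cases e : t = ruT N
        · subst e; simp
        · rw [Function.update_of_ne e]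
          by_cases e1 : t = auxT N
          · rw [e1, haux]; exact hsub
          · by_cases e2 : t = adT N
            · rw [e2, had]; exact hO.trans hsub
            · rw [hblank t e2 e1]; exact Finset.empty_subset _
    have hholds : Holds N (Function.update (Frag.counting (adT N) (auxT N) O (Finset.range a) 0)
        (ruT N) ⟨Finset.range (1 + 2 * c * a), 0⟩) (fun _ => 0) := by
      intro r hr
      rw [Function.update_of_ne (by simp [reg]), hblank _ (by simp [reg]) (by simp [reg])]
      rfl
    obtain ⟨T', he3, hT', hσ'⟩ := p.exec_compile (N := N) (L := 1 + 2 * c * a)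
      (ℓ := (2 * c + 3) * (Nat.log 2 x.length + 1)) (by omega) (by rw [hmul]; omega) x hp hN
      (Function.update (Frag.counting (adT N) (auxT N) O (Finset.range a) 0) (ruT N)
        ⟨Finset.range (1 + 2 * c * a), 0⟩) (fun _ => 0) hready hholds
    · refine ⟨1 + 2 * c * a, T', fun hx => ⟨?_, by omega⟩, he.seq (he2.seq he3), ?_⟩
      · have h0 : 0 < x.length := List.length_pos_iff.2 hx
        have ha0 : a ≠ 0 := by rintro rfl; exact hx (by simpa using hxa)
        -- The reason for `2 * c` ruler cells per counted bit: `2 ^ a` is only known to exceed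
        -- `|x|`, and a second factor absorbs the `+ 2`.
        have h1 : x.length + 2 ≤ 2 ^ (2 * a) := by
          obtain ⟨b, rfl⟩ := Nat.exists_eq_succ_of_ne_zero ha0
          rw [two_mul, pow_add]
          have : 2 * (x.length + 1) ≤ 2 ^ b.succ * 2 ^ b.succ :=
            Nat.mul_le_mul (by rw [pow_succ]; have := Nat.one_le_two_pow (n := b); omega) hxa
          omega
        calc (x.length + 2) ^ c ≤ (2 ^ (2 * a)) ^ c := Nat.pow_le_pow_left h1 _
          _ = 2 ^ (2 * c * a) := by rw [← pow_mul]; congr 1; ring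
          _ ≤ _ := Nat.pow_le_pow_right (by norm_num) (by omega)
      · rw [Tape.bit_eq_decide_value (hT'.head _), hσ' 0 (Nat.zero_le _)]
  choose L T' h1 h2 h3 using key
  obtain ⟨A, hA⟩ := Frag.exists_algorithm _ (adT N) (reg N 0) (2 * c + 3) T' h2
  exact ⟨A, L, h1, fun x r hr => by rw [hA x r hr, h3]⟩

end LogspacePC

namespace LogspacePC

/-! ### Functions computable in logarithmic space -/

namespace Prog

/-- Set a register to `0`. -/
def clear (r : ℕ) : Prog := loop r (copy (r + 1) (r + 2))

/-- Increase a register by one, modulo the bound. -/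
def inc (r : ℕ) : Prog := seq (clear (r + 1)) (seq (dec (r + 1)) (loop (r + 1) (dec r)))

/-- Increase a register `k` times. -/
def incs (r : ℕ) : ℕ → Prog
  | 0 => clear r
  | k + 1 => seq (incs r k) (inc r)

/-- Copy `m` consecutive registers from position `b` to position `a`. -/
def copyVec (a b t : ℕ) : ℕ → Prog
  | 0 => copy t (t + 1)
  | m + 1 => seq (copyVec a b t m) (copy (a + m) (b + m))

lemma clear_wf (r : ℕ) : (clear r).WF := ⟨by simp [WF], by simp [Writes]⟩

lemma clear_writes {r r' : ℕ} (h : (clear r).Writes r') : r ≤ r' := by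
  simp only [clear, Writes] at h
  omega

lemma run_clear (x : List Bool) (B : ℕ) (σ : ℕ → ℕ) (r : ℕ) : (clear r).run x B σ r = 0 := by
  have key : ∀ m, ((fun τ => (copy (r + 1) (r + 2)).run x B (Function.update τ r (τ r - 1)))^[m] σ) r
      = σ r - m := by
    intro m
    induction m with
    | zero => rfl
    | succ m ih =>
      rw [Function.iterate_succ_apply']
      generalize (fun τ => (copy (r + 1) (r + 2)).run x B
        (Function.update τ r (τ r - 1)))^[m] σ = τ at *
      simp only [run]
      rw [Function.update_of_ne (by omega), Function.update_self, ih]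
      omega
  rw [clear, run, key, Nat.sub_self]

lemma inc_wf (r : ℕ) : (inc r).WF := ⟨clear_wf _, trivial, trivial, by simp [Writes]⟩

lemma inc_writes {r r' : ℕ} (h : (inc r).Writes r') : r ≤ r' := by
  simp only [inc, Writes] at h
  rcases h with h | h | h | h
  · have := clear_writes h; omega
  all_goals omega

/-- Each decrement adds `B - 1` modulo `B`. It is performed `B - 1` times, a count obtained by
decrementing zero, and `(B - 1) ^ 2 ≡ 1`. -/
lemma run_inc (x : List Bool) {B : ℕ} (hB : 2 ≤ B) (σ : ℕ → ℕ) (r : ℕ) (hr : σ r < B) :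
    (inc r).run x B σ r = (σ r + 1) % B := by
  have key : ∀ (τ : ℕ → ℕ), τ r < B → ∀ m,
      ((fun τ => (dec r).run x B (Function.update τ (r + 1) (τ (r + 1) - 1)))^[m] τ) r
      = (τ r + m * (B - 1)) % B := by
    intro τ hτ m
    induction m with
    | zero => simp [Nat.mod_eq_of_lt hτ]
    | succ m ih =>
      rw [Function.iterate_succ_apply']
      generalize (fun τ => (dec r).run x B
        (Function.update τ (r + 1) (τ (r + 1) - 1)))^[m] τ = τ' at *
      simp only [run]
      rw [Function.update_self, Function.update_of_ne (by omega), ih, Nat.mod_add_mod]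
      congr 1
      ring
  have h1 : (clear (r + 1)).run x B σ r = σ r :=
    run_of_not_writes _ _ _ _ fun h => by have := clear_writes h; omega
  have hloop : ∀ τ, (loop (r + 1) (dec r)).run x B τ =
      (fun τ => (dec r).run x B (Function.update τ (r + 1) (τ (r + 1) - 1)))^[τ (r + 1)] τ :=
    fun τ => by rw [run]
  rw [inc, run, run, hloop, key]
  · simp only [run]
    rw [Function.update_self, run_clear, Function.update_of_ne (by omega), h1, zero_add,
      Nat.mod_eq_of_lt (show B - 1 < B by omega)]
    obtain ⟨b, rfl⟩ : ∃ b, B = b + 2 := ⟨B - 2, by omega⟩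
    have : σ r + (b + 2 - 1) * (b + 2 - 1) = σ r + 1 + (b + 2) * b := by
      rw [show b + 2 - 1 = b + 1 by omega]; ring
    rw [this, Nat.add_mul_mod_self_left]
  · simp only [run]
    rw [Function.update_of_ne (by omega), h1]
    exact hr

lemma incs_wf (r : ℕ) : ∀ k, (incs r k).WF
  | 0 => clear_wf r
  | k + 1 => ⟨incs_wf r k, inc_wf r⟩

lemma incs_writes {r r' : ℕ} : ∀ {k}, (incs r k).Writes r' → r ≤ r'
  | 0, h => clear_writes h
  | _ + 1, h => h.elim incs_writes inc_writes

lemma run_incs (x : List Bool) {B : ℕ} (hB : 2 ≤ B) (σ : ℕ → ℕ) (hσ : ∀ r, σ r < B) (r : ℕ) :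
    ∀ k < B, (incs r k).run x B σ r = k
  | 0, _ => run_clear x B σ r
  | k + 1, h => by
    rw [incs, run, run_inc x hB _ r (run_lt x hB _ _ hσ r), run_incs x hB σ hσ r k (by omega),
      Nat.mod_eq_of_lt h]

lemma copyVec_wf {a b t : ℕ} : ∀ {m}, a + m ≤ b → (copyVec a b t m).WF
  | 0, _ => by simp [copyVec, WF]
  | m + 1, h => ⟨copyVec_wf (by omega), by simp only [WF]; omega⟩

lemma copyVec_writes {a b t r : ℕ} : ∀ {m}, (copyVec a b t m).Writes r →
    a ≤ r ∧ r < a + m ∨ r = t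
  | 0, h => .inr h
  | m + 1, h => by
    rcases h with h | h
    · have := copyVec_writes h; omega
    · simp only [Writes] at h; omega

lemma run_copyVec (x : List Bool) (B : ℕ) {a b t : ℕ} (σ : ℕ → ℕ) : ∀ {m}, a + m ≤ b → b + m ≤ t →
    ∀ j < m, (copyVec a b t m).run x B σ (a + j) = σ (b + j)
  | m + 1, h, h', j, hj => by
    rw [copyVec, run, run]
    by_cases e : j = m
    · subst e
      rw [Function.update_self]
      refine run_of_not_writes _ _ _ _ fun hw => ?_
      have := copyVec_writes hw
      omega
    · rw [Function.update_of_ne (by omega)]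
      exact run_copyVec x B σ (by omega) (by omega) j (by omega)

end Prog

/-- The size of the data of a computation, up to a polynomial: the length of the input plus the
values of the variables. -/
def envSize (x : List Bool) {V : Type} [Fintype V] (e : V → ℕ) : ℕ := x.length + ∑ v, e v + 2

/-- A function of the input and of finitely many numbers is computable in logarithmic space: it is
computed by a program on registers of polynomial size. -/
def LogComputable {V : Type} [Fintype V] (f : List Bool → (V → ℕ) → ℕ) : Prop :=
  ∃ c, ∀ (ρ : V → ℕ) (D : ℕ), (∀ v, ρ v < D) → ∃ p : Prog, p.WF ∧ (∀ r, p.Writes r → D ≤ r) ∧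
    ∀ (x : List Bool) (B : ℕ) (σ : ℕ → ℕ), 2 ≤ B → (∀ r, σ r < B) → envSize x (σ ∘ ρ) ^ c ≤ B →
      p.run x B σ D = f x (σ ∘ ρ)

section envSize

variable {V : Type} [Fintype V] (x : List Bool) (e : V → ℕ)

lemma two_le_envSize : 2 ≤ envSize x e := Nat.le_add_left _ _

lemma length_lt_envSize : x.length < envSize x e := by unfold envSize; omega

lemma lt_envSize (v : V) : e v < envSize x e := by
  have := Finset.single_le_sum (f := e) (fun _ _ => Nat.zero_le _) (Finset.mem_univ v)
  unfold envSize
  omega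

variable {x e}

lemma envSize_pow_mono {c c' : ℕ} (h : c ≤ c') : envSize x e ^ c ≤ envSize x e ^ c' :=
  Nat.pow_le_pow_right (by have := two_le_envSize x e; omega) h

end envSize

lemma add_mul_pow_le {a : ℕ} (ha : 2 ≤ a) (m c : ℕ) : a + m * a ^ c ≤ a ^ (m + c + 1) := by
  have h1 : m + 1 ≤ a ^ m := (Nat.lt_two_pow_self (n := m)).trans_le (Nat.pow_le_pow_left ha m)
  have h2 : a ≤ a ^ (c + 1) := Nat.le_self_pow (by omega) a
  have h3 : a ^ c ≤ a ^ (c + 1) := Nat.pow_le_pow_right (by omega) (by omega)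
  calc a + m * a ^ c ≤ a ^ (c + 1) + m * a ^ (c + 1) :=
        add_le_add h2 (Nat.mul_le_mul_left _ h3)
    _ = (m + 1) * a ^ (c + 1) := by ring
    _ ≤ a ^ m * a ^ (c + 1) := Nat.mul_le_mul_right _ h1
    _ = _ := by rw [← pow_add, add_assoc]

/-- Substituting polynomially bounded quantities for the variables keeps the size polynomial; this
lets exponents compose in `comp` and `iterate`. -/
lemma envSize_le_of_le {V W : Type} [Fintype V] [Fintype W] {x : List Bool} {e : V → ℕ}
    {s : W → ℕ} {c : ℕ} (h : ∀ w, s w ≤ envSize x e ^ c) :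
    envSize x s ≤ envSize x e ^ (Fintype.card W + c + 1) := by
  refine le_trans ?_ (add_mul_pow_le (two_le_envSize x e) _ _)
  have h1 : ∑ w, s w ≤ Fintype.card W * envSize x e ^ c := by
    simpa using Finset.sum_le_card_nsmul Finset.univ s _ fun w _ => h w
  have h2 : x.length + 2 ≤ envSize x e := by unfold envSize; omega
  unfold envSize at *
  omega

lemma Prog.run_comp {p : Prog} {D : ℕ} (hp : ∀ r, p.Writes r → D ≤ r) {V : Type} {ρ : V → ℕ}
    (hρ : ∀ v, ρ v < D) (x : List Bool) (B : ℕ) (σ : ℕ → ℕ) : p.run x B σ ∘ ρ = σ ∘ ρ := by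
  funext v
  exact run_of_not_writes _ _ _ _ fun h => absurd (hp _ h) (by have := hρ v; omega)

namespace LogComputable

variable {V W : Type} [Fintype V] [Fintype W]

/-- No growth estimate is needed: run the program with the register bound `envSize x e ^ (c + 1)`.
The result is a register content, hence below this bound, and it equals `f` for every admissible
bound. -/
lemma exists_bound {f : List Bool → (V → ℕ) → ℕ} (hf : LogComputable f) :
    ∃ c, ∀ x e, f x e ≤ envSize x e ^ c := by
  obtain ⟨c, hc⟩ := hf
  obtain ⟨p, -, -, hp⟩ := hc (fun v => Fintype.equivFin V v) (Fintype.card V) fun v => Fin.is_lt _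
  refine ⟨c + 1, fun x e => ?_⟩
  set σ : ℕ → ℕ := fun r => if h : r < Fintype.card V then e ((Fintype.equivFin V).symm ⟨r, h⟩)
    else 0 with hσ
  have he : (σ ∘ fun v => (Fintype.equivFin V v : ℕ)) = e := by
    funext v
    simp [hσ]
  have h2 := two_le_envSize x e
  have h3 : envSize x e ≤ envSize x e ^ (c + 1) := Nat.le_self_pow (by omega) _
  have hlt : ∀ r, σ r < envSize x e ^ (c + 1) := by
    intro r
    simp only [hσ]
    split
    · exact (lt_envSize x e _).trans_le h3
    · omega
  have := hp x (envSize x e ^ (c + 1)) σ (by omega) hlt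
    (by rw [he]; exact envSize_pow_mono (by omega))
  rw [he] at this
  rw [← this]
  exact (Prog.run_lt x (by omega) p σ hlt _).le

lemma exists_bound_vec {f : W → List Bool → (V → ℕ) → ℕ} (hf : ∀ w, LogComputable (f w)) :
    ∃ c, ∀ w x e, f w x e ≤ envSize x e ^ c := by
  choose c hc using fun w => (hf w).exists_bound
  exact ⟨Finset.univ.sup c, fun w x e => (hc w x e).trans
    (envSize_pow_mono (Finset.le_sup (Finset.mem_univ w)))⟩

/-- Finitely many computable functions can be evaluated one after the other. -/
lemma exists_vec : ∀ {m : ℕ} {f : Fin m → List Bool → (V → ℕ) → ℕ}, (∀ j, LogComputable (f j)) →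
    ∃ c, ∀ (ρ : V → ℕ) (D : ℕ), (∀ v, ρ v < D) → ∃ p : Prog, p.WF ∧ (∀ r, p.Writes r → D ≤ r) ∧
    ∀ (x : List Bool) (B : ℕ) (σ : ℕ → ℕ), 2 ≤ B → (∀ r, σ r < B) → envSize x (σ ∘ ρ) ^ c ≤ B →
      ∀ j : Fin m, p.run x B σ (D + j) = f j x (σ ∘ ρ)
  | 0, _, _ => ⟨0, fun _ D _ => ⟨.copy D (D + 1), by simp [Prog.WF], fun r h => le_of_eq h.symm,
      fun _ _ _ _ _ _ j => j.elim0⟩⟩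
  | m + 1, f, hf => by
    obtain ⟨c₁, h₁⟩ := exists_vec (fun j : Fin m => hf j.castSucc)
    obtain ⟨c₂, h₂⟩ := hf (Fin.last m)
    refine ⟨max c₁ c₂, fun ρ D hρ => ?_⟩
    obtain ⟨p₁, hw₁, hd₁, hp₁⟩ := h₁ ρ D hρ
    obtain ⟨p₂, hw₂, hd₂, hp₂⟩ := h₂ ρ (D + m) fun v => by have := hρ v; omega
    refine ⟨.seq p₁ p₂, ⟨hw₁, hw₂⟩, fun r h => ?_, fun x B σ hB hσ hs j => ?_⟩
    · rcases h with h | h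
      · exact hd₁ r h
      · have := hd₂ r h; omega
    · rw [Prog.run]
      have hcomp := Prog.run_comp hd₁ hρ x B σ
      induction j using Fin.lastCases with
      | last =>
        have := hp₂ x B _ hB (Prog.run_lt x hB p₁ σ hσ)
          (by rw [hcomp]; exact (envSize_pow_mono (le_max_right _ _)).trans hs)
        rwa [hcomp] at this
      | cast j =>
        rw [Prog.run_of_not_writes _ _ _ _ fun h => by
          have h1 := hd₂ _ h
          have h2 := j.is_lt
          simp only [Fin.val_castSucc] at h1
          omega]
        exact hp₁ x B σ hB hσ ((envSize_pow_mono (le_max_left _ _)).trans hs) j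

theorem proj (v : V) : LogComputable fun _ e => e v :=
  ⟨0, fun ρ D hρ => ⟨.copy D (ρ v), (hρ v).ne', fun _ h => le_of_eq h.symm,
    fun x B σ _ _ _ => by simp [Prog.run]⟩⟩

theorem const (k : ℕ) : LogComputable fun _ (_ : V → ℕ) => k :=
  ⟨k, fun ρ D _ => ⟨.incs D k, Prog.incs_wf D k, fun _ => Prog.incs_writes,
    fun x B σ hB hσ hs => Prog.run_incs x hB σ hσ D k (by
      refine lt_of_lt_of_le ?_ hs
      exact Nat.lt_two_pow_self.trans_le (Nat.pow_le_pow_left (two_le_envSize _ _) k))⟩⟩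

theorem succ {f : List Bool → (V → ℕ) → ℕ} (hf : LogComputable f) :
    LogComputable fun x e => f x e + 1 := by
  obtain ⟨c', hc'⟩ := hf.exists_bound
  obtain ⟨c, hc⟩ := hf
  -- Two extra powers of the size give a factor of at least `4`, so the increment does not wrap
  -- around.
  refine ⟨max c (c' + 2), fun ρ D hρ => ?_⟩
  obtain ⟨p, hw, hd, hp⟩ := hc ρ D hρ
  refine ⟨.seq p (.inc D), ⟨hw, Prog.inc_wf D⟩, fun r h => h.elim (hd r) Prog.inc_writes,
    fun x B σ hB hσ hs => ?_⟩
  have h1 := hp x B σ hB hσ ((envSize_pow_mono (le_max_left _ _)).trans hs)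
  have h2 := hc' x (σ ∘ ρ)
  have h3 := (envSize_pow_mono (le_max_right c (c' + 2))).trans hs
  have h4 := two_le_envSize x (σ ∘ ρ)
  have h5 : 1 ≤ envSize x (σ ∘ ρ) ^ c' := Nat.one_le_pow _ _ (by omega)
  have h6 : envSize x (σ ∘ ρ) ^ c' * 4 ≤ envSize x (σ ∘ ρ) ^ (c' + 2) := by
    rw [pow_add]
    exact Nat.mul_le_mul_left _ (by nlinarith)
  rw [Prog.run, Prog.run_inc x hB _ D (Prog.run_lt x hB p σ hσ D), h1,
    Nat.mod_eq_of_lt (by omega)]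

theorem query {f : List Bool → (V → ℕ) → ℕ} (hf : LogComputable f) :
    LogComputable fun x e => if x[f x e]? = some true then 1 else 0 := by
  obtain ⟨c, hc⟩ := hf
  refine ⟨c, fun ρ D hρ => ?_⟩
  obtain ⟨p, hw, hd, hp⟩ := hc ρ D hρ
  refine ⟨.seq p (.query D D), ⟨hw, trivial⟩, fun r h => h.elim (hd r) fun h => le_of_eq h.symm,
    fun x B σ hB hσ hs => ?_⟩
  simp only [Prog.run, Function.update_self, hp x B σ hB hσ hs]

theorem comp {g : List Bool → (W → ℕ) → ℕ} (hg : LogComputable g)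
    {f : W → List Bool → (V → ℕ) → ℕ} (hf : ∀ w, LogComputable (f w)) :
    LogComputable fun x e => g x fun w => f w x e := by
  obtain ⟨c₀, hc₀⟩ := exists_bound_vec hf
  obtain ⟨c₁, h₁⟩ := exists_vec fun j => hf ((Fintype.equivFin W).symm j)
  obtain ⟨c₂, h₂⟩ := hg
  refine ⟨max c₁ ((Fintype.card W + c₀ + 1) * c₂), fun ρ D hρ => ?_⟩
  obtain ⟨p₁, hw₁, hd₁, hp₁⟩ := h₁ ρ D hρ
  -- The inner values occupy the registers from `D` on; the program for `g` reads them there and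
  -- works above them.
  obtain ⟨p₂, hw₂, hd₂, hp₂⟩ := h₂ (fun w => D + Fintype.equivFin W w) (D + Fintype.card W + 1)
    fun w => by have := (Fintype.equivFin W w).is_lt; omega
  refine ⟨.seq p₁ (.seq p₂ (.copy D (D + Fintype.card W + 1))),
    ⟨hw₁, hw₂, by simp only [Prog.WF]; omega⟩, fun r h => ?_, fun x B σ hB hσ hs => ?_⟩
  · rcases h with h | h | h
    · exact hd₁ r h
    · have := hd₂ r h; omega
    · exact le_of_eq h.symm
  · have h3 := hp₁ x B σ hB hσ ((envSize_pow_mono (le_max_left _ _)).trans hs)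
    have h4 : (p₁.run x B σ ∘ fun w => D + (Fintype.equivFin W w : ℕ)) =
        fun w => f w x (σ ∘ ρ) := by
      funext w
      rw [Function.comp_apply, h3, Equiv.symm_apply_apply]
    simp only [Prog.run, Function.update_self]
    rw [hp₂ x B _ hB (Prog.run_lt x hB _ _ hσ), h4]
    rw [h4]
    refine le_trans (Nat.pow_le_pow_left (envSize_le_of_le fun w => hc₀ w x (σ ∘ ρ)) _) ?_
    rw [← pow_mul]
    exact (envSize_pow_mono (le_max_right _ _)).trans hs

/-- Bounded recursion, from which the arithmetic below is derived. Register `D` counts the rounds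
and the next ones hold the state. The hypothesis `hb` asks for one polynomial bound valid in all
rounds, so that every round is run within the same `B`. -/
theorem iterate {g : W → List Bool → (V ⊕ W → ℕ) → ℕ} {h : W → List Bool → (V → ℕ) → ℕ}
    {n : List Bool → (V → ℕ) → ℕ} (hg : ∀ w, LogComputable (g w)) (hh : ∀ w, LogComputable (h w))
    (hn : LogComputable n) (c₀ : ℕ)
    (hb : ∀ x e i w, i ≤ n x e →
      (fun s w => g w x (Sum.elim e s))^[i] (fun w => h w x e) w ≤ envSize x e ^ c₀) (w₀ : W) :
    LogComputable fun x e => (fun s w => g w x (Sum.elim e s))^[n x e] (fun w => h w x e) w₀ := by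
  obtain ⟨c₁, h₁⟩ := hn
  obtain ⟨c₂, h₂⟩ := exists_vec fun j => hh ((Fintype.equivFin W).symm j)
  obtain ⟨c₃, h₃⟩ := exists_vec fun j => hg ((Fintype.equivFin W).symm j)
  set m := Fintype.card W with hm
  refine ⟨max (max c₁ c₂) ((Fintype.card (V ⊕ W) + (c₀ + 1) + 1) * c₃), fun ρ D hρ => ?_⟩
  have hidx : ∀ w, (Fintype.equivFin W w : ℕ) < m := fun w => Fin.is_lt _
  obtain ⟨p₁, hw₁, hd₁, hp₁⟩ := h₁ ρ D hρ
  obtain ⟨p₂, hw₂, hd₂, hp₂⟩ := h₂ ρ (D + 1) fun v => (hρ v).trans (Nat.lt_succ_self _)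
  obtain ⟨p₃, hw₃, hd₃, hp₃⟩ := h₃ (Sum.elim ρ fun w => D + 1 + Fintype.equivFin W w)
    (D + 1 + m) (by
      rintro (v | w)
      · have := hρ v; simp only [Sum.elim_inl]; omega
      · have := hidx w; simp only [Sum.elim_inr]; omega)
  -- Each new component depends on the whole old state, so the new state is computed in a fresh
  -- block and copied back afterwards.
  set body : Prog := .seq p₃ (.copyVec (D + 1) (D + 1 + m) (D + 1 + m + m) m) with hbody
  have hbw : ∀ r, body.Writes r → D + 1 ≤ r := by
    intro r hr
    rcases hr with hr | hr
    · have := hd₃ r hr; omega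
    · have := Prog.copyVec_writes hr; omega
  refine ⟨.seq p₁ (.seq p₂ (.seq (.loop D body) (.copy D (D + 1 + Fintype.equivFin W w₀)))),
    ⟨hw₁, hw₂, ⟨⟨hw₃, Prog.copyVec_wf (by omega)⟩, fun h => absurd (hbw D h) (by omega)⟩,
      by simp only [Prog.WF]; omega⟩, fun r h => ?_, fun x B σ hB hσ hs => ?_⟩
  · rcases h with h | h | (h | h) | h
    · exact hd₁ r h
    · have := hd₂ r h; omega
    · exact le_of_eq h.symm
    · have := hbw r h; omega
    · exact le_of_eq h.symm
  · have hs₁ : envSize x (σ ∘ ρ) ^ c₁ ≤ B :=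
      (envSize_pow_mono ((le_max_left _ _).trans (le_max_left _ _))).trans hs
    have hs₂ : envSize x (σ ∘ ρ) ^ c₂ ≤ B :=
      (envSize_pow_mono ((le_max_right _ _).trans (le_max_left _ _))).trans hs
    have hs₃ := (envSize_pow_mono (le_max_right _ _)).trans hs
    have e₁ := hp₁ x B σ hB hσ hs₁
    have hσ₁ := Prog.run_lt x hB p₁ σ hσ
    have hρ₁ := Prog.run_comp hd₁ hρ x B σ
    simp only [Prog.run, Function.update_self]
    generalize p₁.run x B σ = σ₁ at *
    have e₂ := hp₂ x B σ₁ hB hσ₁ (by rwa [hρ₁])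
    have hσ₂ := Prog.run_lt x hB p₂ σ₁ hσ₁
    have hρ₂ := Prog.run_comp hd₂ (fun v => (hρ v).trans (Nat.lt_succ_self _)) x B σ₁
    have hD₂ : p₂.run x B σ₁ D = σ₁ D :=
      Prog.run_of_not_writes _ _ _ _ fun h => absurd (hd₂ _ h) (by omega)
    rw [hρ₁] at e₂ hρ₂
    rw [hD₂, e₁]
    generalize p₂.run x B σ₁ = σ₂ at *
    have hinv : ∀ i ≤ n x (σ ∘ ρ),
        (∀ r, (fun τ => body.run x B (Function.update τ D (τ D - 1)))^[i] σ₂ r < B) ∧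
        (fun τ => body.run x B (Function.update τ D (τ D - 1)))^[i] σ₂ ∘ ρ = σ ∘ ρ ∧
        ∀ w, (fun τ => body.run x B (Function.update τ D (τ D - 1)))^[i] σ₂
            (D + 1 + Fintype.equivFin W w) =
          (fun s w => g w x (Sum.elim (σ ∘ ρ) s))^[i] (fun w => h w x (σ ∘ ρ)) w := by
      intro i
      induction i with
      | zero =>
        refine fun _ => ⟨hσ₂, hρ₂, fun w => ?_⟩
        simp only [Function.iterate_zero, id]
        rw [e₂, Equiv.symm_apply_apply]
      | succ i ih =>
        intro hi
        obtain ⟨i₁, i₂, i₃⟩ := ih (by omega)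
        have hbi := fun w => hb x (σ ∘ ρ) i w (by omega)
        simp only [Function.iterate_succ_apply']
        generalize (fun τ => body.run x B (Function.update τ D (τ D - 1)))^[i] σ₂ = τ at *
        generalize (fun s w => g w x (Sum.elim (σ ∘ ρ) s))^[i] (fun w => h w x (σ ∘ ρ)) = s at *
        have hτ : ∀ r, Function.update τ D (τ D - 1) r < B := by
          intro r
          by_cases e : r = D
          · subst e; simpa using (Nat.sub_le _ _).trans_lt (i₁ r)
          · simpa [e] using i₁ r
        have hτρ : Function.update τ D (τ D - 1) ∘ ρ = σ ∘ ρ := by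
          rw [← i₂]
          funext v
          exact Function.update_of_ne (hρ v).ne _ _
        have hτw : ∀ w, Function.update τ D (τ D - 1) (D + 1 + Fintype.equivFin W w) = s w := by
          intro w
          rw [Function.update_of_ne (by omega), i₃]
        generalize Function.update τ D (τ D - 1) = τ' at *
        refine ⟨Prog.run_lt x hB _ _ hτ, ?_, fun w => ?_⟩
        · rw [Prog.run_comp hbw (fun v => (hρ v).trans (Nat.lt_succ_self _)), hτρ]
        · have henv : (τ' ∘ Sum.elim ρ fun w => D + 1 + (Fintype.equivFin W w : ℕ)) =
              Sum.elim (σ ∘ ρ) s := by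
            funext v
            rcases v with v | w
            · exact congrFun hτρ v
            · exact hτw w
          rw [hbody, Prog.run, Prog.run_copyVec x B _ (by omega) (by omega) _ (hidx w),
            hp₃ x B τ' hB hτ, henv, Equiv.symm_apply_apply]
          rw [henv]
          refine le_trans (Nat.pow_le_pow_left (envSize_le_of_le (e := σ ∘ ρ) (c := c₀ + 1) ?_) _) ?_
          · rintro (v | w)
            · exact (lt_envSize x (σ ∘ ρ) v).le.trans (Nat.le_self_pow (by omega) _)
            · exact (hbi w).trans (envSize_pow_mono (by omega))
          · rwa [← pow_mul]
    exact (hinv _ le_rfl).2.2 w₀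

end LogComputable

end LogspacePC

/-! ### Closure properties: arithmetic, bounded sums, finite tables, bounded quantifiers. -/

namespace LogspacePC

/-- The function is bounded by a polynomial in the size of the data. -/
def PolyBounded {V : Type} [Fintype V] (f : List Bool → (V → ℕ) → ℕ) : Prop :=
  ∃ c, ∀ x e, f x e ≤ envSize x e ^ c

/-- The indicator of a proposition. -/
noncomputable def ind (P : Prop) : ℕ := open Classical in if P then 1 else 0

lemma ind_of_true {P : Prop} (h : P) : ind P = 1 := if_pos h

lemma ind_of_false {P : Prop} (h : ¬ P) : ind P = 0 := if_neg h

lemma ind_le_one (P : Prop) : ind P ≤ 1 := by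
  by_cases h : P
  · rw [ind_of_true h]
  · rw [ind_of_false h]; exact zero_le_one

lemma ind_eq_one_iff {P : Prop} : ind P = 1 ↔ P := by
  by_cases h : P
  · simp [ind, h]
  · simp [ind, h]

lemma ind_pos_iff {P : Prop} : 0 < ind P ↔ P := by
  by_cases h : P
  · simp [ind, h]
  · simp [ind, h]

/-- A property of the input and of finitely many numbers is decidable in logarithmic space. -/
def LogDecidable {V : Type} [Fintype V] (P : List Bool → (V → ℕ) → Prop) : Prop :=
  LogComputable fun x e => ind (P x e)

/-- Add a variable to an environment. -/
def extend {V : Type} (i : ℕ) (e : V → ℕ) : Option V → ℕ := fun o => o.elim i e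

@[simp] lemma extend_none {V : Type} (i : ℕ) (e : V → ℕ) : extend i e none = i := rfl

@[simp] lemma extend_some {V : Type} (i : ℕ) (e : V → ℕ) (v : V) : extend i e (some v) = e v := rfl

section Bounds

variable {V : Type} [Fintype V] {f g : List Bool → (V → ℕ) → ℕ}

lemma PolyBounded.mul (hf : PolyBounded f) (hg : PolyBounded g) :
    PolyBounded fun x e => f x e * g x e := by
  obtain ⟨a, ha⟩ := hf
  obtain ⟨b, hb⟩ := hg
  exact ⟨a + b, fun x e => (Nat.mul_le_mul (ha x e) (hb x e)).trans (pow_add _ _ _).ge⟩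

lemma PolyBounded.add (hf : PolyBounded f) (hg : PolyBounded g) :
    PolyBounded fun x e => f x e + g x e := by
  obtain ⟨a, ha⟩ := hf
  obtain ⟨b, hb⟩ := hg
  refine ⟨max a b + 1, fun x e => ?_⟩
  have h1 := (ha x e).trans (envSize_pow_mono (le_max_left a b))
  have h2 := (hb x e).trans (envSize_pow_mono (le_max_right a b))
  have h3 := Nat.mul_le_mul_left (envSize x e ^ max a b) (two_le_envSize x e)
  rw [pow_succ]
  change f x e + g x e ≤ _
  omega

lemma PolyBounded.pow (hf : PolyBounded f) (k : ℕ) : PolyBounded fun x e => f x e ^ k := by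
  obtain ⟨a, ha⟩ := hf
  exact ⟨a * k, fun x e => (Nat.pow_le_pow_left (ha x e) k).trans (pow_mul _ _ _).ge⟩

lemma polyBounded_envSize : PolyBounded fun x (e : V → ℕ) => envSize x e :=
  ⟨1, fun _ _ => (pow_one _).ge⟩

lemma polyBounded_const (k : ℕ) : PolyBounded fun _ (_ : V → ℕ) => k :=
  ⟨k, fun _ _ => Nat.lt_two_pow_self.le.trans (Nat.pow_le_pow_left (two_le_envSize _ _) k)⟩

lemma envSize_extend (x : List Bool) (i : ℕ) (e : V → ℕ) :
    envSize x (extend i e) = envSize x e + i := by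
  unfold envSize
  rw [Fintype.sum_option]
  simp only [extend_none, extend_some]
  omega

end Bounds

namespace LogComputable

variable {V W : Type} [Fintype V] [Fintype W] {f g : List Bool → (V → ℕ) → ℕ}

lemma polyBounded (hf : LogComputable f) : PolyBounded f := hf.exists_bound

lemma of_eq (hf : LogComputable f) (h : ∀ x e, f x e = g x e) : LogComputable g := by
  rwa [show g = f from funext fun x => funext fun e => (h x e).symm]

/-- The convenient form of `iterate`: the trajectory `s` is given explicitly, so its bound can be
read off and only its recurrence has to be checked. -/
theorem iterate_of_polyBounded {g : W → List Bool → (V ⊕ W → ℕ) → ℕ}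
    {h : W → List Bool → (V → ℕ) → ℕ} {n F : List Bool → (V → ℕ) → ℕ}
    (hg : ∀ w, LogComputable (g w)) (hh : ∀ w, LogComputable (h w)) (hn : LogComputable n)
    (hF : PolyBounded F) (s : List Bool → (V → ℕ) → ℕ → W → ℕ)
    (h0 : ∀ x e w, s x e 0 w = h w x e)
    (hs : ∀ x e i w, i < n x e → s x e (i + 1) w = g w x (Sum.elim e (s x e i)))
    (hb : ∀ x e i w, i ≤ n x e → s x e i w ≤ F x e) (w₀ : W) :
    LogComputable fun x e => s x e (n x e) w₀ := by
  obtain ⟨c, hc⟩ := hF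
  have key : ∀ x e i, i ≤ n x e →
      (fun s w => g w x (Sum.elim e s))^[i] (fun w => h w x e) = s x e i := by
    intro x e i
    induction i with
    | zero => exact fun _ => funext fun w => (h0 x e w).symm
    | succ i ih =>
      intro hi
      rw [Function.iterate_succ_apply', ih (by omega)]
      exact funext fun w => (hs x e i w (by omega)).symm
  refine (iterate hg hh hn c (fun x e i w hi => ?_) w₀).of_eq fun x e => ?_
  · rw [key x e i hi]
    exact (hb x e i w hi).trans (hc x e)
  · rw [key x e _ le_rfl]

theorem add (hf : LogComputable f) (hg : LogComputable g) :
    LogComputable fun x e => f x e + g x e :=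
  iterate_of_polyBounded (W := Unit) (fun _ => (proj (.inr ())).succ) (fun _ => hf) hg
    (hf.polyBounded.add hg.polyBounded) (fun x e i _ => f x e + i) (fun _ _ _ => rfl)
    (fun _ _ _ _ _ => rfl) (fun _ _ _ _ hi => Nat.add_le_add_left hi _) ()

/-- Kleene's trick: component `false` counts the rounds, and component `true` receives its previous
value. -/
theorem pred (hf : LogComputable f) : LogComputable fun x e => f x e - 1 :=
  iterate_of_polyBounded (W := Bool)
    (g := fun w _ e => if w then e (Sum.inr false) else e (Sum.inr false) + 1)
    (h := fun _ _ _ => 0)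
    (fun w => by cases w <;> simp only [Bool.false_eq_true, if_false, if_true]
                 exacts [(proj (V := V ⊕ Bool) (.inr false)).succ, proj (V := V ⊕ Bool) (.inr false)])
    (fun _ => const 0) hf hf.polyBounded (fun _ _ i w => if w then i - 1 else i)
    (fun _ _ w => by cases w <;> rfl) (fun _ _ i w _ => by cases w <;> simp)
    (fun _ _ i w hi => by cases w <;> simp <;> omega) true

theorem sub (hf : LogComputable f) (hg : LogComputable g) :
    LogComputable fun x e => f x e - g x e :=
  iterate_of_polyBounded (W := Unit) (fun _ => (proj (.inr ())).pred) (fun _ => hf) hg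
    hf.polyBounded (fun x e i _ => f x e - i) (fun _ _ _ => rfl)
    (fun _ _ _ _ _ => by simp only [Sum.elim_inr]; omega) (fun _ _ _ _ _ => Nat.sub_le _ _) ()

/-- Variables can be added. -/
theorem weaken (hf : LogComputable f) (ι : V → W) :
    LogComputable fun x (e : W → ℕ) => f x fun v => e (ι v) :=
  hf.comp fun v => proj (ι v)

theorem mul (hf : LogComputable f) (hg : LogComputable g) :
    LogComputable fun x e => f x e * g x e :=
  iterate_of_polyBounded (W := Unit) (h := fun _ _ _ => 0)
    (fun _ => (proj (.inr ())).add (hf.weaken .inl)) (fun _ => const 0) hg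
    (hf.polyBounded.mul hg.polyBounded) (fun x e i _ => f x e * i) (fun _ _ _ => rfl)
    (fun _ _ _ _ _ => rfl) (fun _ _ _ _ hi => Nat.mul_le_mul_left _ hi) ()

theorem pow (hf : LogComputable f) : ∀ k : ℕ, LogComputable fun x e => f x e ^ k
  | 0 => const 1
  | k + 1 => (pow hf k).mul hf

theorem le (hf : LogComputable f) (hg : LogComputable g) :
    LogDecidable fun x e => f x e ≤ g x e :=
  ((const 1).sub (hf.sub hg)).of_eq fun x e => by
    by_cases h : f x e ≤ g x e
    · rw [ind_of_true h]; omega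
    · rw [ind_of_false h]; omega

theorem lt (hf : LogComputable f) (hg : LogComputable g) :
    LogDecidable fun x e => f x e < g x e := hf.succ.le hg

end LogComputable

namespace LogDecidable

variable {V W : Type} [Fintype V] [Fintype W] {P Q : List Bool → (V → ℕ) → Prop}

lemma of_iff (hP : LogDecidable P) (h : ∀ x e, P x e ↔ Q x e) : LogDecidable Q := by
  rwa [show Q = P from funext fun x => funext fun e => propext (h x e).symm]

theorem not (hP : LogDecidable P) : LogDecidable fun x e => ¬ P x e :=
  ((LogComputable.const 1).sub hP).of_eq fun x e => by
    by_cases h : P x e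
    · rw [ind_of_true h, ind_of_false (not_not.2 h)]
    · rw [ind_of_true h, ind_of_false h]

theorem and (hP : LogDecidable P) (hQ : LogDecidable Q) : LogDecidable fun x e => P x e ∧ Q x e :=
  (hP.mul hQ).of_eq fun x e => by
    by_cases h : P x e <;> by_cases h' : Q x e <;> simp [ind, h, h']

theorem ite (hP : LogDecidable P) [∀ x e, Decidable (P x e)] {f g : List Bool → (V → ℕ) → ℕ}
    (hf : LogComputable f) (hg : LogComputable g) :
    LogComputable fun x e => if P x e then f x e else g x e :=
  ((LogComputable.mul hP hf).add (hP.not.mul hg)).of_eq fun x e => by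
    by_cases h : P x e <;> simp [ind, h]

end LogDecidable

namespace LogComputable

variable {V W : Type} [Fintype V] [Fintype W] {f g : List Bool → (V → ℕ) → ℕ}

theorem eq (hf : LogComputable f) (hg : LogComputable g) :
    LogDecidable fun x e => f x e = g x e :=
  ((hf.le hg).and (hg.le hf)).of_iff fun _ _ => le_antisymm_iff.symm

/-- The state is the index and the partial sum. The latter is polynomially bounded because an index
below `n x e` enlarges the data only polynomially. -/
theorem sum_range {f : List Bool → (Option V → ℕ) → ℕ} (hf : LogComputable f)
    {n : List Bool → (V → ℕ) → ℕ} (hn : LogComputable n) :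
    LogComputable fun x e => ∑ i ∈ Finset.range (n x e), f x (LogspacePC.extend i e) := by
  obtain ⟨c, hc⟩ := hf.exists_bound
  have hle : ∀ x e i, i ≤ n x e → ∑ j ∈ Finset.range i, f x (LogspacePC.extend j e) ≤
      n x e * (envSize x e + n x e) ^ c := by
    intro x e i hi
    refine (Finset.sum_le_card_nsmul _ _ ((envSize x e + n x e) ^ c) fun j hj => ?_).trans ?_
    · refine (hc _ _).trans (Nat.pow_le_pow_left ?_ c)
      rw [envSize_extend]
      have := Finset.mem_range.1 hj
      omega
    · rw [Finset.card_range, smul_eq_mul]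
      exact Nat.mul_le_mul_right _ hi
  refine iterate_of_polyBounded (W := Bool)
    (g := fun w x e => if w then e (Sum.inr true) +
      f x (LogspacePC.extend (e (Sum.inr false)) fun v => e (Sum.inl v)) else e (Sum.inr false) + 1)
    (h := fun _ _ _ => 0)
    (fun w => ?_) (fun _ => const 0) hn
    (hn.polyBounded.add (hn.polyBounded.mul ((polyBounded_envSize.add hn.polyBounded).pow c)))
    (fun x e i w => if w then ∑ j ∈ Finset.range i, f x (LogspacePC.extend j e) else i)
    (fun _ _ w => by cases w <;> rfl) (fun x e i w _ => ?_) (fun x e i w hi => ?_) true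
  · cases w
    · simpa using (proj _).succ
    · simp only [if_true]
      refine (proj _).add (hf.comp (f := fun o x e => LogspacePC.extend (e (Sum.inr false))
        (fun v => e (Sum.inl v)) o) fun o => ?_)
      cases o
      · exact proj _
      · exact proj _
  · cases w
    · simp
    · simp [Finset.sum_range_succ]
  · cases w
    · simp only [Bool.false_eq_true, if_false]; omega
    · simp only [if_true]
      have := hle x e i hi
      omega

/-- The quotient counts the `i < a` with `(i + 1) * b ≤ a`. For `b = 0` the count would be `a`; the
extra factor enforces `a / 0 = 0`. -/
theorem div (hf : LogComputable f) (hg : LogComputable g) :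
    LogComputable fun x e => f x e / g x e := by
  have h1 : LogComputable fun x (e : Option V → ℕ) =>
      ind ((e none + 1) * g x (fun v => e (some v)) ≤ f x (fun v => e (some v))) :=
    ((proj none).succ.mul (hg.weaken some)).le (hf.weaken some)
  refine (mul ((const 0).lt hg) (h1.sum_range hf)).of_eq fun x e => ?_
  simp only [extend_none, extend_some]
  generalize f x e = a
  generalize g x e = b
  rcases Nat.eq_zero_or_pos b with rfl | hb
  · simp [ind]
  · rw [ind_of_true hb, one_mul]
    have : ∀ i ∈ Finset.range a, ind ((i + 1) * b ≤ a) = if i ∈ Finset.range (a / b) then 1 else 0 := by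
      intro i _
      simp only [Finset.mem_range, Nat.lt_iff_add_one_le, Nat.le_div_iff_mul_le hb]
      by_cases h : (i + 1) * b ≤ a <;> simp [ind, h]
    rw [Finset.sum_congr rfl this, Finset.sum_ite_mem, Finset.inter_eq_right.2
      (Finset.range_subset_range.2 (Nat.div_le_self a b))]
    simp

theorem mod (hf : LogComputable f) (hg : LogComputable g) :
    LogComputable fun x e => f x e % g x e :=
  (hf.sub (hg.mul (hf.div hg))).of_eq fun x e => by
    rw [Nat.mod_def]

theorem sum {J : Type} (s : Finset J) {f : J → List Bool → (V → ℕ) → ℕ}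
    (hf : ∀ j, LogComputable (f j)) : LogComputable fun x e => ∑ j ∈ s, f j x e := by
  classical
  induction s using Finset.induction_on with
  | empty => simpa using const 0
  | insert j s hj ih => simpa only [Finset.sum_insert hj] using (hf j).add ih

theorem prod {J : Type} (s : Finset J) {f : J → List Bool → (V → ℕ) → ℕ}
    (hf : ∀ j, LogComputable (f j)) : LogComputable fun x e => ∏ j ∈ s, f j x e := by
  classical
  induction s using Finset.induction_on with
  | empty => simpa using const 1
  | insert j s hj ih => simpa only [Finset.prod_insert hj] using (hf j).mul ih

/-- Every function of finitely many bounded quantities is computable. -/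
theorem table {J : Type} [Fintype J] {g : J → List Bool → (V → ℕ) → ℕ}
    (hg : ∀ j, LogComputable (g j)) (b : ℕ) (hb : ∀ j x e, g j x e ≤ b) (F : (J → ℕ) → ℕ) :
    LogComputable fun x e => F fun j => g j x e := by
  classical
  refine (sum (Finset.univ : Finset (J → Fin (b + 1))) fun y =>
    (const (F fun j => y j)).mul (prod (Finset.univ : Finset J) fun j =>
      (hg j).eq (const (y j : ℕ)))).of_eq fun x e => ?_
  rw [Finset.sum_eq_single (fun j => (⟨g j x e, Nat.lt_succ_of_le (hb j x e)⟩ : Fin (b + 1)))]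
  · simp [ind]
  · intro y _ hy
    obtain ⟨j, hj⟩ := Function.ne_iff.1 hy
    rw [Finset.prod_eq_zero (Finset.mem_univ j), mul_zero]
    exact ind_of_false fun h => hj (Fin.ext h.symm)
  · exact fun h => absurd (Finset.mem_univ _) h

end LogComputable

namespace LogDecidable

variable {V : Type} [Fintype V]

theorem exists_lt {P : List Bool → (Option V → ℕ) → Prop} (hP : LogDecidable P)
    {n : List Bool → (V → ℕ) → ℕ} (hn : LogComputable n) :
    LogDecidable fun x e => ∃ i < n x e, P x (extend i e) :=
  ((LogComputable.const 0).lt (LogComputable.sum_range hP hn)).of_iff fun x e => by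
    rw [Finset.sum_pos_iff]
    simp [ind_pos_iff]

theorem forall_lt {P : List Bool → (Option V → ℕ) → Prop} (hP : LogDecidable P)
    {n : List Bool → (V → ℕ) → ℕ} (hn : LogComputable n) :
    LogDecidable fun x e => ∀ i < n x e, P x (extend i e) :=
  (hP.not.exists_lt hn).not.of_iff fun x e => by simp

theorem forall_fintype {J : Type} [Fintype J] {P : J → List Bool → (V → ℕ) → Prop}
    (hP : ∀ j, LogDecidable (P j)) : LogDecidable fun x e => ∀ j, P j x e :=
  (LogComputable.prod Finset.univ hP).of_eq fun x e => by
    by_cases h : ∀ j, P j x e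
    · rw [ind_of_true h]
      exact Finset.prod_eq_one fun j _ => ind_of_true (h j)
    · rw [ind_of_false h]
      push Not at h
      obtain ⟨j, hj⟩ := h
      exact Finset.prod_eq_zero (Finset.mem_univ j) (ind_of_false hj)

end LogDecidable

/-- Logspace decidable properties of the input are decided by deterministic logspace algorithms. -/
theorem LogDecidable.exists_algorithm {P : List Bool → Prop}
    (hP : LogDecidable fun x (_ : Empty → ℕ) => P x) :
    ∃ A : DeterministicLogspaceAlgorithm, ∀ x r : List Bool, x ≠ [] →
      r.length = A.time.eval x.length → A.machine.result x r = some (open Classical in decide (P x)) := by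
  obtain ⟨c, hc⟩ := hP
  obtain ⟨p, hw, -, hp⟩ := hc (fun v => v.elim) 0 (fun v => v.elim)
  obtain ⟨A, L, hL, hA⟩ := p.exists_algorithm hw c
  refine ⟨A, fun x r hx hr => ?_⟩
  obtain ⟨h1, h2⟩ := hL x hx
  have hB : 2 ≤ 2 ^ L x := by
    calc 2 = 2 ^ 1 := rfl
      _ ≤ _ := Nat.pow_le_pow_right (by norm_num) h2
  rw [hA x r hr, hp x (2 ^ L x) (fun _ => 0) hB (fun _ => by omega) (by simpa [envSize] using h1)]
  by_cases h : P x <;> simp [ind, h]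

end LogspacePC

namespace LogspacePC

/-! ### Simulation of machines on computed inputs -/

namespace Tape

/-- Split the sum at position `h`: the low part is below `2 ^ h`, and the parity of the shifted high
part is its cell `0`. -/
lemma value_div_mod (t : Tape) (h : ℕ) : t.value / 2 ^ h % 2 = if h ∈ t.ones then 1 else 0 := by
  have h1 : t.value = ∑ i ∈ t.ones.filter (· < h), 2 ^ i +
      2 ^ h * ∑ i ∈ t.ones.filter (¬ · < h), 2 ^ (i - h) := by
    rw [Tape.value, ← Finset.sum_filter_add_sum_filter_not t.ones (· < h), Finset.mul_sum]
    congr 1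
    refine Finset.sum_congr rfl fun i hi => ?_
    have := (Finset.mem_filter.1 hi).2
    rw [← pow_add]
    congr 1
    omega
  have h2 : ∑ i ∈ t.ones.filter (· < h), 2 ^ i < 2 ^ h :=
    Tape.value_lt (t := ⟨t.ones.filter (· < h), 0⟩) fun i hi =>
      Finset.mem_range.2 (Finset.mem_filter.1 hi).2
  have h3 := Tape.bit_eq_decide_value
    (t := ⟨(t.ones.filter (¬ · < h)).image (· - h), 0⟩) rfl
  have h4 : (Tape.mk ((t.ones.filter (¬ · < h)).image (· - h)) 0).value =
      ∑ i ∈ t.ones.filter (¬ · < h), 2 ^ (i - h) := by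
    refine Finset.sum_image fun i hi j hj hij => ?_
    have := (Finset.mem_filter.1 hi).2
    have := (Finset.mem_filter.1 hj).2
    omega
  have h5 : 0 ∈ (t.ones.filter (¬ · < h)).image (· - h) ↔ h ∈ t.ones := by
    simp only [Finset.mem_image, Finset.mem_filter]
    constructor
    · rintro ⟨i, ⟨hi, hih⟩, h0⟩
      obtain rfl : i = h := by omega
      exact hi
    · exact fun hh => ⟨h, ⟨hh, lt_irrefl _⟩, Nat.sub_self h⟩
  rw [h4] at h3
  rw [h1, Nat.add_mul_div_left _ _ (by positivity), Nat.div_eq_of_lt h2, zero_add]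
  simp only [Tape.bit, decide_eq_decide, h5] at h3
  by_cases hh : h ∈ t.ones
  · rw [if_pos hh]; exact h3.1 hh
  · rw [if_neg hh]; have := mt h3.2 hh; omega

lemma bit_eq_decide_div (t : Tape) : t.bit = decide (t.value / 2 ^ t.head % 2 = 1) := by
  rw [value_div_mod]
  unfold bit
  by_cases h : t.head ∈ t.ones <;> simp [h]

/-- The truncated subtraction is exact: a scanned `1` contributes its weight to the value. -/
lemma value_act (t : Tape) (b : Bool) (m : Move) :
    (t.act b m).value = t.value + 2 ^ t.head * b.toNat - 2 ^ t.head * t.bit.toNat := by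
  by_cases h : t.head ∈ t.ones
  · have h1 := Finset.sum_erase_add t.ones (fun i => 2 ^ i) h
    cases b
    · simp only [value, act, bit, h]
      simp
      omega
    · simp [value, act, bit, h]
  · cases b
    · simp [value, act, bit, h]
    · simp [value, act, bit, h]
      omega

end Tape

/-- The numerical code of a move. -/
def Move.code : Move → ℕ
  | .left => 0
  | .stay => 1
  | .right => 2

/-- At the left end `2 ^ head = 1` and `1 / 2 = 0`; the truncated summand restores `1`, since the
head stays put there. -/
lemma Tape.two_pow_head_act (t : Tape) (b : Bool) (m : Move) : 2 ^ (t.act b m).head =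
    if m.code = 0 then 2 ^ t.head / 2 + (1 - 2 ^ t.head / 2)
      else if m.code = 1 then 2 ^ t.head else 2 ^ t.head * 2 := by
  cases m
  · simp only [Move.code, if_true, Tape.act_head_left]
    rcases t.head with _ | h
    · rfl
    · have := Nat.one_le_two_pow (n := h)
      rw [pow_succ, Nat.mul_div_cancel _ (by norm_num), Nat.add_sub_cancel]
      omega
  · simp [Move.code]
  · simp [Move.code, pow_succ]

namespace Machine

variable (M : Machine)

/-- The action of a machine in terms of what it sees; it does not move after it has halted. -/
def action (q : M.State) (v : M.Ix → Bool × Bool) (i : Option Bool) :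
    M.State × (M.Ix → Bool × Move) :=
  match M.output q with
  | some _ => (q, fun t => ((v t).1, .stay))
  | none => M.trans q v i false

variable {M}

lemma step_false (x : List Bool) (c : M.Config) : M.step x c false =
    ⟨(M.action c.state (view c.tape) x[(c.tape M.addr).value]?).1, fun t => (c.tape t).act
      ((M.action c.state (view c.tape) x[(c.tape M.addr).value]?).2 t).1
      ((M.action c.state (view c.tape) x[(c.tape M.addr).value]?).2 t).2⟩ := by
  unfold step action
  cases h : M.output c.state with
  | none => rfl
  | some o =>
    have : (fun t => (c.tape t).act (view c.tape t).1 .stay) = c.tape :=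
      funext fun t => Tape.act_bit_stay _
    cases c
    simp only at this ⊢
    rw [this]

end Machine

lemma LogComputable.eval {V : Type} [Fintype V] {f : List Bool → (V → ℕ) → ℕ}
    (hf : LogComputable f) (T : Polynomial ℕ) : LogComputable fun x e => T.eval (f x e) :=
  (LogComputable.sum (Finset.range (T.natDegree + 1)) fun i =>
    (LogComputable.const (T.coeff i)).mul (hf.pow i)).of_eq fun _ _ =>
      (Polynomial.eval_eq_sum_range _).symm

/-- A list of bits that depends on the input and on finitely many numbers is computable in
logarithmic space: its length is, and so are its entries. -/
structure LogComputableList {V : Type} [Fintype V] (X : List Bool → (V → ℕ) → List Bool) : Prop where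
  length : LogComputable fun x e => (X x e).length
  entry : LogDecidable fun x (e : Option V → ℕ) => (X x fun v => e (some v))[e none]? = some true

section Simulation

variable (M : Machine) [Fintype M.State]

/-- The data of a configuration: the state, and for each tape the number on it and the power of `2`
at the position of the head. -/
noncomputable def confData (c : M.Config) : Option (M.Ix × Bool) → ℕ
  | none => Fintype.equivFin M.State c.state
  | some (t, false) => (c.tape t).value
  | some (t, true) => 2 ^ (c.tape t).head

/-- What determines the next action. -/
noncomputable def confView (d : Option (M.Ix × Bool) → ℕ) (i : ℕ) : Option (Option (M.Ix × Bool)) → ℕ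
  | none => i
  | some none => d none
  | some (some (t, false)) => d (some (t, false)) / d (some (t, true)) % 2
  | some (some (t, true)) => ind (d (some (t, true)) = 1)

/-- The next action, in terms of numbers. -/
noncomputable def tableAction (y : Option (Option (M.Ix × Bool)) → ℕ) :
    M.State × (M.Ix → Bool × Move) :=
  M.action (if h : y (some none) < Fintype.card M.State then
      (Fintype.equivFin M.State).symm ⟨_, h⟩ else M.start)
    (fun t => (decide (y (some (some (t, false))) = 1), decide (y (some (some (t, true))) = 1)))
    (if y none = 2 then none else some (decide (y none = 1)))

/-- The data of the next configuration. -/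
noncomputable def nextData (d : Option (M.Ix × Bool) → ℕ)
    (y : Option (Option (M.Ix × Bool)) → ℕ) : Option (M.Ix × Bool) → ℕ
  | none => Fintype.equivFin M.State (tableAction M y).1
  | some (t, false) => d (some (t, false)) + d (some (t, true)) * ((tableAction M y).2 t).1.toNat -
      d (some (t, true)) * (d (some (t, false)) / d (some (t, true)) % 2)
  | some (t, true) => if ((tableAction M y).2 t).2.code = 0 then
        d (some (t, true)) / 2 + (1 - d (some (t, true)) / 2)
      else if ((tableAction M y).2 t).2.code = 1 then d (some (t, true)) else d (some (t, true)) * 2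

/-- The numerical code of an input symbol. -/
noncomputable def inputCode (X : List Bool) (a : ℕ) : ℕ :=
  if X.length ≤ a then 2 else ind (X[a]? = some true)

/-- Storing heads as powers of two turns reading and writing a cell into division and addition. The
finite control enters only through `tableAction`. -/
lemma confData_step (X : List Bool) (c : M.Config) : confData M (M.step X c false) =
    nextData M (confData M c)
      (confView M (confData M c) (inputCode X (confData M c (some (M.addr, false))))) := by
  have h1 : tableAction M (confView M (confData M c)
      (inputCode X (confData M c (some (M.addr, false))))) =
      M.action c.state (view c.tape) X[(c.tape M.addr).value]? := by
    unfold tableAction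
    congr 1
    · simp [confView, confData]
    · funext t
      simp only [confView, confData, view, Tape.bit_eq_decide_div, ind_eq_one_iff, Tape.atLeftEnd]
      congr 2
      simp
    · change (if inputCode X (c.tape M.addr).value = 2 then none
        else some (decide (inputCode X (c.tape M.addr).value = 1))) = _
      unfold inputCode
      by_cases h : X.length ≤ (c.tape M.addr).value
      · simp [h]
      · rw [if_neg h, if_neg (by have := ind_le_one (X[(c.tape M.addr).value]? = some true); omega),
          List.getElem?_eq_getElem (by omega)]
        simp [ind_eq_one_iff]
  funext w
  rw [Machine.step_false, ← h1]
  rcases w with _ | ⟨t, _ | _⟩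
  · rfl
  · simp only [confData, nextData]
    rw [Tape.value_act, Tape.bit_eq_decide_div]
    congr 2
    have := Nat.mod_lt ((c.tape t).value / 2 ^ (c.tape t).head) (show 0 < 2 by norm_num)
    by_cases h : (c.tape t).value / 2 ^ (c.tape t).head % 2 = 1
    · simp [h]
    · simp [show (c.tape t).value / 2 ^ (c.tape t).head % 2 = 0 by omega]
  · exact Tape.two_pow_head_act _ _ _

end Simulation

lemma LogComputable.min {V : Type} [Fintype V] {f g : List Bool → (V → ℕ) → ℕ}
    (hf : LogComputable f) (hg : LogComputable g) :
    LogComputable fun x e => Nat.min (f x e) (g x e) :=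
  (hf.sub (hf.sub hg)).of_eq fun x e => by
    change _ = Min.min _ _
    omega

/-- A function of finitely many quantities that does not distinguish large values is computable. -/
lemma LogComputable.table_of_min {V J : Type} [Fintype V] [Fintype J]
    {g : J → List Bool → (V → ℕ) → ℕ} (hg : ∀ j, LogComputable (g j)) (b : ℕ) {F : (J → ℕ) → ℕ}
    (hF : ∀ y, F (fun j => Nat.min (y j) b) = F y) : LogComputable fun x e => F fun j => g j x e :=
  (LogComputable.table (fun j => (hg j).min (LogComputable.const b)) b
    (fun _ _ _ => Nat.min_le_right _ _) F).of_eq fun _ _ => hF _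

section Simulation

variable {M : Machine}

/-- The action only compares its arguments with `1`, `2` and the number of states, so truncating
them above these values loses nothing and leaves a finite table. -/
lemma tableAction_min [Fintype M.State] (y : Option (Option (M.Ix × Bool)) → ℕ) :
    tableAction M (fun j => Nat.min (y j) (Fintype.card M.State + 3)) = tableAction M y := by
  have h1 : ∀ a, Nat.min a (Fintype.card M.State + 3) = 1 ↔ a = 1 := fun a => by
    change Min.min _ _ = 1 ↔ _; omega
  have h2 : ∀ a, Nat.min a (Fintype.card M.State + 3) = 2 ↔ a = 2 := fun a => by
    change Min.min _ _ = 2 ↔ _; omega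
  have h3 : (if h : Nat.min (y (some none)) (Fintype.card M.State + 3) < Fintype.card M.State then
      (Fintype.equivFin M.State).symm ⟨_, h⟩ else M.start) =
      if h : y (some none) < Fintype.card M.State then
      (Fintype.equivFin M.State).symm ⟨_, h⟩ else M.start := by
    by_cases h : y (some none) < Fintype.card M.State
    · have h4 : Nat.min (y (some none)) (Fintype.card M.State + 3) = y (some none) :=
        Nat.min_eq_left (by omega)
      rw [dif_pos h, dif_pos (by rwa [h4])]
      congr 2
    · rw [dif_neg h, dif_neg]
      change ¬ Min.min _ _ < _
      omega
  unfold tableAction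
  simp only [h1, h2, h3]

lemma logComputable_confView [Fintype M.Ix] {V : Type} [Fintype V] {X : List Bool → (V → ℕ) → List Bool}
    (hX : LogComputableList X) (j : Option (Option (M.Ix × Bool))) :
    LogComputable fun x (e : V ⊕ Option (M.Ix × Bool) → ℕ) =>
      confView M (fun w => e (.inr w))
        (inputCode (X x fun v => e (.inl v)) (e (.inr (some (M.addr, false))))) j := by
  rcases j with _ | _ | ⟨t, _ | _⟩
  · refine LogDecidable.ite ((hX.length.weaken Sum.inl).le (LogComputable.proj _))
      (LogComputable.const 2) ?_
    exact hX.entry.comp (f := fun o _ (e : V ⊕ Option (M.Ix × Bool) → ℕ) =>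
      o.elim (e (.inr (some (M.addr, false)))) fun v => e (.inl v)) fun o => by
        cases o
        · exact LogComputable.proj _
        · exact LogComputable.proj _
  · exact LogComputable.proj _
  · exact ((LogComputable.proj _).div (LogComputable.proj _)).mod (LogComputable.const 2)
  · exact (LogComputable.proj _).eq (LogComputable.const 1)

lemma logComputable_nextData [Fintype M.State] [Fintype M.Ix] {V : Type} [Fintype V]
    {X : List Bool → (V → ℕ) → List Bool}
    (hX : LogComputableList X) (w : Option (M.Ix × Bool)) :
    LogComputable fun x (e : V ⊕ Option (M.Ix × Bool) → ℕ) =>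
      nextData M (fun w => e (.inr w)) (confView M (fun w => e (.inr w))
        (inputCode (X x fun v => e (.inl v)) (e (.inr (some (M.addr, false)))))) w := by
  have key : ∀ F : M.State × (M.Ix → Bool × Move) → ℕ,
      LogComputable fun x (e : V ⊕ Option (M.Ix × Bool) → ℕ) =>
        F (tableAction M (confView M (fun w => e (.inr w))
          (inputCode (X x fun v => e (.inl v)) (e (.inr (some (M.addr, false))))))) := fun F =>
    LogComputable.table_of_min (F := fun y => F (tableAction M y)) (logComputable_confView hX)
      (Fintype.card M.State + 3) fun y => by rw [tableAction_min]
  rcases w with _ | ⟨t, _ | _⟩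
  · exact key fun a => Fintype.equivFin M.State a.1
  · exact ((LogComputable.proj _).add ((LogComputable.proj _).mul
      (key fun a => (a.2 t).1.toNat))).sub ((LogComputable.proj _).mul
        (((LogComputable.proj _).div (LogComputable.proj _)).mod (LogComputable.const 2)))
  · have h2 := (LogComputable.proj (V := V ⊕ Option (M.Ix × Bool)) (.inr (some (t, true)))).div
      (LogComputable.const 2)
    exact LogDecidable.ite ((key fun a => (a.2 t).2.code).eq (LogComputable.const 0))
      (h2.add ((LogComputable.const 1).sub h2))
      (LogDecidable.ite ((key fun a => (a.2 t).2.code).eq (LogComputable.const 1))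
        (LogComputable.proj _) ((LogComputable.proj _).mul (LogComputable.const 2)))

end Simulation

/-- Deterministic logspace algorithms can be run in logarithmic space on inputs that are computable
in logarithmic space. -/
theorem DeterministicLogspaceAlgorithm.logDecidable (A : DeterministicLogspaceAlgorithm)
    {V : Type} [Fintype V] {X : List Bool → (V → ℕ) → List Bool} (hX : LogComputableList X) :
    LogDecidable fun x e => A.result (X x e) = some true := by
  have := A.machine.finite_state
  have := A.machine.finite_ix
  have := Fintype.ofFinite A.machine.State
  have := Fintype.ofFinite A.machine.Ix
  obtain ⟨c, hc⟩ := A.logspace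
  have hrun : ∀ X i, (fun d => A.machine.step X d false)^[i] A.machine.init =
      A.machine.run X (List.replicate i false) := fun X i => by
    rw [A.deterministic.run_eq, List.length_replicate]
  have hstate : LogComputable fun x e => confData A.machine (A.machine.run (X x e)
      (List.replicate (A.time.eval (X x e).length) false)) none := by
    -- Logarithmic space keeps the data polynomial: tape contents and `2 ^ head` are at most `2 ^ (c
    -- * (log |X| + 1)) ≤ (2 * (|X| + 1)) ^ c`. Each round asks for a single entry of `X`, so `X` is
    -- never stored.
    refine LogComputable.iterate_of_polyBounded (fun w => logComputable_nextData hX w)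
      (fun w => LogComputable.const (confData A.machine A.machine.init w)) (hX.length.eval A.time)
      ((polyBounded_const (Fintype.card A.machine.State)).add
        (((polyBounded_const 2).mul (hX.length.polyBounded.add (polyBounded_const 1))).pow c))
      (fun x e i => confData A.machine (A.machine.run (X x e) (List.replicate i false)))
      (fun _ _ _ => rfl) (fun x e i w _ => ?_) (fun x e i w _ => ?_) none
    · rw [← hrun, Function.iterate_succ_apply', hrun, confData_step]
      rfl
    · have h1 : 2 ^ (c * (Nat.log 2 (X x e).length + 1)) ≤ (2 * ((X x e).length + 1)) ^ c := by
        rw [mul_comm, pow_mul]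
        refine Nat.pow_le_pow_left ?_ c
        rw [pow_succ]
        by_cases h0 : (X x e).length = 0
        · simp [h0]
        · have := Nat.pow_log_le_self 2 h0
          omega
      rcases w with _ | ⟨t, _ | _⟩
      · exact (Fin.is_lt _).le.trans (Nat.le_add_right _ _)
      · refine (Tape.value_lt (Machine.ones_run_subset (hc (X x e)) _ t)).le.trans ?_
        exact h1.trans (Nat.le_add_left _ _)
      · refine (Nat.pow_le_pow_right (by norm_num) (hc (X x e) _ t).le).trans ?_
        exact h1.trans (Nat.le_add_left _ _)
  refine (LogComputable.table (J := Unit) (fun _ => hstate) (Fintype.card A.machine.State)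
    (fun _ _ _ => (Fin.is_lt _).le) (fun y => ind (∃ h : y () < Fintype.card A.machine.State,
      A.machine.output ((Fintype.equivFin A.machine.State).symm ⟨_, h⟩) = some true))).of_eq
    fun x e => ?_
  congr 1
  simp [confData, DeterministicLogspaceAlgorithm.result, Machine.result]

end LogspacePC

namespace LogspacePC

/-! ### Reading unary numbers -/

/-- Move on from a position of the input that holds a `1`. -/
def scanStep (x : List Bool) (a : ℕ) : ℕ := if x[a]? = some true then a + 1 else a

/-- The first position from `a` on that does not hold a `1`. -/
def scan (x : List Bool) (a : ℕ) : ℕ := (scanStep x)^[x.length] a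

lemma iterate_scanStep {x : List Bool} {a m : ℕ} (h : ∀ j < m, x[a + j]? = some true) :
    ∀ i ≤ m, (scanStep x)^[i] a = a + i
  | 0, _ => rfl
  | i + 1, hi => by
    rw [Function.iterate_succ_apply', iterate_scanStep h i (by omega), scanStep,
      if_pos (h i (by omega)), add_assoc]

lemma iterate_scanStep_of_le {x : List Bool} {a m : ℕ} (h : ∀ j < m, x[a + j]? = some true)
    (h' : x[a + m]? ≠ some true) {i : ℕ} (hi : m ≤ i) : (scanStep x)^[i] a = a + m := by
  induction i, hi using Nat.le_induction with
  | base => exact iterate_scanStep h m le_rfl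
  | succ i _ ih => rw [Function.iterate_succ_apply', ih, scanStep, if_neg h']

lemma exists_scan (x : List Bool) (a : ℕ) : ∃ m ≤ x.length, (∀ j < m, x[a + j]? = some true) ∧
    x[a + m]? ≠ some true := by
  classical
  have hex : ∃ m, x[a + m]? ≠ some true := ⟨x.length, by simp⟩
  refine ⟨Nat.find hex, Nat.find_min' hex (by simp), fun j hj => ?_, Nat.find_spec hex⟩
  exact not_not.1 (Nat.find_min hex hj)

lemma scan_eq {x : List Bool} {a m : ℕ} (h : ∀ j < m, x[a + j]? = some true)
    (h' : x[a + m]? ≠ some true) : scan x a = a + m := by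
  refine iterate_scanStep_of_le h h' ?_
  by_contra hlt
  have := h x.length (by omega)
  simp at this

lemma iterate_scanStep_eq_scan (x : List Bool) (a : ℕ) {i : ℕ} (hi : x.length ≤ i) :
    (scanStep x)^[i] a = scan x a := by
  obtain ⟨m, hm, h, h'⟩ := exists_scan x a
  rw [scan_eq h h', iterate_scanStep_of_le h h' (hm.trans hi)]

lemma iterate_scanStep_le (x : List Bool) (a : ℕ) (i : ℕ) : (scanStep x)^[i] a ≤ a + x.length := by
  obtain ⟨m, hm, h, h'⟩ := exists_scan x a
  rcases le_total i m with hi | hi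
  · rw [iterate_scanStep h i hi]; omega
  · rw [iterate_scanStep_of_le h h' hi]; omega

/-- Count down the register `D` from its maximal value, and each time move on the position in the
register `D + 2`. -/
def Prog.scanProg (D : ℕ) : Prog :=
  .seq (.clear D) (.seq (.dec D)
    (.loop D (.seq (.query (D + 1) (D + 2)) (.loop (D + 1) (.inc (D + 2))))))

/-- The length of `x` is not yet known to be computable, so `iterate` does not apply with that
number of rounds. The program runs `B - 1` rounds instead: `B - 1 ≥ |x|`, and scanning is stationary
after at most `|x|` rounds. -/
theorem LogComputable.scan {V : Type} [Fintype V] {f : List Bool → (V → ℕ) → ℕ}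
    (hf : LogComputable f) : LogComputable fun x e => LogspacePC.scan x (f x e) := by
  obtain ⟨c', hc'⟩ := hf.polyBounded.add (polyBounded_envSize (V := V))
  obtain ⟨c, hc⟩ := hf
  refine ⟨max c (c' + 1), fun ρ D hρ => ?_⟩
  obtain ⟨p, hw, hd, hp⟩ := hc ρ (D + 2) fun v => by have := hρ v; omega
  have hbw : ∀ r, (Prog.seq (.query (D + 1) (D + 2)) (.loop (D + 1) (.inc (D + 2)))).Writes r →
      D + 1 ≤ r := by
    intro r h
    rcases h with h | h | h
    · exact le_of_eq h.symm
    · exact le_of_eq h.symm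
    · have := Prog.inc_writes h; omega
  refine ⟨.seq p (.seq (.scanProg D) (.copy D (D + 2))), ⟨hw, ⟨Prog.clear_wf D, trivial,
    ⟨trivial, Prog.inc_wf _, fun h => by have := Prog.inc_writes h; omega⟩,
      fun h => by have := hbw _ h; omega⟩, by simp [Prog.WF]⟩, fun r h => ?_,
    fun x B σ hB hσ hs => ?_⟩
  · rcases h with h | (h | h | h | h) | h
    · have := hd r h; omega
    · exact Prog.clear_writes h
    · exact le_of_eq h.symm
    · exact le_of_eq h.symm
    · have := hbw r h; omega
    · exact le_of_eq h.symm
  · have h1 := hp x B σ hB hσ ((envSize_pow_mono (le_max_left _ _)).trans hs)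
    have h2 : f x (σ ∘ ρ) + x.length + 1 < B := by
      have h3 := hc' x (σ ∘ ρ)
      have h4 := (envSize_pow_mono (le_max_right c (c' + 1))).trans hs
      have h5 := Nat.mul_le_mul_left (envSize x (σ ∘ ρ) ^ c') (two_le_envSize x (σ ∘ ρ))
      have h6 := length_lt_envSize x (σ ∘ ρ)
      rw [pow_succ] at h4
      change f x (σ ∘ ρ) + envSize x (σ ∘ ρ) ≤ _ at h3
      omega
    have hσ1 := Prog.run_lt x hB p σ hσ
    have hrun : ∀ σ₁, (Prog.scanProg D).run x B σ₁ =
        (fun τ => (Prog.loop (D + 1) (.inc (D + 2))).run x B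
          ((Prog.query (D + 1) (D + 2)).run x B (Function.update τ D (τ D - 1))))^[
          (Prog.seq (.clear D) (.dec D)).run x B σ₁ D]
          ((Prog.seq (.clear D) (.dec D)).run x B σ₁) := fun _ => rfl
    rw [Prog.run, Prog.run, Prog.run, Function.update_self, hrun]
    generalize p.run x B σ = σ₁ at *
    have hσ2 := Prog.run_lt x hB (.seq (.clear D) (.dec D)) σ₁ hσ1
    have h3 : (Prog.seq (.clear D) (.dec D)).run x B σ₁ (D + 2) = σ₁ (D + 2) := by
      refine Prog.run_of_not_writes _ _ _ _ ?_
      simp [Prog.clear, Prog.Writes]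
    have h4 : (Prog.seq (.clear D) (.dec D)).run x B σ₁ D = B - 1 := by
      rw [Prog.run, Prog.run, Function.update_self, Prog.run_clear, zero_add,
        Nat.mod_eq_of_lt (by omega)]
    generalize (Prog.seq (.clear D) (.dec D)).run x B σ₁ = σ₂ at *
    have hinv : ∀ i, (∀ r, (fun τ => (Prog.loop (D + 1) (.inc (D + 2))).run x B
          ((Prog.query (D + 1) (D + 2)).run x B (Function.update τ D (τ D - 1))))^[i] σ₂ r < B) ∧
        (fun τ => (Prog.loop (D + 1) (.inc (D + 2))).run x B
          ((Prog.query (D + 1) (D + 2)).run x B (Function.update τ D (τ D - 1))))^[i] σ₂ (D + 2) =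
          (scanStep x)^[i] (f x (σ ∘ ρ)) := by
      intro i
      induction i with
      | zero => exact ⟨hσ2, by simp only [Function.iterate_zero, id, h3, h1]⟩
      | succ i ih =>
        obtain ⟨i₁, i₂⟩ := ih
        have hle := iterate_scanStep_le x (f x (σ ∘ ρ)) i
        simp only [Function.iterate_succ_apply']
        generalize (fun τ => (Prog.loop (D + 1) (.inc (D + 2))).run x B
          ((Prog.query (D + 1) (D + 2)).run x B (Function.update τ D (τ D - 1))))^[i] σ₂ = τ at *
        have hτ : ∀ r, Function.update τ D (τ D - 1) r < B := by
          intro r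
          by_cases e : r = D
          · subst e; simpa using (Nat.sub_le _ _).trans_lt (i₁ r)
          · simpa [e] using i₁ r
        have hτ' : Function.update τ D (τ D - 1) (D + 2) = (scanStep x)^[i] (f x (σ ∘ ρ)) := by
          rw [Function.update_of_ne (by omega), i₂]
        generalize Function.update τ D (τ D - 1) = τ' at *
        refine ⟨Prog.run_lt x hB _ _ (Prog.run_lt x hB _ _ hτ), ?_⟩
        have hq := Prog.run_lt x hB (.query (D + 1) (D + 2)) τ' hτ
        generalize hQ : (Prog.query (D + 1) (D + 2)).run x B τ' = τ₂ at *
        have hQ1 : τ₂ (D + 1) = if x[τ' (D + 2)]? = some true then 1 else 0 := by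
          rw [← hQ]; simp [Prog.run]
        have hQ2 : τ₂ (D + 2) = τ' (D + 2) := by
          rw [← hQ]; simp [Prog.run]
        -- The inner loop runs at most once and serves as a conditional.
        rw [Prog.run, hQ1, hτ', scanStep]
        split
        · rw [Function.iterate_one, Prog.run_inc x hB, Function.update_of_ne (by omega), hQ2, hτ',
            Nat.mod_eq_of_lt (by omega)]
          rw [Function.update_of_ne (by omega)]
          exact hq _
        · rw [Function.iterate_zero, id, hQ2, hτ']
    rw [(hinv _).2, h4]
    exact iterate_scanStep_eq_scan x _ (by omega)

end LogspacePC

namespace LogspacePC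

/-! ### The detection algorithm -/

/-- The number of vertices that is given by the input. -/
def readN (x : List Bool) : ℕ := scan x 0

/-- The size of the planted set that is given by the input. -/
def readK (x : List Bool) : ℕ := scan x (readN x + 1) - (readN x + 1)

/-- The position of the adjacency tensor in the input. -/
def header (s : ℕ) (x : List Bool) : ℕ := readN x + readK x + s + 3

/-- The composition of the transpositions `(i a_i)` for `i < m`. -/
def swaps (a : ℕ → ℕ) : ℕ → ℕ → ℕ
  | 0, v => v
  | m + 1, v => swaps a m (if v = m then a m else if v = a m then m else v)

/-- The digits of a number to the base `n`. -/
def digit (n t i : ℕ) : ℕ := t / n ^ i % n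

/-- The index of the tuple of vertices that is obtained by a permutation of the vertices. -/
def swapIndex (s n t j : ℕ) : ℕ := ∑ i ∈ Finset.range s, swaps (digit n t) (s - 2) (digit n j i) * n ^ i

/-- The entry of the permuted adjacency tensor. -/
def SwapAdj (s : ℕ) (x : List Bool) (t j : ℕ) : Prop :=
  x[header s x + swapIndex s (readN x) t j]? = some true

/-- The entry of the input for the recovery algorithm on the permuted hypergraph. -/
def SwapEntry (s : ℕ) (x : List Bool) (t v a : ℕ) : Prop :=
  a < readN x ∨ (readN x < a ∧ a < readN x + 1 + readK x) ∨
    (readN x + readK x + 2 ≤ a ∧ a < readN x + readK x + 2 + s) ∨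
    (header s x ≤ a ∧ a < header s x + readN x ^ s ∧ SwapAdj s x t (a - header s x)) ∨
    (header s x + readN x ^ s ≤ a ∧ a < header s x + readN x ^ s + v)

/-- The input for the recovery algorithm on the permuted hypergraph. -/
noncomputable def swapInput (s : ℕ) (x : List Bool) (t v : ℕ) : List Bool :=
  (List.range (header s x + readN x ^ s + v + 1)).map
    fun a => open Classical in decide (SwapEntry s x t v a)

/-- For some permutation of the vertices, the recovery algorithm finds a clique of the right size. -/
def Detects (A : DeterministicLogspaceAlgorithm) (s : ℕ) (x : List Bool) : Prop :=
  ∃ t < readN x ^ (s - 2),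
    ∑ v ∈ Finset.range (readN x), ind (A.result (swapInput s x t v) = some true) = readK x ∧
    ∀ u < readN x ^ s,
      (∀ i j : Fin s, i ≠ j → digit (readN x) u i ≠ digit (readN x) u j) →
      (∀ i : Fin s, A.result (swapInput s x t (digit (readN x) u i)) = some true) →
      SwapAdj s x t u

section LogDecidable

variable {V : Type} [Fintype V] {P Q : List Bool → (V → ℕ) → Prop}

theorem LogDecidable.or (hP : LogDecidable P) (hQ : LogDecidable Q) :
    LogDecidable fun x e => P x e ∨ Q x e :=
  (hP.not.and hQ.not).not.of_iff fun x e => by tauto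

theorem LogDecidable.imp (hP : LogDecidable P) (hQ : LogDecidable Q) :
    LogDecidable fun x e => P x e → Q x e :=
  (hP.not.or hQ).of_iff fun x e => by tauto

lemma logComputable_readN : LogComputable fun x (_ : V → ℕ) => readN x :=
  (LogComputable.const 0).scan

lemma logComputable_readK : LogComputable fun x (_ : V → ℕ) => readK x :=
  logComputable_readN.succ.scan.sub logComputable_readN.succ

lemma logComputable_header (s : ℕ) : LogComputable fun x (_ : V → ℕ) => header s x :=
  ((logComputable_readN.add logComputable_readK).add (LogComputable.const s)).add
    (LogComputable.const 3)

variable {t v j : List Bool → (V → ℕ) → ℕ}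

lemma LogComputable.digit (ht : LogComputable t) (i : ℕ) :
    LogComputable fun x e => LogspacePC.digit (readN x) (t x e) i :=
  (ht.div (logComputable_readN.pow i)).mod logComputable_readN

lemma LogComputable.swaps (ht : LogComputable t) : ∀ (m : ℕ) {v : List Bool → (V → ℕ) → ℕ},
    LogComputable v → LogComputable fun x e => LogspacePC.swaps (LogspacePC.digit (readN x) (t x e)) m (v x e)
  | 0, _, hv => hv
  | m + 1, _, hv => LogComputable.swaps ht m
      ((hv.eq (LogComputable.const m)).ite (ht.digit m)
        ((hv.eq (ht.digit m)).ite (LogComputable.const m) hv))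

lemma LogComputable.swapIndex (s : ℕ) (ht : LogComputable t) (hj : LogComputable j) :
    LogComputable fun x e => LogspacePC.swapIndex s (readN x) (t x e) (j x e) :=
  LogComputable.sum (Finset.range s) fun i =>
    (ht.swaps (s - 2) (hj.digit i)).mul (logComputable_readN.pow i)

lemma logDecidable_swapAdj (s : ℕ) (ht : LogComputable t) (hj : LogComputable j) :
    LogDecidable fun x e => SwapAdj s x (t x e) (j x e) :=
  ((logComputable_header s).add (ht.swapIndex s hj)).query.of_eq fun x e => by
    by_cases h : x[header s x + LogspacePC.swapIndex s (readN x) (t x e) (j x e)]? = some true <;>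
      simp [SwapAdj, ind, h]

lemma logDecidable_swapEntry (s : ℕ) (ht : LogComputable t) (hv : LogComputable v)
    (hj : LogComputable j) : LogDecidable fun x e => SwapEntry s x (t x e) (v x e) (j x e) := by
  have hN := logComputable_readN (V := V)
  have hK := logComputable_readK (V := V)
  have hH := logComputable_header (V := V) s
  have hT := hH.add (hN.pow s)
  have h2 := (hN.add hK).add (LogComputable.const 2)
  exact (hj.lt hN).or (((hN.lt hj).and (hj.lt (hN.succ.add hK))).or
    (((h2.le hj).and (hj.lt (h2.add (LogComputable.const s)))).or
      (((hH.le hj).and ((hj.lt hT).and (logDecidable_swapAdj s ht (hj.sub hH)))).or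
        ((hT.le hj).and (hj.lt (hT.add hv))))))

lemma logComputableList_swapInput (s : ℕ) (ht : LogComputable t) (hv : LogComputable v) :
    LogComputableList fun x e => swapInput s x (t x e) (v x e) := by
  have hlen : LogComputable fun x e => header s x + readN x ^ s + v x e + 1 :=
    (((logComputable_header s).add (logComputable_readN.pow s)).add hv).succ
  refine ⟨hlen.of_eq fun x e => by simp [swapInput], ?_⟩
  refine (((LogComputable.proj none).lt (hlen.weaken some)).and (logDecidable_swapEntry s
    (ht.weaken some) (hv.weaken some) (LogComputable.proj none))).of_iff fun x e => ?_
  simp only [swapInput, List.getElem?_map]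
  by_cases h : e none < header s x + readN x ^ s + (v x fun v => e (some v)) + 1
  · simp [h]
  · simp [h]

theorem logDecidable_detects (A : DeterministicLogspaceAlgorithm) (s : ℕ) :
    LogDecidable fun x (_ : Empty → ℕ) => Detects A s x := by
  have hN := fun {V : Type} [Fintype V] => logComputable_readN (V := V)
  have hr : ∀ {V : Type} [Fintype V] {t v : List Bool → (V → ℕ) → ℕ}, LogComputable t →
      LogComputable v → LogDecidable fun x e => A.result (swapInput s x (t x e) (v x e)) = some true :=
    fun ht hv => A.logDecidable (logComputableList_swapInput s ht hv)
  have h1 : LogDecidable fun x (e : Option Empty → ℕ) =>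
      ∑ v ∈ Finset.range (readN x), ind (A.result (swapInput s x (e none) v) = some true) = readK x :=
    (LogComputable.sum_range (V := Option Empty) (hr (LogComputable.proj (some none))
      (LogComputable.proj none)) hN).eq logComputable_readK
  have h2 : LogDecidable fun x (e : Option (Option Empty) → ℕ) =>
      (∀ i j : Fin s, i ≠ j →
        digit (readN x) (e none) i ≠ digit (readN x) (e none) j) →
      (∀ i : Fin s, A.result (swapInput s x (e (some none)) (digit (readN x) (e none) i))
        = some true) → SwapAdj s x (e (some none)) (e none) := by
    have hu : LogComputable fun _ (e : Option (Option Empty) → ℕ) => e none :=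
      LogComputable.proj none
    have ht : LogComputable fun _ (e : Option (Option Empty) → ℕ) => e (some none) :=
      LogComputable.proj (some none)
    refine LogDecidable.imp ?_ (LogDecidable.imp ?_ (logDecidable_swapAdj s ht hu))
    · refine LogDecidable.forall_fintype fun i => LogDecidable.forall_fintype fun j => ?_
      by_cases hij : i = j
      · exact (LogComputable.const 1).of_eq fun x e => (ind_of_true fun h => absurd hij h).symm
      · exact ((hu.digit i).eq (hu.digit j)).not.of_iff fun x e => ⟨fun h _ => h, fun h => h hij⟩
    · exact LogDecidable.forall_fintype fun i => hr ht (hu.digit i)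
  exact (h1.and (h2.forall_lt (hN.pow s))).exists_lt (hN.pow (s - 2))

end LogDecidable

end LogspacePC

namespace LogspacePC

/-! ### Correctness of the detection algorithm -/

/-- Permute the vertices of a hypergraph. -/
def permute {n s : ℕ} (π : Equiv.Perm (Fin n)) (G : Hypergraph n s) : Hypergraph n s :=
  fun e => G ⟨e.1.map π.toEmbedding, by rw [Finset.card_map, e.2]⟩

lemma adj_permute {n s : ℕ} (π : Equiv.Perm (Fin n)) (G : Hypergraph n s) (v : Fin s → Fin n) :
    Hypergraph.adj (permute π G) v = Hypergraph.adj G fun i => π (v i) := by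
  have h : Finset.univ.image (fun i => π (v i)) = (Finset.univ.image v).map π.toEmbedding := by
    ext w
    simp [Equiv.eq_symm_apply]
  unfold Hypergraph.adj permute
  simp only [h, Finset.card_map]

lemma swaps_congr {a b : ℕ → ℕ} : ∀ {m : ℕ}, (∀ i < m, a i = b i) → ∀ v, swaps a m v = swaps b m v
  | 0, _, _ => rfl
  | m + 1, h, v => by
    rw [swaps, swaps, h m (Nat.lt_succ_self m)]
    exact swaps_congr (fun i hi => h i (by omega)) _

lemma exists_perm_swaps {n : ℕ} {a : ℕ → ℕ} (ha : ∀ i, a i < n) : ∀ {m : ℕ}, m ≤ n →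
    ∃ π : Equiv.Perm (Fin n), ∀ v : Fin n, (π v : ℕ) = swaps a m v
  | 0, _ => ⟨1, fun _ => rfl⟩
  | m + 1, h => by
    obtain ⟨π, hπ⟩ := exists_perm_swaps ha (m := m) (by omega)
    refine ⟨Equiv.swap ⟨m, h⟩ ⟨a m, ha m⟩ |>.trans π, fun v => ?_⟩
    rw [Equiv.trans_apply, hπ, swaps, Equiv.swap_apply_def]
    congr 1
    simp only [Fin.ext_iff]
    split_ifs <;> rfl

/-- The transposition `(m a_m)` acts first, so `a_m` has to be the preimage of `τ m` under the
permutation `π` built so far. Earlier `i` are not disturbed: they differ from `m`, and from that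
preimage because `τ` is injective. -/
lemma exists_swaps_eq {n : ℕ} (hn : 0 < n) : ∀ {m : ℕ} (τ : Fin m ↪ Fin n),
    ∃ a : ℕ → ℕ, (∀ i, a i < n) ∧ ∀ i : Fin m, swaps a m i = τ i
  | 0, _ => ⟨fun _ => 0, fun _ => hn, fun i => i.elim0⟩
  | m + 1, τ => by
    have hm : m + 1 ≤ n := by simpa using Fintype.card_le_of_embedding τ
    obtain ⟨a, ha, h⟩ := exists_swaps_eq hn (Fin.castSuccEmb.trans τ)
    obtain ⟨π, hπ⟩ := exists_perm_swaps ha (m := m) (by omega)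
    have hcong := swaps_congr (a := Function.update a m (π.symm (τ (Fin.last m)))) (b := a)
      (m := m) fun i hi => Function.update_of_ne hi.ne _ _
    refine ⟨Function.update a m (π.symm (τ (Fin.last m))), fun i => ?_, fun i => ?_⟩
    · by_cases e : i = m
      · subst e; simp
      · simpa [e] using ha i
    · rw [swaps, hcong, Function.update_self]
      induction i using Fin.lastCases with
      | last => rw [Fin.val_last, if_pos rfl, ← hπ, Equiv.apply_symm_apply]
      | cast i =>
        have h1 : ((i.castSucc : Fin (m + 1)) : ℕ) ≠ m := by simpa using i.is_lt.ne
        have h2 : ((i.castSucc : Fin (m + 1)) : ℕ) ≠ π.symm (τ (Fin.last m)) := by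
          intro heq
          have h3 := h i
          rw [show (i : ℕ) = π.symm (τ (Fin.last m)) from heq, ← hπ, Equiv.apply_symm_apply] at h3
          have h4 := τ.injective (Fin.ext h3)
          exact absurd (congrArg Fin.val h4) (by simpa using i.is_lt.ne')
        rw [if_neg h1, if_neg h2]
        exact h i

lemma digit_finFunctionFinEquiv {n s : ℕ} (f : Fin s → Fin n) (i : Fin s) :
    digit n (finFunctionFinEquiv f) i = f i := by
  have := congrFun (finFunctionFinEquiv.symm_apply_apply f) i
  exact congrArg Fin.val this

lemma exists_digits {n m : ℕ} {a : ℕ → ℕ} (ha : ∀ i, a i < n) :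
    ∃ t < n ^ m, ∀ i < m, digit n t i = a i :=
  ⟨finFunctionFinEquiv fun i : Fin m => (⟨a i, ha i⟩ : Fin n), Fin.is_lt _, fun i hi =>
    digit_finFunctionFinEquiv (fun i : Fin m => (⟨a i, ha i⟩ : Fin n)) ⟨i, hi⟩⟩

/-! #### Bits of the inputs -/

lemma getElem?_unary (m a : ℕ) : (unary m)[a]? = some true ↔ a < m := by
  unfold unary
  rw [List.getElem?_append, List.length_replicate]
  split
  · simp [*]
  · rw [List.getElem?_singleton]
    simp [*]

lemma getElem?_append_eq_true (l l' : List Bool) (a : ℕ) : (l ++ l')[a]? = some true ↔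
    l[a]? = some true ∨ l.length ≤ a ∧ l'[a - l.length]? = some true := by
  rw [List.getElem?_append]
  split
  · simp; omega
  · rw [List.getElem?_eq_none (l := l) (by omega)]
    simp; omega

lemma ext_getElem?_eq_true {l l' : List Bool} (h : l.length = l'.length)
    (h' : ∀ a < l.length, l[a]? = some true ↔ l'[a]? = some true) : l = l' := by
  refine List.ext_getElem h fun a h1 h2 => ?_
  have := h' a h1
  rw [List.getElem?_eq_getElem h1, List.getElem?_eq_getElem h2] at this
  simpa using this

@[simp] lemma length_unary (m : ℕ) : (unary m).length = m + 1 := by simp [unary]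

section Encode

variable {n s : ℕ} (k : ℕ) (G : Hypergraph n s)

lemma length_encode : (encode k G).length = n + k + s + 3 + n ^ s := by
  simp [encode]; omega

lemma getElem?_encode (a : ℕ) : (encode k G)[a]? = some true ↔
    a < n ∨ (n < a ∧ a < n + 1 + k) ∨ (n + k + 2 ≤ a ∧ a < n + k + 2 + s) ∨
      (n + k + s + 3 ≤ a ∧ ∃ h : a - (n + k + s + 3) < n ^ s,
        Hypergraph.adj G (finFunctionFinEquiv.symm ⟨_, h⟩) = true) := by
  unfold encode
  simp only [getElem?_append_eq_true, getElem?_unary, List.length_append, length_unary]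
  have h1 : n + 1 + (k + 1) + (s + 1) = n + k + s + 3 := by omega
  rw [h1, List.getElem?_ofFn]
  have h2 : ∀ b, (if h : b < n ^ s then some (Hypergraph.adj G (finFunctionFinEquiv.symm ⟨b, h⟩))
      else none) = some true ↔
      ∃ h : b < n ^ s, Hypergraph.adj G (finFunctionFinEquiv.symm ⟨b, h⟩) = true := by
    intro b
    by_cases h : b < n ^ s <;> simp [h]
  rw [h2]
  constructor
  · rintro (((h | h) | h) | h)
    · exact .inl h
    · exact .inr (.inl (by omega))
    · exact .inr (.inr (.inl (by omega)))
    · exact .inr (.inr (.inr h))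
  · rintro (h | h | h | h)
    · exact .inl (.inl (.inl h))
    · exact .inl (.inl (.inr (by omega)))
    · exact .inl (.inr (by omega))
    · exact .inr h

lemma readN_encode : readN (encode k G) = n := by
  have := scan_eq (x := encode k G) (a := 0) (m := n)
    (fun j hj => (getElem?_encode k G _).2 (by omega))
    (fun h => by
      rcases (getElem?_encode k G _).1 h with h | h | h | ⟨h, -⟩ <;> omega)
  simpa [readN] using this

lemma readK_encode : readK (encode k G) = k := by
  have := scan_eq (x := encode k G) (a := n + 1) (m := k)
    (fun j hj => (getElem?_encode k G _).2 (by omega))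
    (fun h => by
      rcases (getElem?_encode k G _).1 h with h | h | h | ⟨h, -⟩ <;> omega)
  rw [readK, readN_encode, this]
  omega

lemma header_encode : header s (encode k G) = n + k + s + 3 := by
  rw [header, readN_encode, readK_encode]

variable {k G} {t : ℕ} {π : Equiv.Perm (Fin n)}

/-- Permuting the hypergraph is mere index arithmetic: the base-`n` digits of `j` are the vertices
of a tuple, and `π` acts on each of them. -/
lemma swapAdj_encode (hπ : ∀ v : Fin n, (π v : ℕ) = swaps (digit n t) (s - 2) v) {j : ℕ}
    (hj : j < n ^ s) : SwapAdj s (encode k G) t j ↔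
      Hypergraph.adj (permute π G) (finFunctionFinEquiv.symm ⟨j, hj⟩) = true := by
  have h1 : swapIndex s n t j = finFunctionFinEquiv fun i : Fin s =>
      π ((finFunctionFinEquiv.symm ⟨j, hj⟩ : Fin s → Fin n) i) := by
    rw [finFunctionFinEquiv_apply, swapIndex, Finset.sum_range]
    refine Finset.sum_congr rfl fun i _ => ?_
    rw [hπ]
    rfl
  have h2 := (finFunctionFinEquiv fun i : Fin s =>
      π ((finFunctionFinEquiv.symm ⟨j, hj⟩ : Fin s → Fin n) i)).is_lt
  have h3 : ∀ (f : Fin s → Fin n) (h : n + k + s + 3 + (finFunctionFinEquiv f : ℕ) -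
      (n + k + s + 3) < n ^ s), finFunctionFinEquiv.symm ⟨_, h⟩ = f := fun f h => by
    rw [Equiv.symm_apply_eq]
    exact Fin.ext (Nat.add_sub_cancel_left _ _)
  rw [SwapAdj, header_encode, readN_encode, getElem?_encode, adj_permute, h1]
  constructor
  · rintro (h | h | h | ⟨-, h, h'⟩)
    · omega
    · omega
    · omega
    · rwa [h3] at h'
  · intro h
    exact .inr (.inr (.inr ⟨by omega, by omega, by rwa [h3]⟩))

lemma swapInput_encode (hπ : ∀ v : Fin n, (π v : ℕ) = swaps (digit n t) (s - 2) v) (v : Fin n) :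
    swapInput s (encode k G) t v = encodeWithVertex k (permute π G) v := by
  classical
  have hlen : (swapInput s (encode k G) t v).length = n + k + s + 3 + n ^ s + v + 1 := by
    simp [swapInput, header_encode, readN_encode]
  refine ext_getElem?_eq_true ?_ fun a ha => ?_
  · rw [hlen, encodeWithVertex, List.length_append, length_encode, length_unary]
    omega
  · rw [hlen] at ha
    rw [encodeWithVertex, getElem?_append_eq_true, getElem?_encode, length_encode, getElem?_unary,
      swapInput, List.getElem?_map, List.getElem?_range]
    swap
    · rw [header_encode, readN_encode]; exact ha
    rw [Option.map_some, Option.some_inj, decide_eq_true_iff, SwapEntry, header_encode, readN_encode,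
      readK_encode]
    constructor
    · rintro (h | h | h | ⟨h, h', h''⟩ | h)
      · exact .inl (.inl h)
      · exact .inl (.inr (.inl h))
      · exact .inl (.inr (.inr (.inl h)))
      · have h3 : a - (n + k + s + 3) < n ^ s := by omega
        exact .inl (.inr (.inr (.inr ⟨h, h3, (swapAdj_encode hπ h3).1 h''⟩)))
      · exact .inr (by omega)
    · rintro ((h | h | h | ⟨h, h', h''⟩) | h)
      · exact .inl h
      · exact .inr (.inl h)
      · exact .inr (.inr (.inl h))
      · exact .inr (.inr (.inr (.inl ⟨h, by omega, (swapAdj_encode hπ h').2 h''⟩)))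
      · exact .inr (.inr (.inr (.inr (by omega))))

lemma sum_ind_eq_card (P : ℕ → Prop) (S : Finset (Fin n)) (h : ∀ v : Fin n, P v ↔ v ∈ S) :
    ∑ v ∈ Finset.range n, ind (P v) = S.card := by
  rw [Finset.sum_range, Finset.sum_congr rfl fun (v : Fin n) _ =>
    show ind (P v) = if v ∈ S then 1 else 0 by simp [ind, h]]
  simp

/-- The detection algorithm accepts only hypergraphs with a clique of the right size. -/
theorem exists_clique_of_detects {A : DeterministicLogspaceAlgorithm} (hn : 0 < n) (hs : s - 2 ≤ n)
    (h : Detects A s (encode k G)) :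
    ∃ K : Finset (Fin n), K.card = k ∧ ∀ e : Edge n s, e.1 ⊆ K → G e = true := by
  classical
  obtain ⟨t, -, h1, h2⟩ := h
  rw [readN_encode] at h1 h2
  rw [readK_encode] at h1
  -- Every `t` gives a permutation, even if its digits repeat, so soundness requires nothing of the
  -- guess.
  obtain ⟨π, hπ⟩ := exists_perm_swaps (a := digit n t) (fun i => Nat.mod_lt _ hn) hs
  set S : Finset (Fin n) := Finset.univ.filter fun v =>
    A.result (encodeWithVertex k (permute π G) v) = some true with hS
  have hmem : ∀ v : Fin n, A.result (swapInput s (encode k G) t v) = some true ↔ v ∈ S := fun v => by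
    rw [swapInput_encode hπ, hS, Finset.mem_filter]
    simp
  refine ⟨S.map π.toEmbedding, ?_, fun e he => ?_⟩
  · rw [Finset.card_map, ← h1, sum_ind_eq_card _ S hmem]
  · set e' : Finset (Fin n) := e.1.map π.symm.toEmbedding with he'
    have hcard : e'.card = s := by rw [he', Finset.card_map, e.2]
    have hsub : e' ⊆ S := by
      intro v hv
      obtain ⟨w, hw, rfl⟩ := Finset.mem_map.1 hv
      obtain ⟨z, hz, hz'⟩ := Finset.mem_map.1 (he hw)
      rw [← hz']
      simpa using hz
    let u : Fin s → Fin n := e'.orderEmbOfFin hcard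
    have hu : ∀ i, u i ∈ e' := fun i => Finset.orderEmbOfFin_mem e' hcard i
    have h3 := h2 (finFunctionFinEquiv u) (Fin.is_lt _)
      (fun i j hij h => hij ((e'.orderEmbOfFin hcard).injective (Fin.ext (by
        rwa [digit_finFunctionFinEquiv, digit_finFunctionFinEquiv] at h))))
      (fun i => by rw [digit_finFunctionFinEquiv, hmem]; exact hsub (hu i))
    rw [swapAdj_encode hπ (Fin.is_lt _), Fin.eta, Equiv.symm_apply_apply] at h3
    have himg : Finset.univ.image u = e' := by
      apply Finset.coe_injective
      simp [u]
    unfold Hypergraph.adj permute at h3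
    simp only [himg, hcard, dif_pos] at h3
    convert h3
    ext w
    simp [he']

/-- The detection algorithm accepts if the recovery algorithm succeeds after a permutation that moves
given vertices to the front. -/
theorem exists_perm_forall_detects (A : DeterministicLogspaceAlgorithm) (hn : 0 < n)
    (τ : Fin (s - 2) ↪ Fin n) :
    ∃ π : Equiv.Perm (Fin n), (∀ (i : Fin (s - 2)) (v : Fin n), (v : ℕ) = i → π v = τ i) ∧
      ∀ (k : ℕ) (G : Hypergraph n s) (K : Finset (Fin n)), K.card = k →
        (∀ e : Edge n s, e.1 ⊆ K → G e = true) →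
        (∀ v : Fin n, A.result (encodeWithVertex k (permute π G) v) = some (decide (π v ∈ K))) →
        Detects A s (encode k G) := by
  classical
  have hs : s - 2 ≤ n := by simpa using Fintype.card_le_of_embedding τ
  -- The transpositions that realize `τ` are coded by the digits of some `t < n ^ (s - 2)`, the
  -- range of the search.
  obtain ⟨a, ha, haτ⟩ := exists_swaps_eq hn τ
  obtain ⟨t, ht, hta⟩ := exists_digits (m := s - 2) ha
  obtain ⟨π, hπ⟩ := exists_perm_swaps ha hs
  have hπt : ∀ v : Fin n, (π v : ℕ) = swaps (digit n t) (s - 2) v := fun v => by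
    rw [hπ, swaps_congr hta]
  refine ⟨π, fun i v hv => Fin.ext ?_, fun k G K hK hG hA => ?_⟩
  · rw [hπ, hv, haτ]
  -- In the permuted labels the clique is the preimage of `K` under `π`.
  · have hmem : ∀ v : Fin n, A.result (swapInput s (encode k G) t v) = some true ↔
        v ∈ K.map π.symm.toEmbedding := fun v => by
      rw [swapInput_encode hπt, hA]
      simp
    refine ⟨t, by rwa [readN_encode], ?_, fun u hu hdist hin => ?_⟩
    · rw [readN_encode, readK_encode, sum_ind_eq_card _ _ hmem, Finset.card_map, hK]
    · rw [readN_encode] at hu hdist hin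
      rw [swapAdj_encode hπt hu]
      set w : Fin s → Fin n := finFunctionFinEquiv.symm ⟨u, hu⟩ with hw
      have hdig : ∀ i : Fin s, digit n u i = w i := fun i => rfl
      have hinj : Function.Injective w := fun i j hij => by
        by_contra hne
        exact hdist i j hne (by rw [hdig, hdig, hij])
      have hcard : (Finset.univ.image w).card = s := by
        rw [Finset.card_image_of_injective _ hinj, Finset.card_univ, Fintype.card_fin]
      unfold Hypergraph.adj permute
      rw [dif_pos hcard]
      refine hG _ fun z hz => ?_
      obtain ⟨y, hy, rfl⟩ := Finset.mem_map.1 hz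
      obtain ⟨i, -, rfl⟩ := Finset.mem_image.1 hy
      have h1 := hin i
      rw [hdig, hmem] at h1
      simpa using h1

end Encode

end LogspacePC

namespace LogspacePC

/-! ### The planted and the Erdős–Rényi distribution -/

instance (n : ℕ) : DiscreteMeasurableSpace (Finset (Fin n)) :=
  inferInstanceAs (@DiscreteMeasurableSpace (Finset (Fin n)) ⊤)

instance : IsProbabilityMeasure fairCoin := by
  unfold fairCoin; infer_instance

instance (n s : ℕ) : IsProbabilityMeasure (erdosRenyi n s) := by
  unfold erdosRenyi; infer_instance

lemma fairCoin_singleton (b : Bool) : fairCoin {b} = 2⁻¹ := by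
  rw [fairCoin, PMF.toMeasure_apply_singleton _ _ (measurableSet_singleton b)]
  simp

lemma erdosRenyi_singleton {n s : ℕ} (G : Hypergraph n s) :
    erdosRenyi n s {G} = 2⁻¹ ^ Fintype.card (Edge n s) := by
  simp [erdosRenyi, Measure.pi_singleton, fairCoin_singleton, Finset.prod_const, Finset.card_univ]

lemma measurePreserving_of_singleton {α : Type*} [Countable α] [MeasurableSpace α]
    [DiscreteMeasurableSpace α] {μ : Measure α} (e : α ≃ α) (h : ∀ a, μ {e a} = μ {a}) :
    MeasurePreserving e μ μ := by
  refine ⟨Measurable.of_discrete, Measure.ext_of_singleton fun a => ?_⟩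
  rw [Measure.map_apply Measurable.of_discrete (measurableSet_singleton a),
    show e ⁻¹' {a} = {e.symm a} by ext; simp [Equiv.eq_symm_apply], ← h, e.apply_symm_apply]

lemma permute_permute_symm {n s : ℕ} (π : Equiv.Perm (Fin n)) (G : Hypergraph n s) :
    permute π (permute π.symm G) = G := by
  funext e
  unfold permute
  congr 1
  ext1
  ext v
  simp

/-- Relabelling the vertices of a hypergraph with a distinguished vertex set. -/
def relabel {n s : ℕ} (π : Equiv.Perm (Fin n)) :
    Finset (Fin n) × Hypergraph n s ≃ Finset (Fin n) × Hypergraph n s where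
  toFun p := (p.1.map π.symm.toEmbedding, permute π p.2)
  invFun p := (p.1.map π.toEmbedding, permute π.symm p.2)
  left_inv p := by
    refine Prod.ext ?_ (permute_permute_symm π.symm p.2)
    ext v
    simp
  right_inv p := by
    refine Prod.ext ?_ (permute_permute_symm π p.2)
    ext v
    simp

/-- Planting commutes with relabelling, since `π e ⊆ K` exactly when `e` lies in the preimage of
`K`. -/
lemma relabel_plant {n s : ℕ} (π : Equiv.Perm (Fin n)) (p : Finset (Fin n) × Hypergraph n s) :
    relabel π (p.1, plant p.1 p.2) =
      ((relabel π p).1, plant (relabel π p).1 (relabel π p).2) := by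
  refine Prod.ext rfl (funext fun e => ?_)
  have h : e.1.map π.toEmbedding ⊆ p.1 ↔ e.1 ⊆ p.1.map π.symm.toEmbedding := by
    simp only [Finset.subset_iff, Finset.mem_map]
    constructor
    · exact fun H v hv => ⟨π v, H ⟨v, hv, rfl⟩, by simp⟩
    · rintro H _ ⟨v, hv, rfl⟩
      obtain ⟨w, hw, rfl⟩ := H hv
      simpa using hw
  exact congrArg (· || p.2 ⟨e.1.map π.toEmbedding, _⟩) (decide_eq_decide.2 h)

section Planted

variable {n k : ℕ} (s : ℕ)

lemma isProbabilityMeasure_uniformOn_card (hk : k ≤ n) :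
    IsProbabilityMeasure (uniformOn {K : Finset (Fin n) | K.card = k}) := by
  refine isProbabilityMeasure_uniformOn (Set.toFinite _) ?_
  obtain ⟨K, -, hK⟩ := Finset.exists_subset_card_eq (s := (Finset.univ : Finset (Fin n)))
    (n := k) (by simpa using hk)
  exact ⟨K, hK⟩

lemma isProbabilityMeasure_plantedClique (hk : k ≤ n) :
    IsProbabilityMeasure (plantedClique n s k) := by
  have := isProbabilityMeasure_uniformOn_card hk
  exact Measure.isProbabilityMeasure_map Measurable.of_discrete.aemeasurable

lemma ae_plantedClique (hk : k ≤ n) :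
    ∀ᵐ p ∂plantedClique n s k,
      p.1.card = k ∧ ∀ e : Edge n s, e.1 ⊆ p.1 → p.2 e = true := by
  have := isProbabilityMeasure_uniformOn_card hk
  unfold plantedClique
  rw [ae_map_iff Measurable.of_discrete.aemeasurable MeasurableSet.of_discrete]
  have h : ∀ᵐ K ∂uniformOn {K : Finset (Fin n) | K.card = k}, K.card = k :=
    ae_cond_mem MeasurableSet.of_discrete
  filter_upwards [Measure.quasiMeasurePreserving_fst.ae h] with p hp
  exact ⟨hp, fun e he => by simp [plant, he]⟩

/-- Before planting, the pair is uniform on `k`-sets times hypergraphs, and `relabel` is a bijection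
that keeps the size of the set, so point masses agree. `relabel_plant` transfers the invariance to
the planted law. -/
lemma measurePreserving_relabel (hk : k ≤ n) (π : Equiv.Perm (Fin n)) :
    MeasurePreserving (relabel π) (plantedClique n s k) (plantedClique n s k) := by
  have := isProbabilityMeasure_uniformOn_card hk
  set μ := (uniformOn {K : Finset (Fin n) | K.card = k}).prod (erdosRenyi n s) with hμ
  have h : MeasurePreserving (relabel π) μ μ := by
    refine measurePreserving_of_singleton _ fun p => ?_
    have hs : ∀ q : Finset (Fin n) × Hypergraph n s, ({q} : Set _) = {q.1} ×ˢ {q.2} := fun q => by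
      simp
    rw [hs, hs p, hμ, Measure.prod_prod, Measure.prod_prod, erdosRenyi_singleton,
      erdosRenyi_singleton]
    congr 1
    rw [uniformOn, cond_apply MeasurableSet.of_discrete, cond_apply MeasurableSet.of_discrete]
    congr 1
    have hc : ∀ K : Finset (Fin n), Measure.count ({K : Finset (Fin n) | K.card = k} ∩ {K}) =
        if K.card = k then 1 else 0 := fun K => by
      split_ifs with hK
      · rw [Set.inter_eq_right.2 (by simpa using hK), Measure.count_singleton]
      · rw [Set.inter_singleton_eq_empty.2 (by simpa using hK), measure_empty]
    rw [hc, hc]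
    simp [relabel]
  refine ⟨Measurable.of_discrete, ?_⟩
  unfold plantedClique
  rw [Measure.map_map Measurable.of_discrete Measurable.of_discrete]
  conv_rhs => rw [← hμ, ← h.map_eq, Measure.map_map Measurable.of_discrete Measurable.of_discrete]
  congr 1
  funext p
  exact relabel_plant π p

end Planted

lemma card_embeddings_subset {n m : ℕ} (K : Finset (Fin n)) :
    (Finset.univ.filter fun τ : Fin m ↪ Fin n => ∀ i, τ i ∈ K).card = K.card.descFactorial m := by
  classical
  rw [← Fintype.card_subtype]
  have e : {τ : Fin m ↪ Fin n // ∀ i, τ i ∈ K} ≃ (Fin m ↪ K) :=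
    { toFun := fun τ => ⟨fun i => ⟨τ.1 i, τ.2 i⟩, fun i j h => τ.1.injective (by simpa using h)⟩
      invFun := fun σ => ⟨σ.trans (Function.Embedding.subtype _), fun i => (σ i).2⟩
      left_inv := fun τ => rfl
      right_inv := fun σ => rfl }
  rw [Fintype.card_congr e, Fintype.card_embedding_eq]
  simp

/-- The probability that the detection algorithm accepts a planted hypergraph is at least the
probability that the recovery algorithm succeeds. -/
lemma leakedClique_le_plantedClique (A : DeterministicLogspaceAlgorithm) {n s k : ℕ} (hn : 0 < n)
    (hk : k ≤ n) (hsk : s - 2 ≤ k) :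
    (leakedClique n s k).real
        {p | ∀ v : Fin n, A.result (encodeWithVertex k p.2 v) = some (decide (v ∈ p.1))} ≤
      (plantedClique n s k).real {p | Detects A s (encode k p.2)} := by
  classical
  have := isProbabilityMeasure_plantedClique s hk
  set P := plantedClique n s k
  set leak : Set (Finset (Fin n) × Hypergraph n s) :=
    {p | ∀ v : Fin n, (v : ℕ) < s - 2 → v ∈ p.1} with hleak
  set good : Set (Finset (Fin n) × Hypergraph n s) :=
    {p | ∀ v : Fin n, A.result (encodeWithVertex k p.2 v) = some (decide (v ∈ p.1))} with hgood
  set D : Set (Finset (Fin n) × Hypergraph n s) := {p | Detects A s (encode k p.2)} with hD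
  choose π hπ hdet using exists_perm_forall_detects (s := s) A hn
  set N := k.descFactorial (s - 2)
  have hN : (0 : ℝ) < N := by exact_mod_cast Nat.descFactorial_pos.2 hsk
  -- Relabelling by `π τ` brings the tuple `τ` to the front, so leakage occurs exactly when `τ`
  -- takes its values in the planted set.
  have hmem : ∀ τ p, relabel (π τ) p ∈ leak ↔ ∀ i, τ i ∈ p.1 := fun τ p => by
    simp only [hleak, relabel, Equiv.coe_fn_mk, Set.mem_ofPred_eq, Finset.mem_map_equiv,
      Equiv.symm_symm]
    constructor
    · intro h i
      rw [← hπ τ i ⟨i, by omega⟩ rfl]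
      exact h _ i.2
    · intro h v hv
      rw [hπ τ ⟨v, hv⟩ v rfl]
      exact h _
  -- By invariance of the planted law, each guess `τ` contributes the same probability.
  have hsum : ∀ E : Set (Finset (Fin n) × Hypergraph n s),
      ∫ p, ∑ τ : Fin (s - 2) ↪ Fin n, (if relabel (π τ) p ∈ E then (1 : ℝ) else 0) ∂P =
        Fintype.card (Fin (s - 2) ↪ Fin n) * P.real E := fun E => by
    rw [integral_finsetSum _ fun τ _ => Integrable.of_finite]
    have h1 : ∀ τ : Fin (s - 2) ↪ Fin n,
        ∫ p, (if relabel (π τ) p ∈ E then (1 : ℝ) else 0) ∂P = P.real E := fun τ => by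
      have h2 := integral_indicator_one (μ := P) (s := relabel (π τ) ⁻¹' E)
        MeasurableSet.of_discrete
      rw [measureReal_def, (measurePreserving_relabel s hk (π τ)).measure_preimage
        MeasurableSet.of_discrete.nullMeasurableSet] at h2
      rw [measureReal_def, ← h2]
      refine integral_congr_ae (Eventually.of_forall fun p => ?_)
      simp [Set.indicator_apply]
    simp [h1]
  -- For `E = leak` the integrand is the number of tuples inside the planted set, almost surely the
  -- constant `N`.
  have hL : Fintype.card (Fin (s - 2) ↪ Fin n) * P.real leak = N := by
    rw [← hsum, integral_congr_ae (g := fun _ => (N : ℝ))]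
    · simp
    · filter_upwards [ae_plantedClique s hk] with p hp
      simp only [hmem]
      rw [Finset.sum_boole, card_embeddings_subset, hp.1]
  -- For `E = leak ∩ good` the integrand is at most `N`, and it vanishes unless the detector
  -- accepts, because one good guess suffices for acceptance. Dividing by `hL` gives the conditional
  -- probability.
  have hG : Fintype.card (Fin (s - 2) ↪ Fin n) * P.real (leak ∩ good) ≤ N * P.real D := by
    rw [← hsum, ← integral_indicator_one MeasurableSet.of_discrete, ← integral_const_mul]
    refine integral_mono_ae Integrable.of_finite Integrable.of_finite ?_
    filter_upwards [ae_plantedClique s hk] with p hp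
    by_cases hpD : p ∈ D
    · have hNp : N = (Finset.univ.filter fun τ : Fin (s - 2) ↪ Fin n => ∀ i, τ i ∈ p.1).card := by
        rw [card_embeddings_subset, hp.1]
      rw [Set.indicator_of_mem hpD, Pi.one_apply, mul_one, hNp, ← Finset.sum_boole]
      refine Finset.sum_le_sum fun τ _ => ?_
      simp only [← hmem, Set.mem_inter_iff]
      split_ifs <;> simp_all
    · rw [Finset.sum_eq_zero]
      · exact mul_nonneg hN.le (Set.indicator_nonneg (fun _ _ => zero_le_one) _)
      · refine fun τ _ => if_neg fun h => hpD (hdet τ k p.2 p.1 hp.1 hp.2 fun v => ?_)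
        have h3 := h.2 v
        simpa [relabel] using h3
  have hT : (0 : ℝ) < Fintype.card (Fin (s - 2) ↪ Fin n) := by
    refine lt_of_le_of_ne (by positivity) fun h => ?_
    rw [← h, zero_mul] at hL
    exact hN.ne hL
  have hLpos : 0 < P.real leak := pos_of_mul_pos_right (hL ▸ hN) hT.le
  have hreal : (leakedClique n s k).real good = (P.real leak)⁻¹ * P.real (leak ∩ good) := by
    unfold leakedClique
    rw [measureReal_def, cond_apply MeasurableSet.of_discrete, ENNReal.toReal_mul,
      ENNReal.toReal_inv]
    rfl
  rw [hreal, inv_mul_le_iff₀ hLpos]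
  refine le_of_mul_le_mul_left ?_ hT
  rwa [← mul_assoc, hL]

end LogspacePC

/-! ### First-moment bound for cliques, and preparations for the limit. -/

namespace LogspacePC

/-- The probability that a random hypergraph contains a clique with `k` vertices. -/
lemma erdosRenyi_clique_le {n s k : ℕ} {E : Set (Hypergraph n s)}
    (hE : ∀ G ∈ E, ∃ K : Finset (Fin n), K.card = k ∧ ∀ e : Edge n s, e.1 ⊆ K → G e = true) :
    (erdosRenyi n s).real E ≤ n.choose k * (1 / 2) ^ k.choose s := by
  classical
  have h1 : ∀ K : Finset (Fin n), K.card = k →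
      (erdosRenyi n s).real {G | ∀ e : Edge n s, e.1 ⊆ K → G e = true} =
        (1 / 2) ^ k.choose s := fun K hK => by
    have h2 : {G : Hypergraph n s | ∀ e : Edge n s, e.1 ⊆ K → G e = true} =
        Set.pi Set.univ fun e => if e.1 ⊆ K then {true} else Set.univ := by
      ext G
      simp only [Set.mem_ofPred_eq, Set.mem_pi, Set.mem_univ, true_imp_iff]
      refine forall_congr' fun e => ?_
      split_ifs with h <;> simp [h]
    have h3 : (Finset.univ.filter fun e : Edge n s => e.1 ⊆ K).card = k.choose s := by
      rw [← hK, ← Finset.card_powersetCard]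
      refine Finset.card_bij (fun e _ => e.1) (fun e he => ?_) (fun _ _ _ _ h => Subtype.ext h)
        fun e he => ?_
      · exact Finset.mem_powersetCard.2 ⟨(Finset.mem_filter.1 he).2, e.2⟩
      · obtain ⟨h4, h5⟩ := Finset.mem_powersetCard.1 he
        exact ⟨⟨e, h5⟩, by simpa using h4, rfl⟩
    have h6 : ∀ e : Edge n s, fairCoin (if e.1 ⊆ K then {true} else Set.univ) =
        if e.1 ⊆ K then 2⁻¹ else 1 := fun e => by
      split_ifs
      · exact fairCoin_singleton true
      · exact measure_univ
    rw [measureReal_def, h2, erdosRenyi, Measure.pi_pi, Finset.prod_congr rfl fun e _ => h6 e,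
      Finset.prod_ite, Finset.prod_const, Finset.prod_const_one, mul_one, h3]
    simp
  have h7 : E ⊆ ⋃ K ∈ Finset.powersetCard k (Finset.univ : Finset (Fin n)),
      {G | ∀ e : Edge n s, e.1 ⊆ K → G e = true} := fun G hG => by
    obtain ⟨K, hK, h⟩ := hE G hG
    exact Set.mem_biUnion (Finset.mem_coe.2 (Finset.mem_powersetCard.2 ⟨K.subset_univ, hK⟩)) h
  calc (erdosRenyi n s).real E
      ≤ _ := measureReal_mono h7 (measure_ne_top _ _)
    _ ≤ _ := measureReal_biUnion_finset_le _ _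
    _ = ∑ K ∈ Finset.powersetCard k (Finset.univ : Finset (Fin n)), (1 / 2) ^ k.choose s :=
      Finset.sum_congr rfl fun K hK => h1 K (Finset.mem_powersetCard.1 hK).2
    _ = _ := by simp

/-- The expected number of cliques with `k` vertices tends to `0`. -/
lemma tendsto_expected_cliques {s : ℕ} (hs : 3 ≤ s) {n k : ℕ → ℕ} (hn : Tendsto n atTop atTop)
    (hk : (fun i => Real.logb 2 (n i) ^ ((1 : ℝ) / ((s : ℝ) - 1))) =o[atTop]
      fun i => (k i : ℝ)) (hk_top : Tendsto k atTop atTop) :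
    Tendsto (fun i => ((n i).choose (k i) : ℝ) * (1 / 2) ^ (k i).choose s) atTop (nhds 0) := by
  -- `M` absorbs `2 ^ s * s!` from `(k / 2) ^ s / s! ≤ k.choose s` and a factor `2` from `k + 1 ≤ 2
  -- * k`.
  set M : ℝ := 2 ^ (s + 1) * s.factorial with hM
  have hM0 : 0 < M := by positivity
  have hs1 : (0 : ℝ) < (s : ℝ) - 1 := by
    have : (3 : ℝ) ≤ s := by exact_mod_cast hs
    linarith
  have hbound : ∀ᶠ i in atTop,
      ((n i).choose (k i) : ℝ) * (1 / 2) ^ (k i).choose s ≤ ((n i : ℝ))⁻¹ := by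
    filter_upwards [hk.bound (show (0 : ℝ) < M⁻¹ ^ ((1 : ℝ) / ((s : ℝ) - 1)) by positivity),
      hn.eventually_ge_atTop 1, hk_top.eventually_ge_atTop (2 * s)] with i hi hni hki
    have hn0 : (0 : ℝ) < n i := by exact_mod_cast hni
    have hk0 : (0 : ℝ) < k i := by exact_mod_cast (by omega : 0 < k i)
    have hlog : 0 ≤ Real.logb 2 (n i) := Real.logb_nonneg one_lt_two (by exact_mod_cast hni)
    have h1 : M * Real.logb 2 (n i) ≤ (k i : ℝ) ^ (s - 1) := by
      rw [Real.norm_of_nonneg (by positivity), Real.norm_of_nonneg hk0.le] at hi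
      have h2 := Real.rpow_le_rpow (by positivity) hi hs1.le
      rw [Real.mul_rpow (by positivity) hk0.le, ← Real.rpow_mul hlog,
        ← Real.rpow_mul (by positivity), one_div, inv_mul_cancel₀ hs1.ne', Real.rpow_one,
        Real.rpow_one, show (s : ℝ) - 1 = ((s - 1 : ℕ) : ℝ) by
          rw [Nat.cast_sub (by omega), Nat.cast_one], Real.rpow_natCast] at h2
      rwa [← le_inv_mul_iff₀ hM0]
    have h3 : ((k i : ℝ) / 2) ^ s / s.factorial ≤ (k i).choose s := by
      refine le_trans ?_ (Nat.pow_le_choose s (k i))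
      gcongr
      rw [div_le_iff₀ two_pos]
      exact_mod_cast (by omega : k i ≤ (k i + 1 - s) * 2)
    -- With `k + 1` in place of `k`, the union bound, whose binomial coefficient costs `n ^ k`,
    -- still leaves a factor `1 / n`.
    have h4 : ((k i + 1 : ℕ) : ℝ) * Real.logb 2 (n i) ≤ (k i).choose s := by
      refine le_trans ?_ h3
      rw [div_pow, div_div, le_div_iff₀ (by positivity)]
      have h5 : (k i : ℝ) ^ s = (k i : ℝ) ^ (s - 1) * k i := by
        rw [← pow_succ, Nat.sub_add_cancel (by omega)]
      have h6 : ((k i + 1 : ℕ) : ℝ) ≤ 2 * k i := by exact_mod_cast (by omega : k i + 1 ≤ 2 * k i)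
      calc ((k i + 1 : ℕ) : ℝ) * Real.logb 2 (n i) * (2 ^ s * s.factorial)
          ≤ 2 * k i * Real.logb 2 (n i) * (2 ^ s * s.factorial) := by gcongr
        _ = M * Real.logb 2 (n i) * k i := by rw [hM]; ring
        _ ≤ (k i : ℝ) ^ (s - 1) * k i := by gcongr
        _ = (k i : ℝ) ^ s := h5.symm
    have h7 : (n i : ℝ) ^ (k i + 1) ≤ 2 ^ (k i).choose s := by
      have h8 : (n i : ℝ) ^ (k i + 1) = 2 ^ (((k i + 1 : ℕ) : ℝ) * Real.logb 2 (n i)) := by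
        rw [mul_comm, Real.rpow_mul two_pos.le, Real.rpow_logb two_pos (by norm_num) hn0,
          Real.rpow_natCast]
      rw [h8, ← Real.rpow_natCast]
      exact Real.rpow_le_rpow_of_exponent_le one_le_two h4
    rw [one_div, inv_pow, ← div_eq_mul_inv, div_le_iff₀ (by positivity), ← div_eq_inv_mul,
      le_div_iff₀ hn0]
    refine le_trans ?_ h7
    rw [pow_succ]
    gcongr
    exact_mod_cast Nat.choose_le_pow (n i) (k i)
  refine squeeze_zero' (Eventually.of_forall fun i => by positivity) hbound ?_
  exact tendsto_inv_atTop_zero.comp (tendsto_natCast_atTop_atTop.comp hn)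

open Classical in
lemma outputProb_eq {A : RandomizedLogspaceAlgorithm} {P : List Bool → Prop}
    (hA : ∀ x r, x ≠ [] → r.length = A.time.eval x.length →
      A.machine.result x r = some (decide (P x))) {x : List Bool} (hx : x ≠ []) (b : Bool) :
    A.outputProb x b = if decide (P x) = b then 1 else 0 := by
  unfold RandomizedLogspaceAlgorithm.outputProb
  have h : ∀ r : Fin (A.time.eval x.length) → Bool,
      A.machine.result x (List.ofFn r) = some (decide (P x)) := fun r => hA x _ hx (by simp)
  split_ifs with hb <;> simp [h, hb]

lemma encode_ne_nil {n s : ℕ} (k : ℕ) (G : Hypergraph n s) : encode k G ≠ [] :=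
  List.ne_nil_of_length_pos (by rw [length_encode]; omega)

/-- The conjecture demands `k ≤ n`, which the growth condition provides only eventually: the
comparison `n ^ (1/2 - δ)` over `n` has the negative exponent `-(1/2 + δ)`. -/
lemma eventually_le_of_isBigO_rpow {n k : ℕ → ℕ} (hn : Tendsto n atTop atTop) {δ : ℝ} (hδ : 0 < δ)
    (hk : (fun i => (k i : ℝ)) =O[atTop] fun i => (n i : ℝ) ^ ((1 : ℝ) / 2 - δ)) :
    ∀ᶠ i in atTop, k i ≤ n i := by
  have hn' : Tendsto (fun i => (n i : ℝ)) atTop atTop := tendsto_natCast_atTop_atTop.comp hn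
  have h : (fun x : ℝ => x ^ ((1 : ℝ) / 2 - δ)) =o[atTop] fun x => x := by
    refine (isLittleO_iff_tendsto' ?_).2 ?_
    · filter_upwards [eventually_ne_atTop 0] with x hx hx0 using absurd hx0 hx
    · refine (tendsto_rpow_neg_atTop (show (0 : ℝ) < 1 / 2 + δ by positivity)).congr' ?_
      filter_upwards [eventually_gt_atTop 0] with x hx
      rw [← Real.rpow_sub_one hx.ne']
      congr 1
      ring
  filter_upwards [(hk.trans_isLittleO (h.comp_tendsto hn')).bound one_pos] with i hi
  simpa using hi

end LogspacePC

/-! ### The contradiction with the conjecture. -/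

theorem mainTheorem10 (s : ℕ) (hs : 3 ≤ s) (n k : ℕ → ℕ)
    (hn_mono : Monotone n) (hk_mono : Monotone k)
    (hn_pos : ∀ i, 0 < n i) (hk_pos : ∀ i, 0 < k i)
    (hn : Tendsto n atTop atTop)
    (hk_lower : (fun i => Real.logb 2 (n i) ^ ((1 : ℝ) / ((s : ℝ) - 1))) =o[atTop]
      fun i => (k i : ℝ))
    (δ : ℝ) (hδ : 0 < δ)
    (hk_upper : (fun i => (k i : ℝ)) =O[atTop] fun i => (n i : ℝ) ^ ((1 : ℝ) / 2 - δ))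
    (hconj : LogspacePC.HPCConjSpace) :
    ¬ ∃ A : LogspacePC.DeterministicLogspaceAlgorithm,
        LogspacePC.SolvesLeakedRecovery A s n k := by
  classical
  rintro ⟨A, c, hc, hsolves⟩
  have hs1 : (0 : ℝ) < (s : ℝ) - 1 := by
    have : (3 : ℝ) ≤ s := by exact_mod_cast hs
    linarith
  have hk_top : Tendsto k atTop atTop := by
    have h1 : Tendsto (fun i => Real.logb 2 (n i) ^ ((1 : ℝ) / ((s : ℝ) - 1))) atTop atTop :=
      (tendsto_rpow_atTop (by positivity)).comp ((Real.tendsto_logb_atTop one_lt_two).comp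
        (tendsto_natCast_atTop_atTop.comp hn))
    refine (tendsto_natCast_atTop_iff (R := ℝ)).1 (tendsto_atTop_mono' _ ?_ h1)
    filter_upwards [hk_lower.bound one_pos] with i hi
    simpa using (le_abs_self _).trans hi
  obtain ⟨B, hB⟩ := (LogspacePC.logDecidable_detects A s).exists_algorithm
  -- Initial terms may violate `k ≤ n`, so the conjecture is applied to the sequences shifted by
  -- `i₀`.
  obtain ⟨i₀, hi₀⟩ := eventually_atTop.1 (LogspacePC.eventually_le_of_isBigO_rpow hn hδ hk_upper)
  have hshift : Tendsto (fun i => i + i₀) atTop atTop := tendsto_add_atTop_nat i₀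
  have hlim := hconj B.toRandomizedLogspaceAlgorithm s hs (fun i => n (i + i₀))
    (fun i => k (i + i₀)) (fun i j h => hn_mono (by omega)) (fun i j h => hk_mono (by omega))
    (fun i => hn_pos _) (fun i => hk_pos _) (hn.comp hshift) (fun i => hi₀ _ (by omega))
    ⟨δ, hδ, hk_upper.comp_tendsto hshift⟩
  have hnull := (LogspacePC.tendsto_expected_cliques hs hn hk_lower hk_top).comp hshift
  have hlow : ∀ᶠ i in atTop, 1 - ((n (i + i₀)).choose (k (i + i₀)) : ℝ) *
        (1 / 2) ^ (k (i + i₀)).choose s + c ≤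
      (∫ G, B.outputProb (LogspacePC.encode (k (i + i₀)) G) false
        ∂(LogspacePC.erdosRenyi (n (i + i₀)) s)) +
      ∫ p, B.outputProb (LogspacePC.encode (k (i + i₀)) p.2) true
        ∂(LogspacePC.plantedClique (n (i + i₀)) s (k (i + i₀))) := by
    -- `s - 2 ≤ k` gives the leakage event positive probability.
    filter_upwards [hshift.eventually hsolves,
      hshift.eventually (hk_top.eventually_ge_atTop (s - 2))] with i hi hsk
    have hkn : k (i + i₀) ≤ n (i + i₀) := hi₀ _ (by omega)
    generalize n (i + i₀) = m, k (i + i₀) = l, hn_pos (i + i₀) = hm at *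
    refine add_le_add ?_ ?_
    · have h1 : ∀ G : LogspacePC.Hypergraph m s,
          B.outputProb (LogspacePC.encode l G) false =
            Set.indicator {G | LogspacePC.Detects A s (LogspacePC.encode l G)}ᶜ 1 G := fun G => by
        rw [LogspacePC.outputProb_eq hB (LogspacePC.encode_ne_nil l G)]
        simp [Set.indicator_apply]
      simp_rw [h1]
      rw [integral_indicator_one MeasurableSet.of_discrete,
        probReal_compl_eq_one_sub MeasurableSet.of_discrete]
      gcongr
      exact LogspacePC.erdosRenyi_clique_le fun G hG =>
        LogspacePC.exists_clique_of_detects hm (by omega) hG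
    · have h1 : ∀ p : Finset (Fin m) × LogspacePC.Hypergraph m s,
          B.outputProb (LogspacePC.encode l p.2) true =
            Set.indicator {p | LogspacePC.Detects A s (LogspacePC.encode l p.2)} 1 p := fun p => by
        rw [LogspacePC.outputProb_eq hB (LogspacePC.encode_ne_nil l p.2)]
        simp [Set.indicator_apply]
      simp_rw [h1]
      rw [integral_indicator_one MeasurableSet.of_discrete]
      exact hi.trans (LogspacePC.leakedClique_le_plantedClique A hm hkn hsk)
  -- The limit of the lower bound is `1 - 0 + c`, while the conjecture says `1`.
  have h := le_of_tendsto_of_tendsto ((tendsto_const_nhds.sub hnull).add_const c) hlim hlow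
  linarith
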